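/- Let $f(q)=\sum_{n\ge 0}(1-q)(1-q^2)\cdots(1-q^n)$ and let $F(x)=e^{-1/(24x)}f(e^{-1/x})=\sum_{n\ge0}a_nx^{-n}\in\mathbb Q[[1/x]]$ (so $a_0=1$). Let $\chi$ be the primitive character of conductor $12$ ($\chi(n)=1$ for $n\equiv 1,11$, $\chi(n)=-1$ for $n\equiv5,7 \bmod 12$, $\chi(n)=0$ otherwise), $\eta$ the Dedekind eta function, $\tilde\eta(z)=\sum_{n\ge1}\chi(n)\,n\,e^{\pi i n^2z/12}$ for $\operatorname{Im}z>0$, $\gamma_\theta=\{re^{i\theta}:r\ge0\}$, and $\mathcal N=\{n^2\pi^2/6: n\ge 1,\ n\equiv1,5,7,11\bmod 12\}=\{\eta_1<\eta_2<\dots\}$. (a) The Borel transform $\sum_{n\ge0}a_{n+1}p^n/n!$ of $F$ converges for $|p|<\pi^2/6$ to $$G(p)=\frac{3\pi}{2\sqrt2}\sum_{n\ge1}\frac{\chi(n)\,n}{(n^2\pi^2/6-p)^{5/2}},$$ where the series converges absolutely for $p\in\mathbb C\setminus[\pi^2/6,\infty)$ (principal branches). $G$ continues analytically along every path in $\mathbb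 C\setminus\mathcal N$ starting at $0$; every branch is given by the same series with some determination of each square root. The singularities are exactly the points of $\mathcal N$, and around each of them $G$ is double-valued: near $n^2\pi^2/6\in\mathcal N$ every branch has the form $A(p)\pm c_n(n^2\pi^2/6-p)^{-5/2}$ with $A$ analytic and $c_n=\frac{3\pi}{2\sqrt2}\chi(n)n\neq0$. An average $\mathbf m$ is a family of weights $\mathbf m^{\epsilon_1,\dots,\epsilon_r}$ ($\epsilon_i=\pm$, $r\ge 0$) with $\mathbf m^{\emptyset}=1$ and $\mathbf m^{\epsilon_1,\dots,\epsilon_r}=\mathbf m^{\epsilon_1,\dots,\epsilon_r,+}+\mathbf m^{\epsilon_1,\dots,\epsilon_r,-}$. For a function $g$ ramified over $\mathcal N$, $\mathbf mg=\sum_{\epsilon}\mathbf m^{\epsilon_1,\dots,\epsilon_r}g^{\epsilon_1,\dots,\epsilon_r}$ on $(\eta_r,\eta_{r+1})$, where $g^{\epsilon_1,\dots,\epsilon_r}$ is the continuation of $g$ passing $\eta_i$ from above if $\epsilon_i=+$ and from below if $\epsilon_i=-$. The Laplace transform $\mathcal L^{\mathbf m}G(x)$ of $\mathbf mG$ is the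 limit for $R\to\infty$ of the averages, with the weights $\mathbf m^{\epsilon_1,\dots,\epsilon_R}$, of the integrals of $e^{-xp}G(p)$ along paths from $0$ to a point of $(\eta_R,\eta_{R+1})$ (the midpoint) passing $\eta_1,\dots,\eta_R$ as prescribed by $\epsilon$; and $S^{\mathbf m}(x)=a_0+\mathcal L^{\mathbf m}G(x)$. Let $\mathbf{mur}$ (resp. $\mathbf{mul}$) have weight $1$ if all $\epsilon_i=+$ (resp. all $\epsilon_i=-$) and $0$ otherwise, and $\mathbf{med}=\frac12(\mathbf{mur}+\mathbf{mul})$. An average is reality-preserving if its weights are real and $\mathbf mg$ is real whenever $g$ is real on the real axis to the left of $\eta_1$. (b) $S^{\mathbf{mur}}$ and $S^{\mathbf{mul}}$ are defined for $\operatorname{Re}x>0$ and extend analytically to the sectors $\arg x\in(-5\pi/2,\pi/2)$ and $\arg x\in(-\pi/2,5\pi/2)$, respectively, of the Riemann surface of $\log x$, where for $\epsilon\in(0,2\pi)$ $$S^{\mathbf{mur}}(x)=1+\int_{\gamma_{\epsilon}}e^{-xp}G(p)\,dp=\sqrt3\,x^{3/2}\int_{\gamma_{\arg x+\epsilon}}\frac{\eta(2\pi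 iz)}{(x-z)^{3/2}}dz\quad\text{if }|\arg x+\epsilon|<\pi/2,$$ $$S^{\mathbf{mul}}(x)=1+\int_{\gamma_{-\epsilon}}e^{-xp}G(p)\,dp=\sqrt3\,x^{3/2}\int_{\gamma_{\arg x-\epsilon}}\frac{\eta(2\pi iz)}{(x-z)^{3/2}}dz\quad\text{if }|\arg x-\epsilon|<\pi/2,$$ with absolutely convergent integrals, the branch of $x^{3/2}(x-z)^{-3/2}$ being $1$ at $z=0$. (c) $\mathbf{med}$ is a reality-preserving average, and for every reality-preserving average $\mathbf m$ and $\operatorname{Re}x>0$, the sum $S^{\mathbf m}(x)$ exists, does not depend on $\mathbf m$, and equals $$S^{\mathbf{med}}(x)=\tfrac12\big(S^{\mathbf{mur}}(x)+S^{\mathbf{mul}}(x)\big)=\frac{\sqrt3\,x^{3/2}}2\Big(\int_{\gamma_{\arg x+\epsilon}}\frac{\eta(2\pi iz)}{(x-z)^{3/2}}dz+\int_{\gamma_{\arg x-\epsilon}}\frac{\eta(2\pi iz)}{(x-z)^{3/2}}dz\Big)$$ for $\epsilon>0$ with $|\arg x|+\epsilon<\pi/2$. Moreover $\overline{S^{\mathbf{med}}(x)}=S^{\mathbf{med}}(\overline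 x)$. (d) For $\operatorname{Re}x>0$, $$\delta(x):=\tfrac12\big(S^{\mathbf{mur}}(x)-S^{\mathbf{mul}}(x)\big)=i\sqrt2(\pi x)^{3/2}\tilde\eta(2\pi ix)=i\sqrt2(\pi x)^{3/2}\sum_{n\ge1}\chi(n)\,n\,e^{-n^2\pi^2x/6}.$$ This is a lacunary series (the gaps between consecutive exponents $\eta_k$ tend to infinity), the line $\operatorname{Re}x=0$ is its natural boundary ($\delta$ has no analytic continuation to a neighbourhood of any of its points), and $\delta$ has a radial limit $\lim_{t\to0^+}\delta(x_0+t)$ at every $x_0\in\frac1{2\pi i}\mathbb Q$. -/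

import Mathlib

open Filter Topology MeasureTheory Set
open scoped Real

noncomputable section

namespace KZ

/-! ### The formal series and its Borel transform

Formal power series in `1/x` are represented as formal power series in the variable `u = 1/x`. -/

/-- The power series `e^{a u}`. -/
def expSeries (a : ℚ) : PowerSeries ℚ := PowerSeries.rescale a (PowerSeries.exp ℚ)

/-- `(q)_n = (1-q)(1-q^2)⋯(1-q^n)` at `q = e^{-u}`, as a power series in `u`. -/
def qFactorial (n : ℕ) : PowerSeries ℚ :=
  ∏ k ∈ Finset.range n, (1 - expSeries (-((k : ℚ) + 1)))

/-- The series `f(e^{-u}) = ∑_{n ≥ 0} (q)_n`, `q = e^{-u}`. As `(q)_n` is divisible by `u^n`, only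
the terms with `n ≤ m` contribute to the coefficient of `u^m`. -/
def kzSeries : PowerSeries ℚ :=
  PowerSeries.mk fun m => ∑ n ∈ Finset.range (m + 1), PowerSeries.coeff m (qFactorial n)

/-- `F = e^{-u/24} f(e^{-u})`, i.e. `F(x) = e^{-1/(24x)} f(e^{-1/x})`. -/
def F : PowerSeries ℚ := expSeries (-1 / 24) * kzSeries

/-- The formal Borel transform `∑ aₙ x^{-n} ↦ ∑ a_{n+1} pⁿ / n!`. -/
def borel (A : PowerSeries ℚ) : PowerSeries ℚ :=
  PowerSeries.mk fun n => PowerSeries.coeff (n + 1) A / (n.factorial : ℚ)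

/-- The primitive character of conductor `12`. -/
def chi (n : ℕ) : ℤ :=
  if n % 12 = 1 ∨ n % 12 = 11 then 1
  else if n % 12 = 5 ∨ n % 12 = 7 then -1
  else 0

/-- The coefficient `c_n = (3π / (2√2)) χ(n) n`. -/
def coeffG (n : ℕ) : ℂ := ((3 * π / (2 * √2) : ℝ) : ℂ) * (chi n : ℂ) * (n : ℂ)

/-- The point `n²π²/6`. -/
def pt (n : ℕ) : ℝ := (n : ℝ) ^ 2 * π ^ 2 / 6

/-- The `n`-th term `c_n (n²π²/6 - p)^{-5/2}` (principal branch). -/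
def termG (n : ℕ) (p : ℂ) : ℂ := coeffG n * ((pt n : ℂ) - p) ^ (-(5 / 2) : ℂ)

/-- `G(p) = (3π/(2√2)) ∑_{n ≥ 1} χ(n) n (n²π²/6 - p)^{-5/2}`, principal branches
(the term `n = 0` is zero). -/
def G (p : ℂ) : ℂ := ∑' n : ℕ, termG n p

/-- The set `{n²π²/6 : n ≡ 1, 5, 7, 11 mod 12}`. -/
def singSet : Set ℂ :=
  {p | ∃ n : ℕ, (n % 12 = 1 ∨ n % 12 = 5 ∨ n % 12 = 7 ∨ n % 12 = 11) ∧ p = (pt n : ℂ)}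

/-- The increasing enumeration `1, 5, 7, 11, 13, 17, …` of the positive integers coprime to `6`. -/
def coprimeSix (k : ℕ) : ℕ := 3 * k + 1 + k % 2

/-- The increasing enumeration of `singSet`. -/
def sing (k : ℕ) : ℝ := pt (coprimeSix k)

lemma mem_singSet_iff (p : ℂ) : p ∈ singSet ↔ ∃ k, p = (sing k : ℂ) := by
  constructor
  · rintro ⟨n, hn, rfl⟩
    refine ⟨n / 3, ?_⟩
    have : coprimeSix (n / 3) = n := by unfold coprimeSix; omega
    rw [sing, this]
  · rintro ⟨k, rfl⟩
    exact ⟨coprimeSix k, by unfold coprimeSix; omega, rfl⟩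

/-! ### Analytic continuation along paths -/

/-- `f t` (a function defined near `γ t`) is the analytic continuation along the path `γ` of the
germ of `g` at `a`. -/
def IsContinuationAlong (g : ℂ → ℂ) {a b : ℂ} (γ : Path a b) (f : unitInterval → ℂ → ℂ) : Prop :=
  f 0 =ᶠ[𝓝 a] g ∧
  ∀ t, AnalyticAt ℂ (f t) (γ t) ∧ ∀ᶠ s in 𝓝 t, f s =ᶠ[𝓝 (γ s)] f t

/-! ### Addresses, ramified functions and averages

`η 0 < η 1 < …` are the ramification points. An address of length `r` is a map
`ε : Fin r → Bool`; `ε i = true` (the sign `+`) means that `η i` is passed from above, and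
`ε i = false` (the sign `-`) that it is passed from below. -/

/-- The two open half-planes, glued along the interval `(η_{r-1}, η_r)`
(along `(-∞, η_0)` if `r = 0`). -/
def sheet (η : ℕ → ℝ) (r : ℕ) : Set ℂ :=
  {p | p.im ≠ 0 ∨ ((∀ k < r, η k < p.re) ∧ p.re < η r)}

/-- A family of functions, one for each address. -/
abbrev Branches := (r : ℕ) → (Fin r → Bool) → ℂ → ℂ

/-- The empty address. -/
def emptyAddr : Fin 0 → Bool := fun i => i.elim0

/-- The address `ε` followed by the sign `b`. -/
def extend {r : ℕ} (ε : Fin r → Bool) (b : Bool) : Fin (r + 1) → Bool :=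
  Fin.snoc (α := fun _ => Bool) ε b

/-- `g` is a multivalued function with ramification points `η`, where `g r ε` is the branch over the
interval `(η_{r-1}, η_r)` obtained from `g 0` by continuation along the address `ε`. -/
structure IsRamified (η : ℕ → ℝ) (g : Branches) : Prop where
  analytic : ∀ r ε, DifferentiableOn ℂ (g r ε) (sheet η r)
  above : ∀ r ε, ∀ p : ℂ, 0 < p.im → g (r + 1) (extend ε true) p = g r ε p
  below : ∀ r ε, ∀ p : ℂ, p.im < 0 → g (r + 1) (extend ε false) p = g r ε p

/-- Averaging weights for the ramification points. -/
abbrev Weights := (r : ℕ) → (Fin r → Bool) → ℂ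

/-- `m` is a system of averaging weights: total mass one, and each weight is the sum of the
weights of the two extensions of its address. -/
structure IsAverage (m : Weights) : Prop where
  total : m 0 emptyAddr = 1
  consistent : ∀ r ε, m r ε = m (r + 1) (extend ε true) + m (r + 1) (extend ε false)

/-- The averaged function `m g` at a point of the interval `(η_{r-1}, η_r)`. -/
def average (m : Weights) (g : Branches) (r : ℕ) (p : ℂ) : ℂ :=
  ∑ ε : Fin r → Bool, m r ε * g r ε p

/-- `m` has real weights and preserves reality: if `g` is ramified over `η` and real on the real
line to the left of `η 0`, then `m g` is real on each interval `(η_{r-1}, η_r)`. -/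
def IsRealityPreserving (η : ℕ → ℝ) (m : Weights) : Prop :=
  (∀ r ε, (m r ε).im = 0) ∧
  ∀ g : Branches, IsRamified η g → (∀ t : ℝ, t < η 0 → (g 0 emptyAddr (t : ℂ)).im = 0) →
    ∀ (r : ℕ) (t : ℝ), (∀ k < r, η k < t) → t < η r → (average m g r (t : ℂ)).im = 0

/-- The average `mur`: weight `1` if all signs are `+`, and `0` otherwise. -/
def mur : Weights := fun _ ε => if ∀ i, ε i = true then 1 else 0

/-- The average `mul`: weight `1` if all signs are `-`, and `0` otherwise. -/
def mul : Weights := fun _ ε => if ∀ i, ε i = false then 1 else 0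

/-- The median average. -/
def med : Weights := fun r ε => (mur r ε + mul r ε) / 2

/-! ### Laplace transforms and summation -/

/-- The integral of `f` along the segment from `a` to `b`. -/
def segInt (f : ℂ → ℂ) (a b : ℂ) : ℂ :=
  ∫ t in (0 : ℝ)..1, f (a + (t : ℂ) * (b - a)) * (b - a)

/-- The integral of `f` along the ray `{r e^{iθ} : r ≥ 0}`. -/
def rayInt (f : ℂ → ℂ) (θ : ℝ) : ℂ :=
  ∫ r in Ioi (0 : ℝ), f ((r : ℂ) * Complex.exp (Complex.I * θ)) * Complex.exp (Complex.I * θ)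

/-- Absolute convergence of the integral of `f` along the ray `{r e^{iθ} : r ≥ 0}`. -/
def RayIntegrable (f : ℂ → ℂ) (θ : ℝ) : Prop :=
  IntegrableOn (fun r : ℝ => f ((r : ℂ) * Complex.exp (Complex.I * θ))) (Ioi (0 : ℝ))

/-- Break points: `0`, and the midpoint of `(η_{r-1}, η_r)` for `r ≥ 1`. -/
def breakPt (η : ℕ → ℝ) : ℕ → ℝ
  | 0 => 0
  | r + 1 => (η r + η (r + 1)) / 2

/-- The point above (`true`) or below (`false`) `η r` through which the path runs. -/
def apex (η : ℕ → ℝ) (r : ℕ) (b : Bool) : ℂ :=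
  (η r : ℂ) + (if b then Complex.I else -Complex.I)

/-- The integral of `e^{-xp} g(p)` along the path that starts at `0`, ends at the `R`-th break
point and passes `η 0, …, η (R-1)` above or below as prescribed by the address `ε`; the
multivalued function `g` is continued along the path. -/
def pathLaplace (η : ℕ → ℝ) (g : Branches) (x : ℂ) (R : ℕ) (ε : Fin R → Bool) : ℂ :=
  ∑ k : Fin R,
    let h : ℂ → ℂ := fun p =>
      Complex.exp (-x * p) * g (k + 1) (fun i : Fin (k + 1) => ε (Fin.castLE k.isLt i)) p
    segInt h (breakPt η k) (apex η k (ε k)) + segInt h (apex η k (ε k)) (breakPt η (k + 1))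

/-- `L` is the Laplace transform at `x` of the average `m g`: the average, with weights `m`, of the
integrals of `e^{-xp} g(p)` along the paths from `0` to `∞`. -/
def HasLaplace (η : ℕ → ℝ) (m : Weights) (g : Branches) (x L : ℂ) : Prop :=
  Tendsto (fun R => ∑ ε : Fin R → Bool, m R ε * pathLaplace η g x R ε) atTop (𝓝 L)

/-- `S` is the value at `x` of the `m`-summation of the series `A`, whose Borel transform is
continued by `g`: the constant term of `A` plus the Laplace transform of `m g`. -/
def HasSummation (A : PowerSeries ℚ) (η : ℕ → ℝ) (m : Weights) (g : Branches) (x S : ℂ) : Prop :=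
  HasLaplace η m g x (S - ((PowerSeries.constantCoeff A : ℚ) : ℂ))

/-! ### The eta functions -/

/-- The integrand `η(2πiz) x^{3/2} (x-z)^{-3/2}`. On a ray from `0` that does not contain `x`, the
branch of `x^{3/2} (x-z)^{-3/2}` that is continuous and equal to `1` at `z = 0` is the principal
value of `(1 - z/x)^{-3/2}`. -/
def etaKernel (x z : ℂ) : ℂ :=
  ModularForm.eta (2 * π * Complex.I * z) * (1 - z / x) ^ (-(3 / 2) : ℂ)

/-- The modified eta function `∑_{n ≥ 1} χ(n) n e^{π i n² z / 12}`. -/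
def etaTilde (z : ℂ) : ℂ :=
  ∑' n : ℕ, (chi n : ℂ) * (n : ℂ) * Complex.exp (π * Complex.I * (n : ℂ) ^ 2 * z / 12)

/-- The imaginary line is a natural boundary of the function `h` on the right half-plane:
`h` has no analytic continuation to a neighbourhood of any point of the line. -/
def HasNaturalBoundary (h : ℂ → ℂ) : Prop :=
  ∀ x₀ : ℂ, x₀.re = 0 →
    ¬ ∃ k : ℂ → ℂ, AnalyticAt ℂ k x₀ ∧ ∀ᶠ x in 𝓝[{x : ℂ | 0 < x.re}] x₀, k x = h x

end KZ

end

open Filter Topology MeasureTheory Set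
open scoped Real

namespace KZ

/-! ### The character, the coefficients and the ramification points -/

/-! The Borel transform. Zagier's series S(x, q) = ∑ (1 - x)(1 - xq)⋯(1 - xq^k) x^k satisfies S(x) =
1 - q x² - q² x³ S(xq). Put q = e^{-u}, x = e^{-ju}. The divergent series ∑ χ(n) e^{-((n²-1)/24 +
j(n-1)/2)u}, regularized through Bernoulli polynomials, satisfies the same equation because χ(n+6) =
-χ(n). As power series in u with coefficients polynomial in j the two agree, since d(j) + d(j+1) = 0
forces d = 0 (`coeff_zagierSum`). The derivative at j = 0 gives f(e^{-u}) = -½ ∑ χ(n)(n-1)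
e^{-(n²-1)u/24}, so the a_m are multiples of B_{2m+2}(1/12) - B_{2m+2}(5/12) (`coeff_F_eq`). By the
Fourier expansion of the Bernoulli polynomials these are values of L(χ, ·) at even integers, and
they are also what the binomial expansion of the terms of G produces (`hasSum_taylorCoeff`,
`hasSum_borel`).

Continuation. Away from the singular points the distance to n²π²/6 is locally at least a constant
times n², whatever the determinations of the roots, so a sum over arbitrary determinations converges
absolutely to an analytic function. Along a path each root of n²π²/6 - γ(t) is lifted through the
exponential covering, and the resulting sums are the continuation (`isContinuationAlong_branchSum`).
Uniqueness of continuation shows that every branch is of this kind. Near one singular point all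
roots but one extend over the whole disc.

Averages. To the right of a singularity the corresponding term becomes ± `rightTerm`, the sign being
the sign of the address. Hence every branch over the real axis is a common part plus a signed sum of
right terms, which are nonzero and purely imaginary on the axis. Applying reality preservation to G
itself therefore forces each sign to have mean zero (`signMean_eq_zero`). A path integral splits
into contributions that depend on one sign each (`exists_pathLaplace_eq`), so its average depends
only on these means and equals the median one. That the median is reality-preserving is Schwarz
reflection.

Lateral sums. In the upper half-plane e^{-xp} G(p) has a primitive; the integrals along the paths
passing above the singularities telescope to its boundary values at the break points. The vertical
lines through the break points stay away from the singularities, so G is bounded on them, and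
comparison along these lines gives the integral along a slanted ray (`tendsto_pathLaplace_true`).
Rays may be rotated as long as the integrand decays, which yields the sectors. The left sum is the
complex conjugate of the right one.

Eta integral. One integration by parts and the substitution z = xp/A with A = n²π²/6 turn the n-th
Laplace integral into a boundary term and √3 χ(n) ∫ e^{-Az} (1 - z/x)^{-3/2} dz. The boundary terms
add up to -1 and cancel a₀ = 1; the exponentials add up to η(2πiz) by Euler's pentagonal number
theorem (`hasSum_eta`, `one_add_rayInt_eq`).

The difference. Two integrations by parts lower the exponent to -1/2, which is integrable on the
cut. The boundary terms cancel, and the jump across the cut is a Gaussian integral giving e^{-Ax}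
√(π/x) (`rayInt_half_sub_eq`, `hasSum_lateralDiff`). If the resulting series ∑ χ(n) n e^{-n²π²x/6}
were bounded near a boundary segment, isolating one frequency by a second difference would bound its
coefficients, which grow like n (`coefficient_le_of_bounded`). At rational points the coefficients
χ(n) e^{πi n²α/12} are periodic with mean zero, and three summations by parts give the radial limits
(`exists_tendsto_tsum_periodic`). -/

/-- The support of `chi`. -/
def chiSupport : Set ℕ := {n | chi n ≠ 0}

lemma mem_chiSupport_iff (n : ℕ) :
    n ∈ chiSupport ↔ n % 12 = 1 ∨ n % 12 = 5 ∨ n % 12 = 7 ∨ n % 12 = 11 := by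
  unfold chiSupport chi
  simp only [mem_ofPred_eq]
  split_ifs <;> (simp; omega)

lemma chi_eq_zero_of_notMem {n : ℕ} (h : n ∉ chiSupport) : chi n = 0 := by
  simpa [chiSupport] using h

lemma chi_sq_of_mem {n : ℕ} (h : n ∈ chiSupport) : chi n ^ 2 = 1 := by
  rw [mem_chiSupport_iff] at h
  unfold chi
  split_ifs <;> simp <;> omega

lemma abs_chi_le (n : ℕ) : |chi n| ≤ 1 := by
  unfold chi
  split_ifs <;> simp

lemma norm_chi_le (n : ℕ) : ‖(chi n : ℂ)‖ ≤ 1 := by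
  rw [Complex.norm_intCast]
  exact_mod_cast abs_chi_le n

lemma norm_chi_of_mem {n : ℕ} (h : n ∈ chiSupport) : ‖(chi n : ℂ)‖ = 1 := by
  have : ‖(chi n : ℂ)‖ ^ 2 = 1 := by
    rw [← norm_pow]
    have := chi_sq_of_mem h
    rw [show ((chi n : ℂ)) ^ 2 = ((chi n ^ 2 : ℤ) : ℂ) by push_cast; rfl, this]
    simp
  nlinarith [norm_nonneg (chi n : ℂ)]

lemma pos_of_mem_chiSupport {n : ℕ} (h : n ∈ chiSupport) : 0 < n := by
  rw [mem_chiSupport_iff] at h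
  omega

lemma coprimeSix_mem (k : ℕ) : coprimeSix k ∈ chiSupport := by
  rw [mem_chiSupport_iff, coprimeSix]
  omega

lemma coprimeSix_div_three (k : ℕ) : coprimeSix k / 3 = k := by
  rw [coprimeSix]; omega

lemma coprimeSix_of_mem {n : ℕ} (h : n ∈ chiSupport) : coprimeSix (n / 3) = n := by
  rw [mem_chiSupport_iff] at h
  rw [coprimeSix]; omega

lemma coprimeSix_strictMono : StrictMono coprimeSix :=
  strictMono_nat_of_lt_succ fun k => by unfold coprimeSix; omega

lemma coeffG_eq_zero {n : ℕ} (h : n ∉ chiSupport) : coeffG n = 0 := by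
  simp [coeffG, chi_eq_zero_of_notMem h]

lemma three_pi_div_le : 3 * π / (2 * √2) ≤ 4 := by
  rw [div_le_iff₀ (by positivity)]
  have h1 : (1.4 : ℝ) ≤ √2 := Real.le_sqrt_of_sq_le (by norm_num)
  linarith [Real.pi_lt_d2]

lemma norm_coeffG_le (n : ℕ) : ‖coeffG n‖ ≤ 4 * n := by
  unfold coeffG
  rw [norm_mul, norm_mul, Complex.norm_real, Complex.norm_natCast, Real.norm_eq_abs,
    abs_of_nonneg (by positivity)]
  have h1 := norm_chi_le n
  have h2 := three_pi_div_le
  have : 3 * π / (2 * √2) * ‖(chi n : ℂ)‖ ≤ 4 * 1 := by gcongr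
  nlinarith [(Nat.cast_nonneg n : (0 : ℝ) ≤ n)]

lemma coeffG_ne_zero {n : ℕ} (h : n ∈ chiSupport) : coeffG n ≠ 0 := by
  have hn := pos_of_mem_chiSupport h
  have h' : chi n ≠ 0 := h
  unfold coeffG
  have : (3 * π / (2 * √2) : ℝ) ≠ 0 := by positivity
  refine mul_ne_zero (mul_ne_zero (by exact_mod_cast this) (by exact_mod_cast h')) ?_
  exact_mod_cast hn.ne'

lemma sq_le_pt (n : ℕ) : (n : ℝ) ^ 2 ≤ pt n := by
  unfold pt
  have h1 : (9 : ℝ) ≤ π ^ 2 := by nlinarith [Real.pi_gt_three]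
  have : (n : ℝ) ^ 2 * 6 ≤ (n : ℝ) ^ 2 * π ^ 2 := by gcongr; linarith
  linarith

lemma pt_strictMono : StrictMono pt := by
  intro a b h
  unfold pt
  have : (a : ℝ) < b := by exact_mod_cast h
  have : (a : ℝ) ^ 2 < (b : ℝ) ^ 2 := by gcongr
  have hp : 0 < π ^ 2 := by positivity
  nlinarith

lemma pt_pos {n : ℕ} (h : 0 < n) : 0 < pt n := by
  unfold pt
  positivity

lemma pt_pos_of_mem {n : ℕ} (h : n ∈ chiSupport) : 0 < pt n := pt_pos (pos_of_mem_chiSupport h)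

lemma pt_one : pt 1 = π ^ 2 / 6 := by simp [pt]

lemma sing_zero : sing 0 = π ^ 2 / 6 := by simp [sing, coprimeSix, pt]

lemma sing_strictMono : StrictMono sing := pt_strictMono.comp coprimeSix_strictMono

lemma sing_div_three {n : ℕ} (h : n ∈ chiSupport) : sing (n / 3) = pt n := by
  rw [sing, coprimeSix_of_mem h]

lemma sing_pos (k : ℕ) : 0 < sing k := pt_pos_of_mem (coprimeSix_mem k)

lemma mem_singSet_iff_exists (p : ℂ) : p ∈ singSet ↔ ∃ n ∈ chiSupport, p = (pt n : ℂ) := by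
  simp only [singSet, mem_ofPred_eq, mem_chiSupport_iff]

lemma pt_mem_singSet {n : ℕ} (h : n ∈ chiSupport) : (pt n : ℂ) ∈ singSet :=
  (mem_singSet_iff_exists _).2 ⟨n, h, rfl⟩

lemma mem_of_pt_mem_singSet {n : ℕ} (h : (pt n : ℂ) ∈ singSet) : n ∈ chiSupport := by
  obtain ⟨m, hm, h⟩ := (mem_singSet_iff_exists _).1 h
  have : n = m := pt_strictMono.injective (by exact_mod_cast h)
  rwa [this]

lemma pt_one_le_of_mem {n : ℕ} (h : n ∈ chiSupport) : π ^ 2 / 6 ≤ pt n := by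
  rw [← pt_one]
  exact pt_strictMono.monotone (pos_of_mem_chiSupport h)

/-! ### Sums over the ramification points -/

/-- Away from the points `pt n`, `n ∈ S`, the distance to `pt n` is bounded below by a multiple of
`n ^ 2`, locally uniformly. -/
lemma exists_mul_sq_le_norm_pt_sub (S : Set ℕ) (p₀ : ℂ) (h : ∀ n ∈ S, (pt n : ℂ) ≠ p₀) :
    ∃ r > 0, ∃ c > 0, ∀ p ∈ Metric.ball p₀ r, ∀ n ∈ S, c * (n : ℝ) ^ 2 ≤ ‖(pt n : ℂ) - p‖ := by
  have hmin : ∀ K : ℕ, ∃ d > 0, ∀ n ∈ S, n < K → d ≤ ‖(pt n : ℂ) - p₀‖ := by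
    intro K
    induction K with
    | zero => exact ⟨1, one_pos, by simp⟩
    | succ K ih =>
      obtain ⟨d, hd, hdK⟩ := ih
      by_cases hK : K ∈ S
      · refine ⟨min d ‖(pt K : ℂ) - p₀‖, lt_min hd (norm_pos_iff.2 (sub_ne_zero.2 (h K hK))), ?_⟩
        intro n hn hlt
        rcases Nat.lt_succ_iff_lt_or_eq.1 hlt with h1 | rfl
        · exact (min_le_left _ _).trans (hdK n hn h1)
        · exact min_le_right _ _
      · refine ⟨d, hd, fun n hn hlt => ?_⟩
        rcases Nat.lt_succ_iff_lt_or_eq.1 hlt with h1 | rfl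
        · exact hdK n hn h1
        · exact absurd hn hK
  -- For n ≥ K one has n²/2 ≥ ‖p₀‖ + 1, so n² - (‖p₀‖ + 1) ≥ n²/2 bounds the distance on the unit
  -- ball; the finitely many n < K are covered by their minimal distance d.
  obtain ⟨K, hK⟩ := exists_nat_gt (2 * (‖p₀‖ + 1) + 1)
  have hK1 : (1 : ℝ) < K := by linarith [norm_nonneg p₀]
  obtain ⟨d, hd, hdK⟩ := hmin K
  refine ⟨min 1 (d / 2), by positivity, min (1 / 2) (d / 2 / (K : ℝ) ^ 2), by positivity, ?_⟩
  intro p hp n hn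
  rw [Metric.mem_ball, dist_eq_norm, lt_min_iff] at hp
  rcases lt_or_ge n K with hlt | hge
  · have h1 := hdK n hn hlt
    have h2 : ‖(pt n : ℂ) - p₀‖ ≤ ‖(pt n : ℂ) - p‖ + ‖p - p₀‖ := norm_sub_le_norm_sub_add_norm_sub ..
    have h3 : (n : ℝ) ^ 2 ≤ (K : ℝ) ^ 2 := by gcongr
    calc min (1 / 2) (d / 2 / (K : ℝ) ^ 2) * (n : ℝ) ^ 2
        ≤ d / 2 / (K : ℝ) ^ 2 * (K : ℝ) ^ 2 := by gcongr; exact min_le_right _ _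
      _ = d / 2 := by field_simp
      _ ≤ _ := by linarith [hp.2]
  · have h1 : (K : ℝ) ≤ n := by exact_mod_cast hge
    have h2 : (pt n : ℝ) ≤ ‖(pt n : ℂ) - p‖ + ‖p - p₀‖ + ‖p₀‖ := by
      have := norm_add₃_le (a := (pt n : ℂ) - p) (b := p - p₀) (c := p₀)
      rw [sub_add_sub_cancel, sub_add_cancel, Complex.norm_real] at this
      exact (le_abs_self _).trans this
    have h3 := sq_le_pt n
    calc min (1 / 2) (d / 2 / (K : ℝ) ^ 2) * (n : ℝ) ^ 2 ≤ 1 / 2 * (n : ℝ) ^ 2 := by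
          gcongr; exact min_le_left _ _
      _ ≤ _ := by nlinarith [hp.1]

/-- A majorant for sums over the ramification points. -/
lemma norm_coeffG_mul_rpow_le {c : ℝ} (hc : 0 < c) (n : ℕ) {d : ℝ} (hd : c * (n : ℝ) ^ 2 ≤ d) :
    ‖coeffG n‖ * d ^ (-(5 / 2) : ℝ) ≤ 4 * c ^ (-(5 / 2) : ℝ) * ((n : ℝ) ^ 2)⁻¹ := by
  rcases Nat.eq_zero_or_pos n with rfl | hn
  · simp [coeffG]
  have hn1 : (1 : ℝ) ≤ n := by exact_mod_cast hn
  have h1 : d ^ (-(5 / 2) : ℝ) ≤ c ^ (-(5 / 2) : ℝ) * (n : ℝ) ^ (-5 : ℝ) := by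
    calc d ^ (-(5 / 2) : ℝ) ≤ (c * (n : ℝ) ^ 2) ^ (-(5 / 2) : ℝ) :=
          Real.rpow_le_rpow_of_nonpos (by positivity) hd (by norm_num)
      _ = _ := by
          rw [Real.mul_rpow hc.le (by positivity), ← Real.rpow_natCast, ← Real.rpow_mul (by positivity)]
          norm_num
  have h2 : (n : ℝ) * (n : ℝ) ^ (-5 : ℝ) ≤ ((n : ℝ) ^ 2)⁻¹ := by
    have : (n : ℝ) * (n : ℝ) ^ (-5 : ℝ) = (n : ℝ) ^ (-4 : ℝ) := by
      rw [← Real.rpow_one_add' (by positivity) (by norm_num)]; norm_num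
    rw [this, ← Real.rpow_natCast, ← Real.rpow_neg (by positivity)]
    exact Real.rpow_le_rpow_of_exponent_le hn1 (by norm_num)
  have h3 := norm_coeffG_le n
  calc ‖coeffG n‖ * d ^ (-(5 / 2) : ℝ)
      ≤ (4 * n) * (c ^ (-(5 / 2) : ℝ) * (n : ℝ) ^ (-5 : ℝ)) := by
        have : 0 ≤ d ^ (-(5 / 2) : ℝ) := Real.rpow_nonneg (le_trans (by positivity) hd) _
        gcongr
    _ = 4 * c ^ (-(5 / 2) : ℝ) * ((n : ℝ) * (n : ℝ) ^ (-5 : ℝ)) := by ring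
    _ ≤ _ := by gcongr

lemma summable_inv_sq : Summable fun n : ℕ => ((n : ℝ) ^ 2)⁻¹ :=
  Real.summable_nat_pow_inv.2 (by norm_num)

/-- Sums of determinations of `cₙ (pt n - p)^{-5/2}` are absolutely convergent and analytic. -/
lemma summable_and_analyticAt_tsum {S : Set ℕ} {u : ℕ → ℂ → ℂ} {p₀ : ℂ}
    (hS : ∀ n ∈ S, (pt n : ℂ) ≠ p₀) {U : Set ℂ} (hU : U ∈ 𝓝 p₀)
    (hd : ∀ n ∈ S, DifferentiableOn ℂ (u n) U)
    (hb : ∀ n ∈ S, ∀ p ∈ U, ‖u n p‖ ≤ ‖coeffG n‖ * ‖(pt n : ℂ) - p‖ ^ (-(5 / 2) : ℝ))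
    (h0 : ∀ n ∉ S, ∀ p, u n p = 0) :
    (∀ᶠ p in 𝓝 p₀, Summable fun n => ‖u n p‖) ∧ AnalyticAt ℂ (fun p => ∑' n, u n p) p₀ := by
  obtain ⟨r, hr, c, hc, hcb⟩ := exists_mul_sq_le_norm_pt_sub S p₀ hS
  obtain ⟨r', hr', hrU⟩ := Metric.mem_nhds_iff.1 hU
  set ρ := min r r' with hρ
  have hρ0 : 0 < ρ := lt_min hr hr'
  have hbound : ∀ n, ∀ p ∈ Metric.ball p₀ ρ,
      ‖u n p‖ ≤ 4 * c ^ (-(5 / 2) : ℝ) * ((n : ℝ) ^ 2)⁻¹ := by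
    intro n p hp
    by_cases hn : n ∈ S
    · exact (hb n hn p (hrU (Metric.ball_subset_ball (min_le_right _ _) hp))).trans
        (norm_coeffG_mul_rpow_le hc n (hcb p (Metric.ball_subset_ball (min_le_left _ _) hp) n hn))
    · rw [h0 n hn]; simp; positivity
  have hsum : Summable fun n : ℕ => 4 * c ^ (-(5 / 2) : ℝ) * ((n : ℝ) ^ 2)⁻¹ :=
    summable_inv_sq.mul_left _
  constructor
  · filter_upwards [Metric.ball_mem_nhds p₀ hρ0] with p hp
    exact Summable.of_nonneg_of_le (fun _ => norm_nonneg _) (fun n => hbound n p hp) hsum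
  · refine DifferentiableOn.analyticAt (s := Metric.ball p₀ ρ) ?_ (Metric.ball_mem_nhds p₀ hρ0)
    refine Complex.differentiableOn_tsum_of_summable_norm hsum (fun n => ?_) Metric.isOpen_ball hbound
    by_cases hn : n ∈ S
    · exact (hd n hn).mono ((Metric.ball_subset_ball (min_le_right _ _)).trans hrU)
    · exact (differentiableOn_const (0 : ℂ)).congr fun p _ => h0 n hn p

/-! ### The series `G` -/

lemma norm_cpow_neg_five_half (z : ℂ) : ‖z ^ (-(5 / 2) : ℂ)‖ = ‖z‖ ^ (-(5 / 2) : ℝ) := by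
  rw [← Complex.norm_cpow_real]
  push_cast
  rfl

lemma norm_termG (n : ℕ) (p : ℂ) :
    ‖termG n p‖ = ‖coeffG n‖ * ‖(pt n : ℂ) - p‖ ^ (-(5 / 2) : ℝ) := by
  rw [termG, norm_mul, norm_cpow_neg_five_half]

lemma termG_eq_zero {n : ℕ} (h : n ∉ chiSupport) (p : ℂ) : termG n p = 0 := by
  simp [termG, coeffG_eq_zero h]

lemma mem_slitPlane_pt_sub {A : ℝ} {p : ℂ} (h : p.im ≠ 0 ∨ p.re < A) :
    (A : ℂ) - p ∈ Complex.slitPlane := by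
  rw [Complex.mem_slitPlane_iff]
  rcases h with h | h
  · right; simpa using h
  · left; simpa using h

lemma differentiableAt_termG {n : ℕ} {p : ℂ} (h : p.im ≠ 0 ∨ p.re < pt n) :
    DifferentiableAt ℂ (termG n) p := by
  unfold termG
  exact (DifferentiableAt.cpow_const (by fun_prop) (mem_slitPlane_pt_sub h)).const_mul _

lemma isOpen_sheet (η : ℕ → ℝ) (r : ℕ) : IsOpen (sheet η r) := by
  have : sheet η r = {p : ℂ | p.im ≠ 0} ∪
      ((⋂ k ∈ Finset.range r, {p : ℂ | η k < p.re}) ∩ {p : ℂ | p.re < η r}) := by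
    ext p; simp [sheet]
  rw [this]
  refine IsOpen.union (isOpen_ne_fun Complex.continuous_im continuous_const) (IsOpen.inter ?_ ?_)
  · exact isOpen_biInter_finset fun k _ => isOpen_lt continuous_const Complex.continuous_re
  · exact isOpen_lt Complex.continuous_re continuous_const

lemma mem_sheet_zero_iff (p : ℂ) : p ∈ sheet sing 0 ↔ p.im ≠ 0 ∨ p.re < π ^ 2 / 6 := by
  simp [sheet, sing_zero]

lemma im_ne_zero_or_lt_of_mem_sheet {p : ℂ} (hp : p ∈ sheet sing 0) {n : ℕ} (hn : n ∈ chiSupport) :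
    p.im ≠ 0 ∨ p.re < pt n :=
  ((mem_sheet_zero_iff p).1 hp).imp_right fun h => h.trans_le (pt_one_le_of_mem hn)

lemma pt_ne_of_im_ne_zero_or_lt {A : ℝ} {p : ℂ} (h : p.im ≠ 0 ∨ p.re < A) : (A : ℂ) ≠ p := by
  rintro rfl
  simp at h

/-- Partial sums over a subset `S` of the indices. -/
lemma summable_and_analyticAt_tsum_termG {S : Set ℕ} {p₀ : ℂ}
    (h : p₀.im ≠ 0 ∨ ∃ A : ℝ, p₀.re < A ∧ ∀ n ∈ S, A ≤ pt n) (_ : S ⊆ chiSupport) :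
    (Summable fun n => ‖S.indicator (fun n => termG n p₀) n‖) ∧
      AnalyticAt ℂ (fun p => ∑' n, S.indicator (fun n => termG n p) n) p₀ := by
  obtain ⟨U, hU, hUS⟩ : ∃ U ∈ 𝓝 p₀, ∀ p ∈ U, ∀ n ∈ S, p.im ≠ 0 ∨ p.re < pt n := by
    rcases h with h | ⟨A, h, hA⟩
    · exact ⟨_, (isOpen_ne_fun Complex.continuous_im continuous_const).mem_nhds h,
        fun p hp n _ => Or.inl hp⟩
    · exact ⟨_, (isOpen_lt Complex.continuous_re continuous_const).mem_nhds h,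
        fun p hp n hn => Or.inr (lt_of_lt_of_le hp (hA n hn))⟩
  have := summable_and_analyticAt_tsum (S := S) (u := fun n p => S.indicator (fun n => termG n p) n)
    (p₀ := p₀) (fun n hn => pt_ne_of_im_ne_zero_or_lt (hUS p₀ (mem_of_mem_nhds hU) n hn)) hU ?_ ?_ ?_
  · exact ⟨this.1.self_of_nhds, this.2⟩
  · intro n hn p hp
    simp only [indicator_of_mem hn]
    exact (differentiableAt_termG (hUS p hp n hn)).differentiableWithinAt
  · intro n hn p hp
    simp only [indicator_of_mem hn, norm_termG, le_refl]
  · intro n hn p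
    simp only [indicator_of_notMem hn]

lemma indicator_termG (p : ℂ) : chiSupport.indicator (fun n => termG n p) = fun n => termG n p := by
  ext n
  by_cases h : n ∈ chiSupport
  · simp [h]
  · simp [h, termG_eq_zero h]

lemma summable_norm_termG {p : ℂ} (hp : p ∈ sheet sing 0) : Summable fun n => ‖termG n p‖ := by
  have := (summable_and_analyticAt_tsum_termG (S := chiSupport) (p₀ := p)
    (((mem_sheet_zero_iff p).1 hp).imp_right fun h => ⟨_, h, fun n hn => pt_one_le_of_mem hn⟩)
    subset_rfl).1
  simpa only [indicator_termG] using this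

lemma analyticAt_G {p : ℂ} (hp : p ∈ sheet sing 0) : AnalyticAt ℂ G p := by
  have := (summable_and_analyticAt_tsum_termG (S := chiSupport) (p₀ := p)
    (((mem_sheet_zero_iff p).1 hp).imp_right fun h => ⟨_, h, fun n hn => pt_one_le_of_mem hn⟩)
    subset_rfl).2
  simp only [indicator_termG] at this
  exact this

/-! ### The expansion of `f(e^{-u})` -/

open Polynomial in
/-- A polynomial that is periodic is constant. -/
lemma eq_C_of_comp_X_add_C_eq {D : ℚ[X]} {a : ℚ} (ha : a ≠ 0) (h : D.comp (X + C a) = D) :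
    D = C (D.eval 0) := by
  have hk : ∀ k : ℕ, D.eval (k * a) = D.eval 0 := by
    intro k
    induction k with
    | zero => simp
    | succ k ih =>
      rw [← ih]
      conv_rhs => rw [← h]
      rw [eval_comp]
      simp [add_mul]
  refine Polynomial.eq_of_infinite_eval_eq _ _ ?_
  refine Set.infinite_of_injective_forall_mem (f := fun k : ℕ => (k : ℚ) * a) ?_ ?_
  · intro x y hxy
    exact_mod_cast mul_right_cancel₀ ha hxy
  · intro k
    simp [hk k]

open Polynomial in
/-- The antidifference operator with step `12`: the polynomial `Q` with `Q(n+12) - Q(n) = P(n)`. -/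
noncomputable def antidiff : ℚ[X] →ₗ[ℚ] ℚ[X] :=
  Polynomial.lsum fun i => (LinearMap.toSpanSingleton ℚ ℚ[X]
    (C ((12 : ℚ) ^ i / (i + 1)) * (Polynomial.bernoulli (i + 1)).comp (C (1 / 12) * X)))

open Polynomial in
lemma antidiff_monomial (i : ℕ) (a : ℚ) : antidiff (monomial i a) =
    a • (C ((12 : ℚ) ^ i / (i + 1)) * (Polynomial.bernoulli (i + 1)).comp (C (1 / 12) * X)) := by
  simp [antidiff, Polynomial.lsum_apply]

open Polynomial in
-- This is B_{i+1}(1 + y) - B_{i+1}(y) = (i+1) y^i at y = x/12.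
lemma antidiff_comp_sub (P : ℚ[X]) : (antidiff P).comp (X + C 12) - antidiff P = P := by
  induction P using Polynomial.induction_on' with
  | add p q hp hq => rw [map_add, add_comp]; linear_combination hp + hq
  | monomial i a =>
    refine Polynomial.funext fun x => ?_
    rw [antidiff_monomial]
    have h := Polynomial.bernoulli_eval_one_add (i + 1) (x / 12)
    simp only [eval_sub, eval_comp, smul_comp, eval_smul, mul_comp, eval_mul, eval_C, eval_X,
      C_comp, eval_add, comp_assoc, X_comp, eval_monomial, smul_eq_mul]
    rw [show (1 / 12 : ℚ) * (x + 12) = 1 + x / 12 by ring, show (1 / 12 : ℚ) * x = x / 12 by ring, h]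
    have h12 : (12 : ℚ) ^ i * (x / 12) ^ i = x ^ i := by rw [← mul_pow]; congr 1; ring
    have hi : (i + 1 : ℚ) ≠ 0 := by positivity
    rw [Nat.add_sub_cancel]
    have h2 : (12 : ℚ) ^ i / (i + 1) * ((i + 1 : ℕ) * (x / 12) ^ i) = x ^ i := by
      rw [← h12]
      push_cast
      field_simp
    linear_combination a * h2

open Polynomial in
/-- The regularized value of `∑ χ(n) P(n)`. -/
noncomputable def regSumRat : ℚ[X] →ₗ[ℚ] ℚ :=
  -- If Q is the antidifference of P, then ∑_{k ≥ 0} P(r + 12k) telescopes formally to -Q(r); the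
  -- residues r = 1, 5, 7, 11 enter with the signs χ(r).
  -((leval 1 - leval 5 - leval 7 + leval 11) ∘ₗ antidiff)

open Polynomial in
lemma regSumRat_apply (P : ℚ[X]) : regSumRat P = -((antidiff P).eval 1 - (antidiff P).eval 5 -
    (antidiff P).eval 7 + (antidiff P).eval 11) := by
  simp [regSumRat, leval]

open Polynomial in
-- Since χ(n+6) = -χ(n), the second sum is formally minus the tail n ≥ 6 of the first, and only the
-- terms n = 1 and n = 5 survive. Rigorously, the antidifference of P(· + 6) and the shifted
-- antidifference of P differ by a periodic polynomial, hence by a constant, which drops out because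
-- χ sums to zero over a period.
lemma regSumRat_add_comp (P : ℚ[X]) :
    regSumRat P + regSumRat (P.comp (X + C 6)) = P.eval 1 - P.eval 5 := by
  have hD : (antidiff (P.comp (X + C 6)) - (antidiff P).comp (X + C 6)).comp (X + C 12) =
      antidiff (P.comp (X + C 6)) - (antidiff P).comp (X + C 6) := by
    have h1 := antidiff_comp_sub (P.comp (X + C 6))
    have h2 := congrArg (fun q : ℚ[X] => q.comp (X + C 6)) (antidiff_comp_sub P)
    simp only [sub_comp, comp_assoc, add_comp, X_comp, C_comp] at h1 h2 ⊢
    rw [show (X + C 12 + C 6 : ℚ[X]) = X + C 6 + C 12 by ring]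
    linear_combination h1 - h2
  have hD' := eq_C_of_comp_X_add_C_eq (by norm_num) hD
  have hv : ∀ x : ℚ, (antidiff (P.comp (X + C 6))).eval x = (antidiff P).eval (x + 6) +
      (antidiff (P.comp (X + C 6)) - (antidiff P).comp (X + C 6)).eval 0 := by
    intro x
    have := congrArg (eval x) hD'
    rw [eval_C] at this
    rw [← this]
    simp [eval_comp]
  have h1 := congrArg (eval 1) (antidiff_comp_sub P)
  have h5 := congrArg (eval 5) (antidiff_comp_sub P)
  simp only [eval_sub, eval_comp, eval_add, eval_X, eval_C] at h1 h5
  rw [regSumRat_apply, regSumRat_apply, hv, hv, hv, hv]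
  norm_num at h1 h5 ⊢
  linear_combination h1 - h5

open Polynomial in
/-- The regularized sum with coefficients in a `ℚ`-algebra. -/
noncomputable def regSum (R : Type*) [CommRing R] [Algebra ℚ R] : R[X] →ₗ[R] R :=
  Polynomial.lsum fun i => LinearMap.toSpanSingleton R R (algebraMap ℚ R (regSumRat (X ^ i)))

/-! ### Regularized sums over ℚ-algebras, exponential series and Zagier's series -/

section
open Polynomial

variable {R : Type*} [CommRing R] [Algebra ℚ R]

lemma regSum_monomial (i : ℕ) (a : R) :
    regSum R (monomial i a) = a * algebraMap ℚ R (regSumRat (X ^ i)) := by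
  simp [regSum, Polynomial.lsum_apply]

lemma regSum_C_mul (a : R) (p : R[X]) : regSum R (C a * p) = a * regSum R p := by
  rw [← smul_eq_C_mul, map_smul, smul_eq_mul]

lemma regSum_map_algebraMap (p : ℚ[X]) :
    regSum R (p.map (algebraMap ℚ R)) = algebraMap ℚ R (regSumRat p) := by
  induction p using Polynomial.induction_on' with
  | add p q hp hq => simp [hp, hq]
  | monomial i a =>
    rw [map_monomial, regSum_monomial, ← map_mul, ← smul_eq_mul, ← map_smul, smul_X_eq_monomial]

lemma regSum_map {R' : Type*} [CommRing R'] [Algebra ℚ R'] (φ : R →+* R') (p : R[X]) :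
    regSum R' (p.map φ) = φ (regSum R p) := by
  induction p using Polynomial.induction_on' with
  | add p q hp hq => simp [hp, hq]
  | monomial i a =>
    rw [map_monomial, regSum_monomial, regSum_monomial, map_mul]
    congr 1
    exact (RingHom.congr_fun (RingHom.ext_rat (φ.comp (algebraMap ℚ R)) (algebraMap ℚ R')) _).symm

lemma regSum_add_comp (p : R[X]) :
    regSum R p + regSum R (p.comp (X + C 6)) = p.eval 1 - p.eval 5 := by
  induction p using Polynomial.induction_on' with
  | add p q hp hq => simp only [add_comp, map_add, eval_add]; linear_combination hp + hq
  | monomial i a =>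
    have h := congrArg (algebraMap ℚ R) (regSumRat_add_comp (X ^ i))
    rw [map_add, ← regSum_map_algebraMap, ← regSum_map_algebraMap] at h
    simp only [X_pow_comp, Polynomial.map_pow, Polynomial.map_add, map_X, eval_pow,
      eval_X, map_sub, map_pow, map_ofNat, Polynomial.map_ofNat, one_pow, map_one] at h
    rw [← C_mul_X_pow_eq_monomial, mul_comp, regSum_C_mul, C_comp, regSum_C_mul, X_pow_comp,
      ← mul_add]
    simp only [eval_mul, eval_C, eval_pow, eval_X, map_ofNat, one_pow]
    rw [h]
    ring

/-- The power series `e^{a u}`. -/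
noncomputable def expU (a : R) : PowerSeries R := PowerSeries.rescale a (PowerSeries.exp R)

lemma coeff_expU (a : R) (n : ℕ) :
    PowerSeries.coeff n (expU a) = algebraMap ℚ R (1 / n.factorial) * a ^ n := by
  rw [expU, PowerSeries.coeff_rescale, PowerSeries.coeff_exp, mul_comm]

lemma expU_mul (a b : R) : expU a * expU b = expU (a + b) :=
  PowerSeries.exp_mul_exp_eq_exp_add a b

lemma expU_zero : expU (0 : R) = 1 := by
  simp [expU]

lemma expU_pow (a : R) (n : ℕ) : expU a ^ n = expU (n * a) := by
  induction n with
  | zero => simp [expU_zero]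
  | succ n ih => rw [pow_succ, ih, expU_mul]; push_cast; ring_nf

lemma map_expU {R' : Type*} [CommRing R'] [Algebra ℚ R'] (φ : R →+* R') (a : R) :
    PowerSeries.map φ (expU a) = expU (φ a) := by
  ext n
  rw [PowerSeries.coeff_map, coeff_expU, coeff_expU, map_mul, map_pow]
  congr 1
  exact RingHom.congr_fun (RingHom.ext_rat (φ.comp (algebraMap ℚ R)) (algebraMap ℚ R')) _

lemma X_dvd_one_sub_expU (a : R) : PowerSeries.X ∣ 1 - expU a := by
  rw [PowerSeries.X_dvd_iff, ← PowerSeries.coeff_zero_eq_constantCoeff_apply, map_sub, coeff_expU]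
  simp

/-- The regularized sum `∑ χ(n) e^{a(n) u}`. -/
noncomputable def regExp (a : R[X]) : PowerSeries R :=
  PowerSeries.mk fun m => regSum R (PowerSeries.coeff m (expU a))

lemma coeff_regExp (a : R[X]) (m : ℕ) :
    PowerSeries.coeff m (regExp a) = algebraMap ℚ R (1 / m.factorial) * regSum R (a ^ m) := by
  rw [regExp, PowerSeries.coeff_mk, coeff_expU, IsScalarTower.algebraMap_apply ℚ R R[X],
    algebraMap_eq, regSum_C_mul]

/-- The coefficients of e^{au} do not involve the summation variable, so they pass through the
linear map `regSum`. -/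
lemma expU_mul_mk_regSum (a : R) (b s : R[X]) :
    expU a * PowerSeries.mk (fun m => regSum R (s * PowerSeries.coeff m (expU b))) =
      PowerSeries.mk fun m => regSum R (s * PowerSeries.coeff m (expU (C a + b))) := by
  ext m
  rw [PowerSeries.coeff_mul, PowerSeries.coeff_mk, ← expU_mul, PowerSeries.coeff_mul,
    Finset.mul_sum, map_sum]
  refine Finset.sum_congr rfl fun ij _ => ?_
  rw [PowerSeries.coeff_mk, ← regSum_C_mul, coeff_expU a, coeff_expU (C a),
    IsScalarTower.algebraMap_apply ℚ R R[X], algebraMap_eq, C_mul, C_pow]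
  congr 1
  ring

lemma expU_mul_regExp (a : R) (b : R[X]) : expU a * regExp b = regExp (C a + b) := by
  have := expU_mul_mk_regSum a b 1
  simp only [one_mul] at this
  exact this

lemma regExp_add_comp (a : R[X]) :
    regExp a + regExp (a.comp (X + C 6)) = expU (a.eval 1) - expU (a.eval 5) := by
  ext m
  rw [map_add, map_sub, coeff_regExp, coeff_regExp, coeff_expU, coeff_expU]
  have h := regSum_add_comp (a ^ m)
  rw [pow_comp, eval_pow, eval_pow] at h
  rw [← mul_add, h]
  ring

/-- The truncation of Zagier's series `∑ (x)_{k+1} x^k`. -/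
noncomputable def zagierSum (x q : R) (N : ℕ) : R :=
  ∑ k ∈ Finset.range N, (1 - x) * (∏ i ∈ Finset.range k, (1 - x * q ^ (i + 1))) * x ^ k

/-- The equation S(x) = 1 - q x² - q² x³ S(xq) of the infinite series holds for the truncations up
to a multiple of ∏ (1 - x q^{i+1}), i < N. In the application this product is divisible by u^N, so
the error is invisible below order N. -/
lemma zagierSum_functional {A : Type*} [CommRing A] (x q : A) (N : ℕ) :
    zagierSum x q N = 1 - q * x ^ 2 - q ^ 2 * x ^ 3 * zagierSum (x * q) q N +
      (∏ i ∈ Finset.range N, (1 - x * q ^ (i + 1))) * (q * x ^ 2 * (x * q) ^ N - x ^ N) := by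
  have hshift : ∀ k, (1 - x * q) * ∏ i ∈ Finset.range k, (1 - x * q * q ^ (i + 1)) =
      ∏ i ∈ Finset.range (k + 1), (1 - x * q ^ (i + 1)) := by
    intro k
    rw [Finset.prod_range_succ']
    rw [mul_comm]
    congr 1
    · refine Finset.prod_congr rfl fun i _ => ?_
      ring
    · ring
  induction N with
  | zero => simp [zagierSum]
  | succ N ih =>
    have h1 : zagierSum x q (N + 1) = zagierSum x q N +
        (1 - x) * (∏ i ∈ Finset.range N, (1 - x * q ^ (i + 1))) * x ^ N := by
      rw [zagierSum, Finset.sum_range_succ, ← zagierSum]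
    have h2 : zagierSum (x * q) q (N + 1) = zagierSum (x * q) q N +
        (∏ i ∈ Finset.range (N + 1), (1 - x * q ^ (i + 1))) * (x * q) ^ N := by
      rw [zagierSum, Finset.sum_range_succ, ← zagierSum, hshift]
    rw [h1, h2, ih, Finset.prod_range_succ]
    ring

end

/-! ### Zagier's identity and the coefficients of `F` -/

section
open Polynomial

lemma map_regExp {R R' : Type*} [CommRing R] [Algebra ℚ R] [CommRing R'] [Algebra ℚ R']
    (φ : R →+* R') (a : R[X]) : PowerSeries.map φ (regExp a) = regExp (a.map φ) := by
  ext m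
  rw [PowerSeries.coeff_map, coeff_regExp, coeff_regExp, map_mul, ← regSum_map, Polynomial.map_pow]
  congr 1
  exact RingHom.congr_fun (RingHom.ext_rat (φ.comp (algebraMap ℚ R)) (algebraMap ℚ R')) _

/-- The shift `j ↦ j + 1`. -/
noncomputable def shiftHom : ℚ[X] →+* ℚ[X] := compRingHom (X + C 1)

lemma shiftHom_apply (p : ℚ[X]) : shiftHom p = p.comp (X + C 1) := rfl

/-- A shift preserves the leading coefficient, which the equation also negates. This is the
uniqueness behind Zagier's identity. -/
lemma eq_zero_of_add_shiftHom {d : ℚ[X]} (h : d + shiftHom d = 0) : d = 0 := by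
  have h1 : (shiftHom d).leadingCoeff = d.leadingCoeff := by
    rw [shiftHom_apply]
    have : (X + C 1 : ℚ[X]).natDegree ≠ 0 := by rw [natDegree_X_add_C]; norm_num
    rw [leadingCoeff_comp this]
    have hl : (X + C 1 : ℚ[X]).leadingCoeff = 1 := leadingCoeff_X_add_C 1
    rw [hl]
    simp
  rw [← leadingCoeff_eq_zero]
  have h2 : shiftHom d = -d := by linear_combination h
  rw [h2, leadingCoeff_neg] at h1
  linarith

lemma prod_dvd_zagier (a : ℕ → ℚ[X]) (N : ℕ) :
    (PowerSeries.X : PowerSeries ℚ[X]) ^ N ∣ ∏ i ∈ Finset.range N, (1 - expU (a i)) := by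
  have := Finset.prod_dvd_prod_of_dvd (s := Finset.range N) (fun _ => (PowerSeries.X : PowerSeries ℚ[X]))
    (fun i => 1 - expU (a i)) fun i _ => X_dvd_one_sub_expU _
  simpa using this

/-- The exponent `-((n²-1)/24 + j (n-1)/2)`. -/
noncomputable def zagierExponent : ℚ[X][X] :=
  -(C (C (1 / 24)) * (X ^ 2 - 1) + C (C (1 / 2) * X) * (X - 1))

/-- In `zagierExponent` the outer variable is the summation index n and the inner one is j.
Replacing n by n + 6 gives the exponent for j + 1 minus 2 + 3j, which is the factor q² x³; the
surviving terms n = 1 and n = 5 are 1 and q x². -/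
lemma regExp_zagierExponent_functional :
    regExp zagierExponent + expU (-(C 2 + C 3 * X)) * PowerSeries.map shiftHom (regExp zagierExponent)
      = 1 - expU (-(C 1 + C 2 * X)) := by
  have h := regExp_add_comp zagierExponent
  rw [map_regExp, expU_mul_regExp]
  have h1 : C (-(C 2 + C 3 * X)) + zagierExponent.map shiftHom = zagierExponent.comp (X + C 6) := by
    simp only [zagierExponent, Polynomial.map_neg, Polynomial.map_add, Polynomial.map_mul,
      Polynomial.map_sub, Polynomial.map_pow, map_X, map_C, Polynomial.map_one, shiftHom_apply,
      mul_comp, C_comp, X_comp, neg_comp, add_comp, sub_comp, pow_comp, one_comp, C_neg, C_add, C_mul]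
    have e1 : (C (C (1 / 24)) : ℚ[X][X]) * 12 = C (C (1 / 2)) := by
      rw [← C_ofNat, ← C_ofNat, ← C_mul, ← C_mul]; norm_num
    have e2 : (C (C (1 / 2)) : ℚ[X][X]) * 2 = 1 := by
      rw [← C_ofNat, ← C_ofNat, ← C_mul, ← C_mul]; norm_num
    simp only [map_ofNat, C_1]
    linear_combination (X + 3) * e1 + (3 * C X + 2) * e2
  rw [h1, h]
  have h2 : zagierExponent.eval 1 = 0 := by simp [zagierExponent]
  have h5 : zagierExponent.eval 5 = -(C 1 + C 2 * X) := by
    simp only [zagierExponent, eval_neg, eval_add, eval_mul, eval_C, eval_sub, eval_pow, eval_X,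
      eval_one]
    have e1 : (C (1 / 24) : ℚ[X]) * 24 = 1 := by rw [← C_ofNat, ← C_mul]; norm_num
    have e2 : (C (1 / 2) : ℚ[X]) * 2 = 1 := by rw [← C_ofNat, ← C_mul]; norm_num
    simp only [C_ofNat, C_1]
    linear_combination -e1 - 2 * X * e2
  rw [h2, h5, expU_zero]

/-- Both series solve the same functional equation modulo u^N. If all coefficients of their
difference below order k vanish, the k-th one satisfies d(j) + d(j+1) = 0, since the multiplier q²
x³ has constant coefficient 1; so it vanishes too. -/
lemma coeff_zagierSum {N m : ℕ} (hm : m < N) :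
    PowerSeries.coeff m (zagierSum (expU (-X)) (expU (-1)) N : PowerSeries ℚ[X]) =
      PowerSeries.coeff m (regExp zagierExponent) := by
  set x : PowerSeries ℚ[X] := expU (-X) with hx
  set q : PowerSeries ℚ[X] := expU (-1) with hq
  set S : PowerSeries ℚ[X] := zagierSum x q N with hS
  have hσ : PowerSeries.map shiftHom S = zagierSum (x * q) q N := by
    have hσx : PowerSeries.map shiftHom x = x * q := by
      rw [hx, hq, map_expU, expU_mul, shiftHom_apply]
      congr 1
      simp
      ring
    have hσq : PowerSeries.map shiftHom q = q := by
      rw [hq, map_expU, shiftHom_apply]; simp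
    rw [hS, zagierSum, zagierSum]
    simp only [map_sum, map_mul, map_sub, map_one, map_prod, map_pow, hσx, hσq]
  have hqx : q ^ 2 * x ^ 3 = expU (-(C 2 + C 3 * X)) := by
    rw [hq, hx, expU_pow, expU_pow, expU_mul]
    congr 1
    simp only [C_ofNat]
    push_cast
    ring
  have hqx2 : q * x ^ 2 = expU (-(C 1 + C 2 * X)) := by
    rw [hq, hx, expU_pow, expU_mul]
    congr 1
    simp only [C_ofNat, C_1]
    push_cast
    ring
  obtain ⟨P, hP⟩ : (PowerSeries.X : PowerSeries ℚ[X]) ^ N ∣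
      ∏ i ∈ Finset.range N, (1 - x * q ^ (i + 1)) := by
    have : ∀ i : ℕ, x * q ^ (i + 1) = expU (-X + (i + 1 : ℕ) * (-1)) := by
      intro i
      rw [hq, hx, expU_pow, expU_mul]
    simp only [this]
    exact prod_dvd_zagier _ N
  set D := S - regExp zagierExponent with hD
  have hDeq : D + expU (-(C 2 + C 3 * X)) * PowerSeries.map shiftHom D =
      PowerSeries.X ^ N * (P * (q * x ^ 2 * (x * q) ^ N - x ^ N)) := by
    have h1 := zagierSum_functional x q N
    have h2 := regExp_zagierExponent_functional
    rw [hP, hqx2, hqx, ← hσ, ← hS] at h1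
    rw [hD, map_sub, hqx2]
    linear_combination h1 - h2
  have hzero : ∀ k < N, PowerSeries.coeff k D = 0 := by
    intro k
    induction k using Nat.strong_induction_on with
    | _ k ih =>
      intro hk
      have h := congrArg (PowerSeries.coeff k) hDeq
      rw [map_add, PowerSeries.coeff_X_pow_mul', if_neg (by omega), PowerSeries.coeff_mul,
        Finset.sum_eq_single (0, k)] at h
      · rw [coeff_expU, PowerSeries.coeff_map] at h
        apply eq_zero_of_add_shiftHom
        simpa using h
      · rintro ⟨i, l⟩ hil hne
        rw [Finset.HasAntidiagonal.mem_antidiagonal] at hil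
        have : l < k := by
          rcases Nat.eq_zero_or_pos i with h0 | h0
          · exact absurd (Prod.ext h0 (by simp at hil ⊢; omega)) hne
          · simp at hil; omega
        rw [PowerSeries.coeff_map, ih l this (by omega), map_zero, mul_zero]
      · intro hne
        simp at hne
  have := hzero m hm
  rw [hD, map_sub, sub_eq_zero] at this
  exact this

/-- The product rule for the derivative at j = 0 when the first factor vanishes there. -/
lemma coeff_one_mul_of_coeff_zero (p r : PowerSeries ℚ[X])
    (hp : PowerSeries.map (constantCoeff : ℚ[X] →+* ℚ) p = 0) (m : ℕ) :
    (PowerSeries.coeff m (p * r)).coeff 1 =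
      ∑ ij ∈ Finset.HasAntidiagonal.antidiagonal m, (PowerSeries.coeff ij.1 p).coeff 1 *
        PowerSeries.coeff ij.2 (PowerSeries.map (constantCoeff : ℚ[X] →+* ℚ) r) := by
  rw [PowerSeries.coeff_mul, finsetSum_coeff]
  refine Finset.sum_congr rfl fun ij _ => ?_
  have h0 : (PowerSeries.coeff ij.1 p).coeff 0 = 0 := by
    have := congrArg (PowerSeries.coeff ij.1) hp
    rwa [PowerSeries.coeff_map] at this
  rw [mul_coeff_one, h0, PowerSeries.coeff_map]
  simp

/-- At j = 0, that is x = 1, the prefactor 1 - x vanishes and has derivative u in j, while the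
remaining factors become (q)_k. The factor u accounts for the shift from m to m + 1. -/
lemma coeff_one_coeff_succ_zagierSum (N m : ℕ) :
    (PowerSeries.coeff (m + 1) (zagierSum (expU (-X)) (expU (-1)) N : PowerSeries ℚ[X])).coeff 1 =
      ∑ k ∈ Finset.range N, PowerSeries.coeff m (qFactorial k) := by
  rw [zagierSum, map_sum, finsetSum_coeff]
  refine Finset.sum_congr rfl fun k _ => ?_
  have hx : PowerSeries.map (constantCoeff : ℚ[X] →+* ℚ) (expU (-X)) = 1 := by
    rw [map_expU]; simp [expU_zero]
  have hq : PowerSeries.map (constantCoeff : ℚ[X] →+* ℚ) (expU (-1)) = expU (-1) := by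
    rw [map_expU]; simp
  rw [mul_assoc, coeff_one_mul_of_coeff_zero _ _ (by rw [map_sub, hx, map_one, sub_self]),
    Finset.sum_eq_single (1, m)]
  · rw [map_mul, map_prod, map_pow, hx, one_pow, mul_one]
    have h1 : (PowerSeries.coeff 1 (1 - expU (-X) : PowerSeries ℚ[X])).coeff 1 = 1 := by
      rw [map_sub, coeff_expU, PowerSeries.coeff_one]
      simp
    rw [h1, one_mul]
    congr 1
    rw [qFactorial]
    refine Finset.prod_congr rfl fun i _ => ?_
    rw [map_sub, map_mul, map_pow, map_one, hx, hq, one_mul, expU_pow]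
    congr 1
    rw [expU, expSeries]
    congr 2
    push_cast
    ring
  · rintro ⟨i, l⟩ hil hne
    rw [Finset.HasAntidiagonal.mem_antidiagonal] at hil
    simp only at hil ⊢
    have hi : i ≠ 1 := fun h => hne (by ext <;> simp <;> omega)
    have : (PowerSeries.coeff i (1 - expU (-X) : PowerSeries ℚ[X])).coeff 1 = 0 := by
      rw [map_sub, coeff_expU, PowerSeries.coeff_one, neg_pow, coeff_sub,
        IsScalarTower.algebraMap_apply ℚ ℚ ℚ[X], algebraMap_eq, coeff_C_mul]
      have h1 : ((-1 : ℚ[X]) ^ i * X ^ i).coeff 1 = 0 := by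
        rw [show (-1 : ℚ[X]) ^ i = C ((-1) ^ i) by simp, coeff_C_mul, coeff_X_pow, if_neg (by omega),
          mul_zero]
      rw [h1]
      split_ifs <;> simp [coeff_one]
    rw [this, zero_mul]
  · intro h
    exact absurd (by rw [Finset.HasAntidiagonal.mem_antidiagonal]; simp only; omega) h

lemma coeff_qFactorial_of_lt {m n : ℕ} (h : m < n) : PowerSeries.coeff m (qFactorial n) = 0 := by
  have : (PowerSeries.X : PowerSeries ℚ) ^ n ∣ qFactorial n := by
    have := Finset.prod_dvd_prod_of_dvd (s := Finset.range n) (fun _ => (PowerSeries.X : PowerSeries ℚ))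
      (fun k => 1 - expSeries (-((k : ℚ) + 1))) fun i _ => X_dvd_one_sub_expU _
    rwa [Finset.prod_const, Finset.card_range] at this
  exact PowerSeries.X_pow_dvd_iff.1 this m h

/-- The derivative of (a + jb)^{m+1} at j = 0 is (m+1) b a^m; the higher terms of the expansion
carry the factor j². -/
lemma coeff_one_regSum_pow (a b : ℚ[X]) (m : ℕ) :
    (regSum ℚ[X] ((a.map (algebraMap ℚ ℚ[X]) + C X * b.map (algebraMap ℚ ℚ[X])) ^ (m + 1))).coeff 1 =
      (m + 1) * regSumRat (b * a ^ m) := by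
  set φ := algebraMap ℚ ℚ[X] with hφ
  obtain ⟨k, hk⟩ := Polynomial.powAddExpansion (a.map φ) (C X * b.map φ) (m + 1)
  have e1 : ((m + 1 : ℕ) : ℚ[X][X]) * (a.map φ) ^ (m + 1 - 1) * (C X * b.map φ) =
      C (X * C ((m + 1 : ℕ) : ℚ)) * (b * a ^ m).map φ := by
    rw [Nat.add_sub_cancel, Polynomial.map_mul, Polynomial.map_pow, C_mul]
    simp only [C_eq_natCast]
    ring
  have e2 : k * (C X * b.map φ) ^ 2 = C (X ^ 2) * (k * (b.map φ) ^ 2) := by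
    rw [C_pow]
    ring
  rw [hk, e1, e2, ← Polynomial.map_pow, map_add, map_add, regSum_C_mul, regSum_C_mul,
    regSum_map_algebraMap, regSum_map_algebraMap, coeff_add, coeff_add, hφ, algebraMap_eq,
    coeff_C_of_ne_zero (by norm_num), mul_assoc, ← C_mul, mul_comm X, coeff_C_mul, coeff_X_one,
    mul_comm (X ^ 2), coeff_mul_X_pow', if_neg (by norm_num)]
  push_cast
  ring

lemma coeff_one_regSum_zagierExponent (m : ℕ) :
    (PowerSeries.coeff (m + 1) (regExp zagierExponent)).coeff 1 =
      regSumRat (C (-1 / 2) * (X - 1) * PowerSeries.coeff m (expU (-(C (1 / 24) * (X ^ 2 - 1))))) := by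
  have hz : zagierExponent = (-(C (1 / 24) * (X ^ 2 - 1)) : ℚ[X]).map (algebraMap ℚ ℚ[X]) +
      C X * ((C (-1 / 2) * (X - 1) : ℚ[X]).map (algebraMap ℚ ℚ[X])) := by
    simp only [zagierExponent, Polynomial.map_neg, Polynomial.map_mul, Polynomial.map_sub,
      Polynomial.map_pow, map_C, map_X, Polynomial.map_one, algebraMap_eq, C_mul]
    rw [show (-1 / 2 : ℚ) = -(1 / 2) by norm_num]
    simp only [C_neg]
    ring
  rw [coeff_regExp, hz, algebraMap_eq, coeff_C_mul, ← algebraMap_eq, coeff_one_regSum_pow, coeff_expU,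
    algebraMap_eq, ← smul_eq_C_mul (1 / (m.factorial : ℚ)), mul_smul_comm, map_smul, smul_eq_mul,
    Nat.factorial_succ]
  push_cast
  have : (m.factorial : ℚ) ≠ 0 := by positivity
  field_simp

/-- The identity f(e^{-u}) = -½ ∑ χ(n)(n-1) e^{-(n²-1)u/24}, with the right-hand side regularized,
results from comparing the derivatives at j = 0. -/
lemma coeff_kzSeries (m : ℕ) : PowerSeries.coeff m kzSeries =
    regSumRat (C (-1 / 2) * (X - 1) * PowerSeries.coeff m (expU (-(C (1 / 24) * (X ^ 2 - 1))))) := by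
  -- The coefficient of order m + 1 requires a truncation N > m + 1. With N = m + 2 the extra
  -- summand (q)_{m+1} is divisible by u^{m+1} and does not contribute.
  rw [← coeff_one_regSum_zagierExponent, ← coeff_zagierSum (N := m + 2) (by omega),
    coeff_one_coeff_succ_zagierSum, Finset.sum_range_succ, coeff_qFactorial_of_lt (by omega),
    kzSeries, PowerSeries.coeff_mk, add_zero]

lemma regSum_rat : regSum ℚ = regSumRat := by
  ext i
  simp [regSum_monomial, X_pow_eq_monomial]

/-- The factor e^{-u/24} turns the exponent -(n²-1)u/24 into -n²u/24, leaving pure powers of n. -/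
lemma coeff_F (m : ℕ) : PowerSeries.coeff m F =
    -(1 / 2) * ((-1 / 24) ^ m / m.factorial) * (regSumRat (X ^ (2 * m + 1)) - regSumRat (X ^ (2 * m))) := by
  have hF : F = PowerSeries.mk fun m => regSum ℚ (C (-1 / 2) * (X - 1) *
      PowerSeries.coeff m (expU (C (-1 / 24) + -(C (1 / 24) * (X ^ 2 - 1))))) := by
    rw [← expU_mul_mk_regSum, F, regSum_rat]
    congr 1
    ext m
    rw [coeff_kzSeries, PowerSeries.coeff_mk]
  rw [hF, PowerSeries.coeff_mk, coeff_expU, regSum_rat]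
  have : C (-1 / 2 : ℚ) * (X - 1) * (algebraMap ℚ ℚ[X] (1 / m.factorial) *
      (C (-1 / 24 : ℚ) + -(C (1 / 24) * (X ^ 2 - 1))) ^ m) =
      ((-(1 / 2) * ((-1 / 24) ^ m / m.factorial) : ℚ)) • (X ^ (2 * m + 1) - X ^ (2 * m) : ℚ[X]) := by
    rw [smul_eq_C_mul, algebraMap_eq]
    have h1 : (C (-1 / 24) + -(C (1 / 24) * (X ^ 2 - 1)) : ℚ[X]) = C (-1 / 24) * X ^ 2 := by
      rw [show (-1 / 24 : ℚ) = -(1 / 24) by norm_num, C_neg]; ring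
    rw [h1, mul_pow, ← C_pow, show (-(1 / 2) * ((-1 / 24) ^ m / m.factorial) : ℚ) =
      (-1 / 2) * (1 / m.factorial) * (-1 / 24) ^ m by ring, C_mul, C_mul]
    ring
  rw [this, map_smul, map_sub, smul_eq_mul]

/-- The reflection B_k(1 - y) = (-1)^k B_k(y) pairs 1/12 with 11/12 and 5/12 with 7/12. In
particular even powers have regularized sum zero, so only the odd power in `coeff_F` matters. -/
lemma regSumRat_X_pow (i : ℕ) : regSumRat (X ^ i) = -((12 : ℚ) ^ i / (i + 1)) *
    (1 + (-1) ^ (i + 1)) * ((Polynomial.bernoulli (i + 1)).eval (1 / 12) -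
      (Polynomial.bernoulli (i + 1)).eval (5 / 12)) := by
  have h1 := Polynomial.bernoulli_eval_one_sub (i + 1) (1 / 12)
  have h5 := Polynomial.bernoulli_eval_one_sub (i + 1) (5 / 12)
  norm_num at h1 h5
  rw [regSumRat_apply, X_pow_eq_monomial, antidiff_monomial]
  simp only [one_smul, eval_mul, eval_C, eval_comp, eval_X]
  norm_num
  rw [h1, h5]
  ring

lemma coeff_F_eq (m : ℕ) : PowerSeries.coeff m F =
    ((-1 / 24) ^ m / m.factorial) * ((12 : ℚ) ^ (2 * m + 1) / (2 * m + 2)) *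
    ((Polynomial.bernoulli (2 * (m + 1))).eval (1 / 12) -
      (Polynomial.bernoulli (2 * (m + 1))).eval (5 / 12)) := by
  rw [coeff_F, regSumRat_X_pow, regSumRat_X_pow]
  rw [show (-1 : ℚ) ^ (2 * m + 1) = -1 by rw [pow_succ, pow_mul]; norm_num,
    show (-1 : ℚ) ^ (2 * m + 1 + 1) = 1 by rw [pow_succ, pow_succ, pow_mul]; norm_num,
    show 2 * m + 1 + 1 = 2 * (m + 1) by ring]
  push_cast
  rw [show (2 * (m : ℚ) + 1 + 1) = 2 * m + 2 by ring]
  ring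

end

/-! ### The Taylor coefficients of `G` -/

lemma chi_eq_sin (n : ℕ) :
    (chi n : ℝ) = 2 / √3 * (Real.sin (π * n / 2) * Real.sin (π * n / 3)) := by
  have h3 : √3 ≠ 0 := by positivity
  have hs : Real.sin (π / 3) = √3 / 2 := Real.sin_pi_div_three
  obtain ⟨m, r, hr, rfl⟩ : ∃ m r, r < 12 ∧ n = r + 12 * m :=
    ⟨n / 12, n % 12, Nat.mod_lt _ (by norm_num), (Nat.mod_add_div n 12).symm⟩
  have e1 : Real.sin (π * (r + 12 * m : ℕ) / 2) = Real.sin (π * r / 2) := by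
    rw [← Real.sin_add_nat_mul_two_pi (π * r / 2) (3 * m)]
    congr 1; push_cast; ring
  have e2 : Real.sin (π * (r + 12 * m : ℕ) / 3) = Real.sin (π * r / 3) := by
    rw [← Real.sin_add_nat_mul_two_pi (π * r / 3) (2 * m)]
    congr 1; push_cast; ring
  have e3 : chi (r + 12 * m) = chi r := by
    unfold chi; rw [Nat.add_mul_mod_self_left]
  rw [e1, e2, e3]
  have s2 : ∀ k : ℕ, Real.sin (π * (2 * k : ℕ) / 2) = 0 := by
    intro k
    rw [← Real.sin_nat_mul_pi k]; congr 1; push_cast; ring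
  have s3 : ∀ k : ℕ, Real.sin (π * (3 * k : ℕ) / 3) = 0 := by
    intro k
    rw [← Real.sin_nat_mul_pi k]; congr 1; push_cast; ring
  have t1 : Real.sin (π * (1 : ℕ) / 2) = 1 := by rw [← Real.sin_pi_div_two]; congr 1; push_cast; ring
  have t5 : Real.sin (π * (5 : ℕ) / 2) = 1 := by
    rw [show π * (5 : ℕ) / 2 = π / 2 + 2 * π by push_cast; ring, Real.sin_add_two_pi,
      Real.sin_pi_div_two]
  have t7 : Real.sin (π * (7 : ℕ) / 2) = -1 := by
    rw [show π * (7 : ℕ) / 2 = π / 2 + π + 2 * π by push_cast; ring, Real.sin_add_two_pi,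
      Real.sin_add_pi, Real.sin_pi_div_two]
  have t11 : Real.sin (π * (11 : ℕ) / 2) = -1 := by
    rw [show π * (11 : ℕ) / 2 = -(π / 2) + (3 : ℕ) * (2 * π) by push_cast; ring,
      Real.sin_add_nat_mul_two_pi, Real.sin_neg, Real.sin_pi_div_two]
  have u1 : Real.sin (π * (1 : ℕ) / 3) = √3 / 2 := by rw [← hs]; congr 1; push_cast; ring
  have u7 : Real.sin (π * (7 : ℕ) / 3) = √3 / 2 := by
    rw [show π * (7 : ℕ) / 3 = π / 3 + 2 * π by push_cast; ring, Real.sin_add_two_pi, hs]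
  have u5 : Real.sin (π * (5 : ℕ) / 3) = -(√3 / 2) := by
    rw [show π * (5 : ℕ) / 3 = -(π / 3) + 2 * π by push_cast; ring, Real.sin_add_two_pi,
      Real.sin_neg, hs]
  have u11 : Real.sin (π * (11 : ℕ) / 3) = -(√3 / 2) := by
    rw [show π * (11 : ℕ) / 3 = -(π / 3) + (2 : ℕ) * (2 * π) by push_cast; ring,
      Real.sin_add_nat_mul_two_pi, Real.sin_neg, hs]
  interval_cases r
  · simp [chi]
  · rw [t1, u1]; simp [chi]
  · rw [s2 1]; simp [chi]
  · rw [s3 1]; simp [chi]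
  · rw [s2 2]; simp [chi]
  · rw [t5, u5]; simp [chi]
  · rw [s2 3]; simp [chi]
  · rw [t7, u7]; simp [chi]
  · rw [s2 4]; simp [chi]
  · rw [s3 3]; simp [chi]
  · rw [s2 5]; simp [chi]
  · rw [t11, u11]; simp [chi]

/-- This finite Fourier expansion expresses L(χ, 2K) through the cosine series of the Bernoulli
polynomial at 1/12 and 5/12. -/
lemma chi_eq_cos (n : ℕ) : (chi n : ℝ) =
    1 / √3 * (Real.cos (2 * π * n * (1 / 12)) - Real.cos (2 * π * n * (5 / 12))) := by
  rw [chi_eq_sin, Real.cos_sub_cos,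
    show (2 * π * n * (1 / 12) + 2 * π * n * (5 / 12)) / 2 = π * n / 2 by ring,
    show (2 * π * n * (1 / 12) - 2 * π * n * (5 / 12)) / 2 = -(π * n / 3) by ring, Real.sin_neg]
  ring

/-- The difference of the values of a Bernoulli polynomial that gives `L(χ, n)`. -/
noncomputable def bernoulliDiff (n : ℕ) : ℚ :=
  (Polynomial.bernoulli n).eval (1 / 12) - (Polynomial.bernoulli n).eval (5 / 12)

lemma hasSum_chi_div_pow {K : ℕ} (hK : K ≠ 0) :
    HasSum (fun n : ℕ => (chi n : ℝ) / (n : ℝ) ^ (2 * K))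
      (1 / √3 * ((-1 : ℝ) ^ (K + 1) * (2 * π) ^ (2 * K) / 2 / (2 * K).factorial *
        (bernoulliDiff (2 * K) : ℝ))) := by
  have h1 := hasSum_one_div_nat_pow_mul_cos hK (x := 1 / 12) (by constructor <;> norm_num)
  have h5 := hasSum_one_div_nat_pow_mul_cos hK (x := 5 / 12) (by constructor <;> norm_num)
  have hev : ∀ x : ℚ, (Polynomial.map (algebraMap ℚ ℝ) (Polynomial.bernoulli (2 * K))).eval (x : ℝ) =
      (((Polynomial.bernoulli (2 * K)).eval x : ℚ) : ℝ) := by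
    intro x
    exact Polynomial.eval_map_apply (f := algebraMap ℚ ℝ) x
  have e1 := hev (1 / 12)
  have e5 := hev (5 / 12)
  push_cast at e1 e5
  rw [e1] at h1
  rw [e5] at h5
  convert! (h1.sub h5).mul_left (1 / √3) using 1
  · ext n
    rw [chi_eq_cos]
    ring
  · rw [bernoulliDiff]
    push_cast
    ring

/-- The binomial coefficients of `(1 - z)^{-5/2}`. -/
noncomputable def binomFive (k : ℕ) : ℝ := (ascPochhammer ℝ k).eval (5 / 2) / k.factorial

lemma binomFive_zero : binomFive 0 = 1 := by simp [binomFive]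

lemma binomFive_succ (k : ℕ) : binomFive (k + 1) = binomFive k * ((5 / 2 + k) / (k + 1)) := by
  rw [binomFive, binomFive, ascPochhammer_succ_eval, Nat.factorial_succ]
  push_cast
  have : (k.factorial : ℝ) ≠ 0 := by positivity
  field_simp

lemma binomFive_nonneg (k : ℕ) : 0 ≤ binomFive k := by
  induction k with
  | zero => simp [binomFive_zero]
  | succ k ih => rw [binomFive_succ]; positivity

lemma hasSum_binomFive {z : ℂ} (hz : ‖z‖ < 1) :
    HasSum (fun k => (binomFive k : ℂ) * z ^ k) ((1 - z) ^ (-(5 / 2) : ℂ)) := by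
  have h := Complex.one_div_one_sub_cpow_hasFPowerSeriesOnBall_zero (5 / 2)
  have hz' : z ∈ Metric.eball (0 : ℂ) 1 := by
    rw [← ENNReal.ofReal_one, Metric.eball_ofReal]
    simpa using hz
  have h2 := h.hasSum hz'
  rw [zero_add, one_div, ← Complex.cpow_neg] at h2
  convert! h2 using 1
  ext k
  rw [FormalMultilinearSeries.ofScalars_apply_eq, smul_eq_mul]
  congr 1
  have h3 := Ring.descPochhammer_eq_factorial_smul_choose ((5 / 2 : ℂ) + k - 1) k
  rw [Polynomial.descPochhammer_smeval_eq_ascPochhammer,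
    show ((5 / 2 : ℂ) + k - 1) - k + 1 = 5 / 2 by ring] at h3
  have h4 : (((ascPochhammer ℝ k).eval (5 / 2) : ℝ) : ℂ) = (ascPochhammer ℂ k).eval (5 / 2 : ℂ) := by
    have := ascPochhammer_map Complex.ofRealHom k
    rw [← this]
    rw [show (5 / 2 : ℂ) = Complex.ofRealHom (5 / 2) by simp, Polynomial.eval_map_apply]
    rfl
  have h5 : (k.factorial : ℂ) ≠ 0 := by exact_mod_cast k.factorial_ne_zero
  rw [binomFive]
  push_cast
  rw [h4, div_eq_iff h5]
  rw [Polynomial.ascPochhammer_smeval_eq_eval, nsmul_eq_mul] at h3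
  rw [h3, mul_comm]

lemma binomFive_eq (k : ℕ) : binomFive k =
    (2 * k + 3).factorial / (6 * 4 ^ k * k.factorial * (k + 1).factorial) := by
  induction k with
  | zero => rw [binomFive_zero]; norm_num [Nat.factorial]
  | succ k ih =>
    rw [binomFive_succ, ih, show 2 * (k + 1) + 3 = (2 * k + 3) + 1 + 1 by ring,
      Nat.factorial_succ (2 * k + 3 + 1), Nat.factorial_succ (2 * k + 3), Nat.factorial_succ (k + 1),
      Nat.factorial_succ k]
    have : (k.factorial : ℝ) ≠ 0 := by positivity
    push_cast
    field_simp
    ring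

lemma pt_rpow (n : ℕ) (a : ℝ) : pt n ^ a = ((n : ℝ) * π / √6) ^ (2 * a) := by
  have h : pt n = ((n : ℝ) * π / √6) ^ (2 : ℝ) := by
    rw [Real.rpow_two, div_pow, Real.sq_sqrt (by norm_num), pt, mul_pow]
  rw [h, ← Real.rpow_mul (by positivity)]

lemma real_coeffG_mul_rpow (n : ℕ) : 3 * π / (2 * √2) * chi n * n * pt n ^ (-(5 / 2) : ℝ) =
    54 * √3 / π ^ 4 * (chi n / (n : ℝ) ^ 4) := by
  rcases Nat.eq_zero_or_pos n with rfl | hn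
  · simp [chi]
  have hn' : (n : ℝ) ≠ 0 := by positivity
  have h6 : √6 = √2 * √3 := by rw [← Real.sqrt_mul (by norm_num)]; norm_num
  have h2 : √2 ^ 2 = 2 := Real.sq_sqrt (by norm_num)
  have h3 : √3 ^ 2 = 3 := Real.sq_sqrt (by norm_num)
  rw [pt_rpow, show (2 * -(5 / 2) : ℝ) = ((-5 : ℤ) : ℝ) by norm_num, Real.rpow_intCast, h6,
    show (-5 : ℤ) = -((5 : ℕ) : ℤ) by norm_num, zpow_neg, zpow_natCast]
  field_simp
  rw [show √2 ^ 4 = (√2 ^ 2) ^ 2 by ring, show √3 ^ 4 = (√3 ^ 2) ^ 2 by ring, h2, h3]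
  ring

/-- The k-th Taylor coefficient of the n-th term is a multiple, depending on k only, of
χ(n)/n^{2k+4}. The sum is thus a multiple of L(χ, 2k+4), and its Bernoulli expression matches
a_{k+1}/k!. -/
lemma hasSum_taylorCoeff (k : ℕ) :
    HasSum (fun n => coeffG n * (pt n : ℂ) ^ (-(5 / 2) : ℂ) * (binomFive k / (pt n : ℂ) ^ k))
      ((PowerSeries.coeff k (borel F) : ℚ) : ℂ) := by
  have h := (hasSum_chi_div_pow (K := k + 2) (by omega)).mul_left
    (54 * √3 / π ^ 4 * (6 / π ^ 2) ^ k * binomFive k)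
  have hv : 54 * √3 / π ^ 4 * (6 / π ^ 2) ^ k * binomFive k *
      (1 / √3 * ((-1 : ℝ) ^ (k + 2 + 1) * (2 * π) ^ (2 * (k + 2)) / 2 / (2 * (k + 2)).factorial *
        (bernoulliDiff (2 * (k + 2)) : ℝ))) = ((PowerSeries.coeff k (borel F) : ℚ) : ℝ) := by
    rw [borel, PowerSeries.coeff_mk, coeff_F_eq, show k + 1 + 1 = k + 2 by ring, ← bernoulliDiff,
      binomFive_eq, show 2 * (k + 2) = 2 * k + 3 + 1 by ring, Nat.factorial_succ (2 * k + 3)]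
    have hk : (k.factorial : ℝ) ≠ 0 := by positivity
    have hk1 : ((k + 1).factorial : ℝ) ≠ 0 := by positivity
    have hk3 : ((2 * k + 3).factorial : ℝ) ≠ 0 := by positivity
    have hs3 : √3 ≠ 0 := by positivity
    push_cast
    rw [div_pow, div_pow, show (-1 : ℝ) ^ (k + 2 + 1) = -(-1) ^ k by ring,
      show (-1 : ℝ) ^ (k + 1) = -(-1) ^ k by ring, mul_pow, ← pow_mul π,
      show (2 : ℝ) ^ (2 * k + 3 + 1) = 16 * 4 ^ k by
        rw [pow_add, pow_add, pow_mul]; norm_num; ring,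
      show π ^ (2 * k + 3 + 1) = π ^ (2 * k) * π ^ 4 by ring,
      show (12 : ℝ) ^ (2 * (k + 1) + 1) = 1728 * (24 ^ k * 6 ^ k) by
        rw [← mul_pow, show 2 * (k + 1) + 1 = 2 * k + 3 by ring, pow_add, pow_mul]; norm_num; ring,
      show (24 : ℝ) ^ (k + 1) = 24 * 24 ^ k by ring]
    field_simp
    ring
  rw [hv] at h
  have h2 := Complex.hasSum_ofReal.2 h
  convert! h2 using 1
  ext n
  rw [show (-(5 / 2) : ℂ) = ((-(5 / 2) : ℝ) : ℂ) by push_cast; rfl,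
    ← Complex.ofReal_cpow (by unfold pt; positivity)]
  have hr := real_coeffG_mul_rpow n
  rw [show 54 * √3 / π ^ 4 * (6 / π ^ 2) ^ k * binomFive k * (chi n / (n : ℝ) ^ (2 * (k + 2))) =
    54 * √3 / π ^ 4 * (chi n / (n : ℝ) ^ 4) * (binomFive k / pt n ^ k) by
      rcases Nat.eq_zero_or_pos n with rfl | hn
      · simp [chi]
      have hn' : (n : ℝ) ≠ 0 := by positivity
      rw [pt, div_pow, div_pow, mul_pow, ← pow_mul, ← pow_mul]
      field_simp
      ring, ← hr, coeffG]
  push_cast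
  ring

lemma ofReal_mul_cpow {A : ℝ} (hA : 0 < A) {z : ℂ} (hz : z ≠ 0) (w : ℂ) :
    ((A : ℂ) * z) ^ w = (A : ℂ) ^ w * z ^ w := by
  have hA' : (A : ℂ) ≠ 0 := by exact_mod_cast hA.ne'
  rw [Complex.cpow_def_of_ne_zero (mul_ne_zero hA' hz), Complex.log_ofReal_mul hA hz,
    Complex.cpow_def_of_ne_zero hA', Complex.cpow_def_of_ne_zero hz, ← Complex.exp_add,
    Complex.ofReal_log hA.le, add_mul]

lemma hasSum_termG {n : ℕ} {p : ℂ} (hp : ‖p‖ < pt n) :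
    HasSum (fun k => coeffG n * (pt n : ℂ) ^ (-(5 / 2) : ℂ) * (binomFive k / (pt n : ℂ) ^ k) * p ^ k)
      (termG n p) := by
  have hA : 0 < pt n := (norm_nonneg p).trans_lt hp
  have hA' : (pt n : ℂ) ≠ 0 := by exact_mod_cast hA.ne'
  have hz : ‖p / (pt n : ℂ)‖ < 1 := by
    rw [norm_div, Complex.norm_real, Real.norm_eq_abs, abs_of_pos hA, div_lt_one hA]; exact hp
  have h := (hasSum_binomFive hz).mul_left (coeffG n * (pt n : ℂ) ^ (-(5 / 2) : ℂ))
  have e : termG n p =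
      coeffG n * (pt n : ℂ) ^ (-(5 / 2) : ℂ) * (1 - p / (pt n : ℂ)) ^ (-(5 / 2) : ℂ) := by
    have h1 : 1 - p / (pt n : ℂ) ≠ 0 := by
      intro h0
      rw [sub_eq_zero] at h0
      rw [← h0] at hz
      simp at hz
    rw [termG, mul_assoc, ← ofReal_mul_cpow hA h1]
    congr 2
    field_simp
  rw [e]
  convert! h using 1
  ext k
  rw [div_pow]
  ring

/-- The Borel transform of `F` converges to `G`. -/
theorem hasSum_borel {p : ℂ} (hp : ‖p‖ < π ^ 2 / 6) :
    HasSum (fun n => ((PowerSeries.coeff n (borel F) : ℚ) : ℂ) * p ^ n) (G p) := by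
  have hA1 : 0 < π ^ 2 / 6 := by positivity
  set f : ℕ × ℕ → ℂ := fun x =>
    coeffG x.1 * (pt x.1 : ℂ) ^ (-(5 / 2) : ℂ) * (binomFive x.2 / (pt x.1 : ℂ) ^ x.2) * p ^ x.2 with hf
  have hlt : ∀ n ∈ chiSupport, ‖p‖ < pt n := fun n hn => hp.trans_le (pt_one_le_of_mem hn)
  have hfz : ∀ n ∉ chiSupport, ∀ k, f (n, k) = 0 := fun n hn k => by
    simp [hf, coeffG_eq_zero hn]
  have hfib : ∀ n, HasSum (fun k => f (n, k)) (termG n p) := by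
    intro n
    by_cases hn : n ∈ chiSupport
    · exact hasSum_termG (hlt n hn)
    · simp only [hfz n hn, termG_eq_zero hn]
      exact hasSum_zero
  set ρ : ℝ := ‖p‖ / (π ^ 2 / 6) with hρ
  have hρ0 : 0 ≤ ρ := by positivity
  have hρ1 : ρ < 1 := (div_lt_one hA1).2 hp
  have hs1 : Summable fun n => ‖termG n 0‖ :=
    summable_norm_termG ((mem_sheet_zero_iff 0).2 (Or.inr (by simpa using hA1)))
  have hs2 : Summable fun k => binomFive k * ρ ^ k := by
    have := (hasSum_binomFive (z := (ρ : ℂ)) (by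
      rw [Complex.norm_real, Real.norm_eq_abs, abs_of_nonneg hρ0]; exact hρ1)).summable
    rw [← Complex.summable_ofReal]
    simpa using this
  -- As π²/6 ≤ pt n on the support, the double series is dominated by the product of ∑ ‖termG n 0‖
  -- and the binomial series at ρ = ‖p‖/(π²/6) < 1.
  have hsum : Summable f := by
    refine Summable.of_norm_bounded (g := fun x : ℕ × ℕ => ‖termG x.1 0‖ * (binomFive x.2 * ρ ^ x.2))
      (hs1.mul_of_nonneg hs2 (fun _ => norm_nonneg _)
        (fun k => mul_nonneg (binomFive_nonneg k) (by positivity))) ?_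
    rintro ⟨n, k⟩
    by_cases hn : n ∈ chiSupport
    · have hA : 0 < pt n := pt_pos_of_mem hn
      simp only [hf, termG, sub_zero, norm_mul, norm_div, norm_pow, Complex.norm_real,
        Real.norm_eq_abs, abs_of_nonneg (binomFive_nonneg k), abs_of_pos hA]
      have : ‖p‖ / pt n ≤ ρ := by
        rw [hρ]; gcongr; exact pt_one_le_of_mem hn
      have h2 : (‖p‖ / pt n) ^ k ≤ ρ ^ k := by gcongr
      calc _ = ‖coeffG n‖ * ‖(pt n : ℂ) ^ (-(5 / 2) : ℂ)‖ * (binomFive k * (‖p‖ / pt n) ^ k) := by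
            rw [div_pow]; ring
        _ ≤ _ := by
            have := binomFive_nonneg k
            gcongr
    · rw [hfz n hn]
      simp only [norm_zero]
      exact mul_nonneg (norm_nonneg _) (mul_nonneg (binomFive_nonneg k) (by positivity))
  have hG : HasSum f (G p) := by
    have h1 := hsum.hasSum.prod_fiberwise hfib
    rw [G, h1.tsum_eq]
    exact hsum.hasSum
  have hswap : HasSum (f ∘ Prod.swap) (G p) := (Equiv.prodComm ℕ ℕ).hasSum_iff.2 hG
  refine hswap.prod_fiberwise fun k => ?_
  exact (hasSum_taylorCoeff k).mul_right (p ^ k)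

lemma constantCoeff_F : PowerSeries.constantCoeff F = 1 := by
  rw [← PowerSeries.coeff_zero_eq_constantCoeff_apply, F, PowerSeries.coeff_mul]
  simp [kzSeries, qFactorial, expSeries]

/-- The value of the series giving the boundary terms of the integrations by parts. -/
lemma hasSum_boundary :
    HasSum (fun n => 2 / 3 * coeffG n * (pt n : ℂ) ^ (-(3 / 2) : ℂ)) 1 := by
  have h := (hasSum_chi_div_pow (K := 1) (by omega)).mul_left (6 * √3 / π ^ 2)
  have hv : 6 * √3 / π ^ 2 * (1 / √3 * ((-1 : ℝ) ^ (1 + 1) * (2 * π) ^ (2 * 1) / 2 /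
      (2 * 1).factorial * (bernoulliDiff (2 * 1) : ℝ))) = 1 := by
    -- The value is read off from a₀ = 1; so the boundary terms sum to exactly the constant term of
    -- F.
    have : bernoulliDiff (2 * 1) = 1 / 6 := by
      have h := coeff_F_eq 0
      rw [PowerSeries.coeff_zero_eq_constantCoeff_apply, constantCoeff_F, ← bernoulliDiff] at h
      norm_num at h ⊢
      linarith
    rw [this]
    norm_num
    field_simp
  rw [hv] at h
  have h2 := Complex.hasSum_ofReal.2 h
  rw [Complex.ofReal_one] at h2
  convert! h2 using 1
  ext n
  rcases Nat.eq_zero_or_pos n with rfl | hn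
  · simp [coeffG]
  have hn' : (n : ℝ) ≠ 0 := by positivity
  rw [show (-(3 / 2) : ℂ) = ((-(3 / 2) : ℝ) : ℂ) by push_cast; rfl,
    ← Complex.ofReal_cpow (by unfold pt; positivity), coeffG]
  norm_cast
  have h6 : √6 = √2 * √3 := by rw [← Real.sqrt_mul (by norm_num)]; norm_num
  have hs2 : √2 ^ 2 = 2 := Real.sq_sqrt (by norm_num)
  have hs3 : √3 ^ 2 = 3 := Real.sq_sqrt (by norm_num)
  rw [pt_rpow, show (2 * -(3 / 2) : ℝ) = ((-3 : ℤ) : ℝ) by norm_num, Real.rpow_intCast, h6,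
    show (-3 : ℤ) = -((3 : ℕ) : ℤ) by norm_num, zpow_neg, zpow_natCast]
  push_cast
  field_simp
  have hs2' : ((√2 : ℝ) : ℂ) ^ 2 = 2 := by exact_mod_cast hs2
  have hs3' : ((√3 : ℝ) : ℂ) ^ 2 = 3 := by exact_mod_cast hs3
  rw [hs2', hs3']
  ring

/-! ### Determinations of the square roots -/

lemma sqrt_sq (z : ℂ) : (z ^ (1 / 2 : ℂ)) ^ 2 = z := by
  rw [one_div]
  exact_mod_cast Complex.cpow_nat_inv_pow z (n := 2) two_ne_zero

lemma re_pos_of_norm_sub_one_lt {u : ℂ} (h : ‖u - 1‖ < 1) : 0 < u.re := by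
  have h1 := (Complex.abs_re_le_norm (u - 1)).trans_lt h
  rw [Complex.sub_re, Complex.one_re, abs_lt] at h1
  linarith

lemma mem_slitPlane_of_norm_sub_one_lt {u : ℂ} (h : ‖u - 1‖ < 1) : u ∈ Complex.slitPlane :=
  Or.inl (re_pos_of_norm_sub_one_lt h)

/-- The arguments of u and v lie in (-π/2, π/2), so their difference stays in (-π, π) and log(u/v) =
log u - log v. -/
lemma div_cpow_mul_cpow {u v : ℂ} (hu : 0 < u.re) (hv : 0 < v.re) (a : ℂ) :
    (u / v) ^ a * v ^ a = u ^ a := by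
  have hu0 : u ≠ 0 := by rintro rfl; simp at hu
  have hv0 : v ≠ 0 := by rintro rfl; simp at hv
  have h1 := abs_lt.1 (Complex.abs_arg_lt_pi_div_two_iff.2 (Or.inl hu))
  have h2 := abs_lt.1 (Complex.abs_arg_lt_pi_div_two_iff.2 (Or.inl hv))
  have hlog : Complex.log (u / v) = Complex.log u - Complex.log v := by
    rw [← Complex.log_exp (x := Complex.log u - Complex.log v), Complex.exp_sub,
      Complex.exp_log hu0, Complex.exp_log hv0]
    · simp only [Complex.sub_im, Complex.log_im]; linarith
    · simp only [Complex.sub_im, Complex.log_im]; linarith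
  rw [Complex.cpow_def_of_ne_zero (div_ne_zero hu0 hv0), Complex.cpow_def_of_ne_zero hv0,
    Complex.cpow_def_of_ne_zero hu0, ← Complex.exp_add, hlog]
  congr 1
  ring

lemma norm_inv_pow_five {w z : ℂ} (h : w ^ 2 = z) : ‖(w ^ 5)⁻¹‖ = ‖z‖ ^ (-(5 / 2) : ℝ) := by
  rw [← h, norm_inv, norm_pow, norm_pow, ← Real.rpow_natCast, ← Real.rpow_natCast,
    ← Real.rpow_mul (norm_nonneg _), ← Real.rpow_neg (norm_nonneg _)]
  norm_num

lemma exists_le_norm_pt_sub {c : ℂ} (hc : c ∉ singSet) :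
    ∃ d > 0, ∀ n ∈ chiSupport, d ≤ ‖(pt n : ℂ) - c‖ := by
  obtain ⟨r, hr, d, hd, h⟩ := exists_mul_sq_le_norm_pt_sub chiSupport c fun n hn hne =>
    hc (hne ▸ pt_mem_singSet hn)
  refine ⟨d, hd, fun n hn => le_trans ?_ (h c (Metric.mem_ball_self hr) n hn)⟩
  have : (1 : ℝ) ≤ n := by exact_mod_cast pos_of_mem_chiSupport hn
  nlinarith [one_le_pow₀ this (n := 2)]

/-- The ratio `(pt n - p) / (pt n - c)`. -/
noncomputable def ptRatio (c p : ℂ) (n : ℕ) : ℂ := ((pt n : ℂ) - p) / ((pt n : ℂ) - c)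

lemma norm_ptRatio_sub_one_lt {c p : ℂ} {n : ℕ} (h : ‖p - c‖ < ‖(pt n : ℂ) - c‖) :
    ‖ptRatio c p n - 1‖ < 1 := by
  have h0 : 0 < ‖(pt n : ℂ) - c‖ := (norm_nonneg _).trans_lt h
  rw [ptRatio, div_sub_one (norm_pos_iff.1 h0), norm_div, div_lt_one h0,
    show (pt n : ℂ) - p - ((pt n : ℂ) - c) = -(p - c) by ring, norm_neg]
  exact h

lemma ptRatio_self {c : ℂ} {n : ℕ} (h : (pt n : ℂ) ≠ c) : ptRatio c c n = 1 :=
  div_self (sub_ne_zero.2 h)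

lemma ptRatio_div {c c' : ℂ} {n : ℕ} (hc : (pt n : ℂ) ≠ c) (p : ℂ) :
    ptRatio c p n / ptRatio c c' n = ptRatio c' p n := by
  unfold ptRatio
  rw [div_div_div_cancel_right₀ (sub_ne_zero.2 hc)]

/-- The square root of `pt n - p`, for `p` near `c`, with value `w` at `c`. -/
noncomputable def rootAt (c w : ℂ) (n : ℕ) (p : ℂ) : ℂ := w * ptRatio c p n ^ (1 / 2 : ℂ)

lemma rootAt_sq {c w : ℂ} {n : ℕ} (hc : (pt n : ℂ) ≠ c) (hw : w ^ 2 = (pt n : ℂ) - c) (p : ℂ) :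
    rootAt c w n p ^ 2 = (pt n : ℂ) - p := by
  rw [rootAt, mul_pow, sqrt_sq, hw, ptRatio, mul_div_cancel₀ _ (sub_ne_zero.2 hc)]

lemma differentiableAt_rootAt {c w p : ℂ} {n : ℕ} (h : ‖p - c‖ < ‖(pt n : ℂ) - c‖) :
    DifferentiableAt ℂ (rootAt c w n) p := by
  unfold rootAt
  have h1 := mem_slitPlane_of_norm_sub_one_lt (norm_ptRatio_sub_one_lt h)
  have h2 : DifferentiableAt ℂ (fun p => ptRatio c p n) p := by
    unfold ptRatio
    fun_prop
  exact (h2.cpow_const h1).const_mul w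

lemma analyticAt_rootAt_self {c w : ℂ} {n : ℕ} (hc : (pt n : ℂ) ≠ c) :
    AnalyticAt ℂ (rootAt c w n) c := by
  refine DifferentiableOn.analyticAt (s := Metric.ball c ‖(pt n : ℂ) - c‖) ?_
    (Metric.ball_mem_nhds c (norm_pos_iff.2 (sub_ne_zero.2 hc)))
  intro p hp
  rw [mem_ball_iff_norm] at hp
  exact (differentiableAt_rootAt hp).differentiableWithinAt

/-- Both ratios relative to c lie in the disc of radius 1 about 1, hence in the right half-plane,
where principal roots are multiplicative. The choice of the centre is therefore immaterial. -/
lemma rootAt_rootAt {c c' w p : ℂ} {n : ℕ} (hc' : ‖c' - c‖ < ‖(pt n : ℂ) - c‖)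
    (hp : ‖p - c‖ < ‖(pt n : ℂ) - c‖) : rootAt c' (rootAt c w n c') n p = rootAt c w n p := by
  have h0 : (pt n : ℂ) ≠ c := sub_ne_zero.1 (norm_pos_iff.1 ((norm_nonneg _).trans_lt hp))
  have := div_cpow_mul_cpow (re_pos_of_norm_sub_one_lt (norm_ptRatio_sub_one_lt hp))
    (re_pos_of_norm_sub_one_lt (norm_ptRatio_sub_one_lt hc')) (1 / 2)
  rw [ptRatio_div h0] at this
  rw [rootAt, rootAt, rootAt, ← this]
  ring

/-- The sum of the series for `G` with determinations `w n` of the square roots at `c`. -/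
noncomputable def branchSum (c : ℂ) (w : ℕ → ℂ) (p : ℂ) : ℂ :=
  ∑' n, coeffG n * (rootAt c (w n) n p ^ 5)⁻¹

lemma branchSum_spec {c : ℂ} {w : ℕ → ℂ} (hc : c ∉ singSet)
    (hw : ∀ n ∈ chiSupport, w n ^ 2 = (pt n : ℂ) - c) :
    (∀ᶠ p in 𝓝 c, Summable fun n => ‖coeffG n * (rootAt c (w n) n p ^ 5)⁻¹‖) ∧
      AnalyticAt ℂ (branchSum c w) c := by
  obtain ⟨d, hd, hdc⟩ := exists_le_norm_pt_sub hc
  have hne : ∀ n ∈ chiSupport, (pt n : ℂ) ≠ c := fun n hn h => hc (h ▸ pt_mem_singSet hn)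
  refine summable_and_analyticAt_tsum (S := chiSupport)
    (u := fun n p => coeffG n * (rootAt c (w n) n p ^ 5)⁻¹) hne (Metric.ball_mem_nhds c hd) ?_ ?_ ?_
  · intro n hn p hp
    rw [mem_ball_iff_norm] at hp
    have h1 := differentiableAt_rootAt (w := w n) (hp.trans_le (hdc n hn))
    have h2 : rootAt c (w n) n p ≠ 0 := by
      intro h0
      have := rootAt_sq (hne n hn) (hw n hn) p
      rw [h0] at this
      have h3 := hdc n hn
      rw [show (pt n : ℂ) = p by linear_combination -this] at h3
      linarith
    exact (((h1.pow 5).inv (pow_ne_zero 5 h2)).const_mul _).differentiableWithinAt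
  · intro n hn p _
    rw [norm_mul, norm_inv_pow_five (rootAt_sq (hne n hn) (hw n hn) p)]
  · intro n hn p
    simp [coeffG_eq_zero hn]

lemma branchSum_rebase {c c' : ℂ} {w w' : ℕ → ℂ} {d : ℝ}
    (hd : ∀ n ∈ chiSupport, d ≤ ‖(pt n : ℂ) - c‖) (hc' : ‖c' - c‖ < d)
    (hw' : ∀ n ∈ chiSupport, w' n = rootAt c (w n) n c') {p : ℂ} (hp : ‖p - c‖ < d) :
    branchSum c' w' p = branchSum c w p := by
  refine tsum_congr fun n => ?_
  by_cases hn : n ∈ chiSupport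
  · rw [hw' n hn, rootAt_rootAt (hc'.trans_le (hd n hn)) (hp.trans_le (hd n hn))]
  · simp [coeffG_eq_zero hn]

/-- Square roots of `pt n - γ t`, continuous along the path. -/
lemma exists_continuous_roots {q : ℂ} (γ : Path (0 : ℂ) q) (hγ : ∀ t, γ t ∉ singSet) :
    ∃ ω : ℕ → unitInterval → ℂ, ∀ n ∈ chiSupport, Continuous (ω n) ∧
      ω n 0 = (pt n : ℂ) ^ (1 / 2 : ℂ) ∧ ∀ t, ω n t ^ 2 = (pt n : ℂ) - γ t := by
  have : ∀ n ∈ chiSupport, ∃ ω : unitInterval → ℂ, Continuous ω ∧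
      ω 0 = (pt n : ℂ) ^ (1 / 2 : ℂ) ∧ ∀ t, ω t ^ 2 = (pt n : ℂ) - γ t := by
    intro n hn
    have hne : ∀ t, (pt n : ℂ) - γ t ≠ 0 := fun t h =>
      hγ t ((sub_eq_zero.1 h) ▸ pt_mem_singSet hn)
    have hA : (pt n : ℂ) ≠ 0 := by exact_mod_cast (pt_pos_of_mem hn).ne'
    -- A logarithm of pt n - γ t is lifted through the covering exp : ℂ → ℂ∖{0}, starting at the
    -- principal value; half of it exponentiates to the root.
    obtain ⟨L, hL, hL0⟩ := Complex.isCoveringMap_exp.exists_path_lifts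
      (⟨fun t => ⟨(pt n : ℂ) - γ t, hne t⟩, by fun_prop⟩ : C(unitInterval, {z : ℂ // z ≠ 0}))
      (Complex.log (pt n)) (by simp [Complex.exp_log hA])
    refine ⟨fun t => Complex.exp (L t / 2), by fun_prop, ?_, fun t => ?_⟩
    · simp only [hL0, Complex.cpow_def_of_ne_zero hA]
      congr 1
      ring
    · rw [← Complex.exp_nat_mul]
      have := congrArg Subtype.val (congrFun hL t)
      simp only [Function.comp_apply, ContinuousMap.coe_mk] at this
      rw [← this]
      congr 1
      push_cast
      ring
  choose! ω h using this
  exact ⟨ω, h⟩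

lemma exists_isPreconnected_subset {t : unitInterval} {U : Set unitInterval} (hU : U ∈ 𝓝 t) :
    ∃ V ∈ 𝓝 t, IsPreconnected V ∧ V ⊆ U := by
  obtain ⟨ε, hε, hU⟩ := Metric.mem_nhds_iff.1 hU
  refine ⟨projIcc (0 : ℝ) 1 zero_le_one '' Metric.ball (t : ℝ) ε, ?_, ?_, ?_⟩
  · filter_upwards [Metric.ball_mem_nhds t hε] with s hs
    exact ⟨s, hs, projIcc_val zero_le_one s⟩
  · exact (convex_ball _ _).isPreconnected.image _ continuous_projIcc.continuousOn
  · rintro _ ⟨s, hs, rfl⟩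
    apply hU
    rw [Metric.mem_ball, Real.dist_eq] at hs
    rw [Metric.mem_ball, Subtype.dist_eq, Real.dist_eq]
    have := abs_projIcc_sub_projIcc (a := (0 : ℝ)) (b := 1) zero_le_one (c := s) (d := t)
    rw [projIcc_val zero_le_one t] at this
    exact this.trans_lt hs

/-- Two continuous square roots of the same nowhere vanishing function on a connected set agree if
they agree at one point. Since d bounds all distances at once, one neighbourhood of t serves every
n. -/
lemma eventually_eq_rootAt {q : ℂ} (γ : Path (0 : ℂ) q) {ω : ℕ → unitInterval → ℂ}
    (hω : ∀ n ∈ chiSupport, Continuous (ω n) ∧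
      ω n 0 = (pt n : ℂ) ^ (1 / 2 : ℂ) ∧ ∀ t, ω n t ^ 2 = (pt n : ℂ) - γ t)
    (t : unitInterval) {d : ℝ} (hd0 : 0 < d) (hd : ∀ n ∈ chiSupport, d ≤ ‖(pt n : ℂ) - γ t‖) :
    ∀ᶠ s in 𝓝 t, ‖γ s - γ t‖ < d ∧
      ∀ n ∈ chiSupport, ω n s = rootAt (γ t) (ω n t) n (γ s) := by
  have hU : γ ⁻¹' Metric.ball (γ t) d ∈ 𝓝 t :=
    γ.continuous.continuousAt (Metric.ball_mem_nhds _ hd0)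
  obtain ⟨V, hV, hVc, hVU⟩ := exists_isPreconnected_subset hU
  have hVb : ∀ s ∈ V, ‖γ s - γ t‖ < d := fun s hs => by
    have := hVU hs
    rwa [mem_preimage, mem_ball_iff_norm] at this
  filter_upwards [hV] with s hs
  refine ⟨hVb s hs, fun n hn => ?_⟩
  obtain ⟨hc, -, hsq⟩ := hω n hn
  have hne : (pt n : ℂ) ≠ γ t := sub_ne_zero.1 (norm_pos_iff.1 (hd0.trans_le (hd n hn)))
  refine hVc.eq_of_sq_eq (g := fun s => rootAt (γ t) (ω n t) n (γ s)) hc.continuousOn ?_ ?_ ?_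
    (mem_of_mem_nhds hV) ?_ hs
  · intro s hs
    exact ((differentiableAt_rootAt ((hVb s hs).trans_le (hd n hn))).continuousAt.comp
      γ.continuous.continuousAt).continuousWithinAt
  · intro s _
    simp only [Pi.pow_apply]
    rw [hsq s, rootAt_sq hne (hsq t)]
  · intro s hs h0
    have h1 := rootAt_sq hne (hsq t) (γ s)
    rw [h0] at h1
    have h2 := hVb s hs
    rw [show γ s = (pt n : ℂ) by linear_combination h1] at h2
    linarith [hd n hn]
  · rw [rootAt, ptRatio_self hne, Complex.one_cpow, mul_one]

/-- The continuation of `G` along a path, given by continuous determinations of the roots. -/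
lemma isContinuationAlong_branchSum {q : ℂ} (γ : Path (0 : ℂ) q) (hγ : ∀ t, γ t ∉ singSet)
    {ω : ℕ → unitInterval → ℂ}
    (hω : ∀ n ∈ chiSupport, Continuous (ω n) ∧
      ω n 0 = (pt n : ℂ) ^ (1 / 2 : ℂ) ∧ ∀ t, ω n t ^ 2 = (pt n : ℂ) - γ t) :
    IsContinuationAlong G γ fun t => branchSum (γ t) fun n => ω n t := by
  constructor
  · have : ∀ᶠ p : ℂ in 𝓝 0, p ∈ sheet sing 0 :=
      (isOpen_sheet sing 0).mem_nhds ((mem_sheet_zero_iff 0).2 (Or.inr (by simp; positivity)))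
    filter_upwards [this] with p hp
    refine tsum_congr fun n => ?_
    by_cases hn : n ∈ chiSupport
    · have hA := pt_pos_of_mem hn
      have hz : (pt n : ℂ) - p ≠ 0 := Complex.slitPlane_ne_zero
        (mem_slitPlane_pt_sub (im_ne_zero_or_lt_of_mem_sheet hp hn))
      have hA' : (pt n : ℂ) ≠ 0 := by exact_mod_cast hA.ne'
      beta_reduce
      rw [(hω n hn).2.1, γ.source, rootAt, ptRatio, sub_zero, ← ofReal_mul_cpow hA (by
        exact div_ne_zero hz hA'), mul_div_cancel₀ _ hA', termG]
      congr 1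
      rw [Complex.cpow_neg]
      congr 1
      rw [← Complex.cpow_nat_mul]
      congr 1
      push_cast
      ring
    · simp [coeffG_eq_zero hn, termG_eq_zero hn]
  · intro t
    refine ⟨(branchSum_spec (hγ t) fun n hn => (hω n hn).2.2 t).2, ?_⟩
    obtain ⟨d, hd0, hd⟩ := exists_le_norm_pt_sub (hγ t)
    filter_upwards [eventually_eq_rootAt γ hω t hd0 hd] with s hs
    filter_upwards [Metric.isOpen_ball.mem_nhds (mem_ball_iff_norm.2 hs.1)] with p hp
    exact branchSum_rebase hd hs.1 hs.2 (mem_ball_iff_norm.1 hp)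

/-- Analytic continuation along a path is unique. -/
lemma IsContinuationAlong.eventuallyEq {g : ℂ → ℂ} {a b : ℂ} {γ : Path a b}
    {f f' : unitInterval → ℂ → ℂ} (hf : IsContinuationAlong g γ f)
    (hf' : IsContinuationAlong g γ f') (t : unitInterval) : f t =ᶠ[𝓝 (γ t)] f' t := by
  -- Equality of the germs is locally constant along the path: near t both families consist of germs
  -- of two fixed functions analytic on one ball, where the identity theorem applies. Connectedness
  -- of the interval then finishes.
  have key : ∀ t, ∀ᶠ s in 𝓝 t, (f s =ᶠ[𝓝 (γ s)] f' s ↔ f t =ᶠ[𝓝 (γ t)] f' t) := by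
    intro t
    obtain ⟨r, hr, hra⟩ := Metric.eventually_nhds_iff_ball.1
      ((hf.2 t).1.eventually_analyticAt.and (hf'.2 t).1.eventually_analyticAt)
    have hb : ∀ᶠ s in 𝓝 t, γ s ∈ Metric.ball (γ t) r :=
      γ.continuous.continuousAt (Metric.ball_mem_nhds _ hr)
    have hball : ∀ z ∈ Metric.ball (γ t) r, ∀ z' ∈ Metric.ball (γ t) r,
        f t =ᶠ[𝓝 z] f' t → f t =ᶠ[𝓝 z'] f' t := by
      intro z hz z' hz' h
      have := AnalyticOnNhd.eqOn_of_preconnected_of_eventuallyEq (fun w hw => (hra w hw).1)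
        (fun w hw => (hra w hw).2) (convex_ball (γ t) r).isPreconnected hz h
      exact this.eventuallyEq_of_mem (Metric.isOpen_ball.mem_nhds hz')
    filter_upwards [(hf.2 t).2, (hf'.2 t).2, hb] with s h1 h2 h3
    constructor
    · intro h
      exact hball _ h3 _ (Metric.mem_ball_self hr) ((h1.symm.trans h).trans h2)
    · intro h
      exact (h1.trans (hball _ (Metric.mem_ball_self hr) _ h3 h)).trans h2.symm
  have hclopen : IsClopen {t | f t =ᶠ[𝓝 (γ t)] f' t} := by
    constructor
    · rw [← isOpen_compl_iff, isOpen_iff_mem_nhds]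
      intro t ht
      filter_upwards [key t] with s hs
      exact fun h => ht (hs.1 h)
    · rw [isOpen_iff_mem_nhds]
      intro t ht
      filter_upwards [key t] with s hs
      exact hs.2 ht
  have h0 : (0 : unitInterval) ∈ {t | f t =ᶠ[𝓝 (γ t)] f' t} := by
    rw [mem_ofPred_eq, γ.source]
    exact hf.1.trans hf'.1.symm
  have ht : t ∈ {t | f t =ᶠ[𝓝 (γ t)] f' t} := by
    rw [hclopen.eq_univ ⟨0, h0⟩]
    exact mem_univ t
  exact ht

lemma IsContinuationAlong.exists_branchSum {q : ℂ} {γ : Path (0 : ℂ) q} (hγ : ∀ t, γ t ∉ singSet)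
    {f : unitInterval → ℂ → ℂ} (hf : IsContinuationAlong G γ f) :
    ∃ w : ℕ → ℂ, (∀ n ∈ chiSupport, w n ^ 2 = (pt n : ℂ) - q) ∧ f 1 =ᶠ[𝓝 q] branchSum q w := by
  obtain ⟨ω, hω⟩ := exists_continuous_roots γ hγ
  refine ⟨fun n => ω n 1, fun n hn => by rw [(hω n hn).2.2, γ.target], ?_⟩
  have := hf.eventuallyEq (isContinuationAlong_branchSum γ hγ hω) 1
  rwa [γ.target] at this

lemma exists_isContinuationAlong {q : ℂ} (γ : Path (0 : ℂ) q) (hγ : ∀ t, γ t ∉ singSet) :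
    ∃ f, IsContinuationAlong G γ f := by
  obtain ⟨ω, hω⟩ := exists_continuous_roots γ hγ
  exact ⟨_, isContinuationAlong_branchSum γ hγ hω⟩

lemma IsContinuationAlong.exists_roots {q : ℂ} {γ : Path (0 : ℂ) q} (hγ : ∀ t, γ t ∉ singSet)
    {f : unitInterval → ℂ → ℂ} (hf : IsContinuationAlong G γ f) :
    ∃ w : ℕ → ℂ → ℂ, (∀ n, chi n ≠ 0 → AnalyticAt ℂ (w n) q) ∧
      ∀ᶠ p in 𝓝 q, (∀ n, chi n ≠ 0 → w n p ^ 2 = (pt n : ℂ) - p) ∧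
        HasSum (fun n => coeffG n * (w n p ^ 5)⁻¹) (f 1 p) := by
  obtain ⟨w, hw, hfw⟩ := hf.exists_branchSum hγ
  have hq : q ∉ singSet := by simpa using hγ 1
  have hne : ∀ n ∈ chiSupport, (pt n : ℂ) ≠ q := fun n hn h => hq (h ▸ pt_mem_singSet hn)
  refine ⟨fun n => rootAt q (w n) n, fun n hn => analyticAt_rootAt_self (hne n hn), ?_⟩
  filter_upwards [hfw, (branchSum_spec hq hw).1] with p hp hs
  exact ⟨fun n hn => rootAt_sq (hne n hn) (hw n hn) p, hp ▸ hs.of_norm.hasSum⟩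

/-- Near `pt n`, every branch is the sum of an analytic function and a singular term. -/
lemma IsContinuationAlong.exists_singular_form {n : ℕ} (hn : n ∈ chiSupport) {ρ : ℝ}
    (hρ : ∀ p ∈ singSet, p ≠ (pt n : ℂ) → ρ ≤ ‖p - (pt n : ℂ)‖)
    {q : ℂ} (hqρ : q ∈ Metric.ball (pt n : ℂ) ρ) {γ : Path (0 : ℂ) q} (hγ : ∀ t, γ t ∉ singSet)
    {f : unitInterval → ℂ → ℂ} (hf : IsContinuationAlong G γ f) :
    ∃ A w : ℂ → ℂ, AnalyticOnNhd ℂ A (Metric.ball (pt n : ℂ) ρ) ∧ AnalyticAt ℂ w q ∧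
      ∀ᶠ p in 𝓝 q, w p ^ 2 = (pt n : ℂ) - p ∧ f 1 p = A p + coeffG n * (w p ^ 5)⁻¹ := by
  obtain ⟨w, hw, hfw⟩ := hf.exists_branchSum hγ
  have hq : q ∉ singSet := by simpa using hγ 1
  have hne : ∀ m ∈ chiSupport, (pt m : ℂ) ≠ q := fun m hm h => hq (h ▸ pt_mem_singSet hm)
  set S : Set ℕ := chiSupport \ {n} with hS
  have hSne : ∀ m ∈ S, (pt m : ℂ) ≠ (pt n : ℂ) := fun m hm h =>
    hm.2 (pt_strictMono.injective (by exact_mod_cast h))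
  have hball : ∀ m ∈ S, ∀ p ∈ Metric.ball (pt n : ℂ) ρ,
      ‖p - (pt n : ℂ)‖ < ‖(pt m : ℂ) - (pt n : ℂ)‖ := fun m hm p hp =>
    (mem_ball_iff_norm.1 hp).trans_le (hρ _ (pt_mem_singSet hm.1) (hSne m hm))
  -- the value at `pt n` of the root number `m`
  have hex : ∀ m, ∃ v : ℂ, m ∈ S → v ^ 2 = (pt m : ℂ) - (pt n : ℂ) ∧
      rootAt (pt n : ℂ) v m q = w m := by
    intro m
    by_cases hm : m ∈ S
    · have h1 : ptRatio (pt n : ℂ) q m ^ (1 / 2 : ℂ) ≠ 0 := by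
        intro h0
        have := sqrt_sq (ptRatio (pt n : ℂ) q m)
        rw [h0] at this
        have h2 := norm_ptRatio_sub_one_lt (hball m hm q hqρ)
        rw [← this] at h2
        norm_num at h2
      refine ⟨w m / ptRatio (pt n : ℂ) q m ^ (1 / 2 : ℂ), fun _ => ⟨?_, ?_⟩⟩
      · rw [div_pow, sqrt_sq, hw m hm.1, ptRatio]
        have := sub_ne_zero.2 (hne m hm.1)
        have := sub_ne_zero.2 (hSne m hm)
        field_simp
      · rw [rootAt, div_mul_cancel₀ _ h1]
    · exact ⟨0, fun h => absurd h hm⟩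
  choose v hv using hex
  -- A collects the terms with m ≠ n; their roots, recentred at pt n, are analytic on the whole ball
  -- because it contains no other singular point. The remaining root w carries the undetermined
  -- sign.
  refine ⟨fun p => ∑' m, S.indicator (fun m => coeffG m * (rootAt (pt n : ℂ) (v m) m p ^ 5)⁻¹) m,
    rootAt q (w n) n, ?_, analyticAt_rootAt_self (hne n hn), ?_⟩
  · intro p₀ hp₀
    refine (summable_and_analyticAt_tsum (S := S) (p₀ := p₀) (u := fun m p =>
      S.indicator (fun m => coeffG m * (rootAt (pt n : ℂ) (v m) m p ^ 5)⁻¹) m) ?_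
      (Metric.isOpen_ball.mem_nhds hp₀) ?_ ?_ ?_).2
    · intro m hm h
      exact (hball m hm p₀ hp₀).ne (by rw [h])
    · intro m hm p hp
      simp only [indicator_of_mem hm]
      have h1 := differentiableAt_rootAt (w := v m) (hball m hm p hp)
      have h2 : rootAt (pt n : ℂ) (v m) m p ≠ 0 := by
        intro h0
        have := rootAt_sq (hSne m hm) (hv m hm).1 p
        rw [h0] at this
        have h3 := hball m hm p hp
        rw [show (pt m : ℂ) = p by linear_combination -this] at h3
        exact lt_irrefl _ h3
      exact (((h1.pow 5).inv (pow_ne_zero 5 h2)).const_mul _).differentiableWithinAt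
    · intro m hm p _
      simp only [indicator_of_mem hm]
      rw [norm_mul, norm_inv_pow_five (rootAt_sq (hSne m hm) (hv m hm).1 p)]
    · intro m hm p
      simp only [indicator_of_notMem hm]
  · filter_upwards [hfw, (branchSum_spec hq hw).1, Metric.isOpen_ball.mem_nhds hqρ] with p hp hs hpρ
    refine ⟨rootAt_sq (hne n hn) (hw n hn) p, ?_⟩
    rw [hp, branchSum, hs.of_norm.tsum_eq_add_tsum_ite n, add_comm]
    congr 1
    refine tsum_congr fun m => ?_
    by_cases hm : m ∈ S
    · have hmn : m ≠ n := fun h => hm.2 h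
      rw [if_neg hmn, indicator_of_mem hm,
        ← rootAt_rootAt (hball m hm q hqρ) (hball m hm p hpρ), (hv m hm).2]
    · rw [indicator_of_notMem hm]
      by_cases hmn : m = n
      · rw [if_pos hmn]
      · rw [if_neg hmn, coeffG_eq_zero (fun h => hm ⟨h, hmn⟩), zero_mul]

/-! ### The branches of `G` over the positive real axis -/

/-- The part of the series `G` that is not ramified over `sing k` for `k < r`. -/
noncomputable def tailG (r : ℕ) (p : ℂ) : ℂ :=
  ∑' n, {n | n ∈ chiSupport ∧ r ≤ n / 3}.indicator (fun n => termG n p) n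

/-- The term of `G` that is ramified over `sing k`, continued to the right of `sing k` from the
upper half-plane. -/
noncomputable def rightTerm (k : ℕ) (p : ℂ) : ℂ :=
  -- Above the axis A - p = e^{-iπ}(p - A), and (e^{-iπ})^{-5/2} = i; below the axis the factor is
  -- -i, whence the sign attached to the address.
  Complex.I * coeffG (coprimeSix k) * (p - sing k) ^ (-(5 / 2) : ℂ)

/-- The number `±1` that belongs to a sign. -/
def signVal (b : Bool) : ℂ := if b then 1 else -1

/-- The branches of `G` over the intervals between the ramification points. -/
noncomputable def branchG : Branches := fun r ε p =>
  tailG r p + ∑ k : Fin r, signVal (ε k) * rightTerm k p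

lemma analyticAt_tailG {r : ℕ} {p : ℂ} (h : p.im ≠ 0 ∨ p.re < sing r) :
    AnalyticAt ℂ (tailG r) p := by
  refine (summable_and_analyticAt_tsum_termG (S := {n | n ∈ chiSupport ∧ r ≤ n / 3})
    (h.imp_right fun h => ⟨_, h, fun n hn => ?_⟩) fun n hn => hn.1).2
  rw [← sing_div_three hn.1]
  exact sing_strictMono.monotone hn.2

lemma tailG_zero (p : ℂ) : tailG 0 p = G p := by
  simp only [tailG, G, zero_le, and_true]
  rw [show {n | n ∈ chiSupport} = chiSupport from rfl, indicator_termG]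

lemma summable_norm_indicator_termG {r : ℕ} {p : ℂ} (h : p.im ≠ 0 ∨ p.re < sing r) :
    Summable fun n => ‖{n | n ∈ chiSupport ∧ r ≤ n / 3}.indicator (fun n => termG n p) n‖ := by
  refine (summable_and_analyticAt_tsum_termG (S := {n | n ∈ chiSupport ∧ r ≤ n / 3})
    (h.imp_right fun h => ⟨_, h, fun n hn => ?_⟩) fun n hn => hn.1).1
  rw [← sing_div_three hn.1]
  exact sing_strictMono.monotone hn.2

lemma tailG_eq_add {r : ℕ} {p : ℂ} (h : p.im ≠ 0 ∨ p.re < sing r) :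
    tailG r p = termG (coprimeSix r) p + tailG (r + 1) p := by
  unfold tailG
  rw [(summable_norm_indicator_termG h).of_norm.tsum_eq_add_tsum_ite (coprimeSix r)]
  congr 1
  · rw [indicator_of_mem]
    exact ⟨coprimeSix_mem r, (coprimeSix_div_three r).ge⟩
  · refine tsum_congr fun n => ?_
    split_ifs with hn
    · rw [indicator_of_notMem]
      rintro ⟨-, h2⟩
      rw [hn, coprimeSix_div_three] at h2
      omega
    · by_cases hm : n ∈ chiSupport
      · have : r = n / 3 → False := fun h => hn (by rw [h, coprimeSix_of_mem hm])
        simp only [indicator, mem_ofPred_eq, hm, true_and]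
        have h2 : r ≤ n / 3 ↔ r + 1 ≤ n / 3 := ⟨fun h => lt_of_le_of_ne h this, fun h => by omega⟩
        simp only [h2]
      · simp [hm]

lemma neg_cpow_of_im_neg {z : ℂ} (h : z.im < 0) (a : ℂ) :
    z ^ a = Complex.exp (-(π * Complex.I) * a) * (-z) ^ a := by
  have hz : z ≠ 0 := by rintro rfl; simp at h
  rw [Complex.cpow_def_of_ne_zero hz, Complex.cpow_def_of_ne_zero (neg_ne_zero.2 hz),
    ← Complex.exp_add]
  congr 1
  have : Complex.log (-z) = Complex.log z + π * Complex.I := by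
    rw [Complex.log, Complex.log, Complex.arg_neg_eq_arg_add_pi_of_im_neg h, norm_neg]
    push_cast; ring
  rw [this]; ring

lemma neg_cpow_of_im_pos {z : ℂ} (h : 0 < z.im) (a : ℂ) :
    z ^ a = Complex.exp (π * Complex.I * a) * (-z) ^ a := by
  have hz : z ≠ 0 := by rintro rfl; simp at h
  rw [Complex.cpow_def_of_ne_zero hz, Complex.cpow_def_of_ne_zero (neg_ne_zero.2 hz),
    ← Complex.exp_add]
  congr 1
  have : Complex.log (-z) = Complex.log z - π * Complex.I := by
    rw [Complex.log, Complex.log, Complex.arg_neg_eq_arg_sub_pi_of_im_pos h, norm_neg]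
    push_cast; ring
  rw [this]; ring

lemma exp_pi_mul_I_mul_half_five :
    Complex.exp (π * Complex.I * (-(5 / 2) : ℂ)) = -Complex.I := by
  rw [show (π * Complex.I * (-(5 / 2) : ℂ)) = -(π / 2 * Complex.I) - 2 * π * Complex.I by ring,
    Complex.exp_sub, Complex.exp_two_pi_mul_I, Complex.exp_neg, Complex.exp_pi_div_two_mul_I]
  simp

lemma rightTerm_of_im_pos {k : ℕ} {p : ℂ} (h : 0 < p.im) :
    rightTerm k p = termG (coprimeSix k) p := by
  rw [termG, neg_cpow_of_im_neg (by simpa using h), rightTerm, neg_sub, neg_mul, Complex.exp_neg,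
    exp_pi_mul_I_mul_half_five, sing]
  simp
  ring

lemma rightTerm_of_im_neg {k : ℕ} {p : ℂ} (h : p.im < 0) :
    rightTerm k p = -termG (coprimeSix k) p := by
  rw [termG, neg_cpow_of_im_pos (by simpa using h), rightTerm, neg_sub,
    exp_pi_mul_I_mul_half_five, sing]
  ring

lemma differentiableAt_rightTerm {k : ℕ} {p : ℂ} (h : p.im ≠ 0 ∨ sing k < p.re) :
    DifferentiableAt ℂ (rightTerm k) p := by
  unfold rightTerm
  refine (DifferentiableAt.cpow_const (by fun_prop) ?_).const_mul _
  rw [Complex.mem_slitPlane_iff]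
  rcases h with h | h
  · right; simpa using h
  · left; simpa using h

/-- Only the first term of `tailG r` is ramified over `sing r`. Passing that point above or below
turns it into plus or minus its right term, and the other terms are unaffected. -/
lemma isRamified_branchG : IsRamified sing branchG where
  analytic r ε p hp := by
    refine DifferentiableAt.differentiableWithinAt ?_
    unfold branchG
    refine DifferentiableAt.add
      (analyticAt_tailG (hp.imp_right fun h => h.2)).differentiableAt ?_
    refine DifferentiableAt.fun_sum fun k _ => (differentiableAt_rightTerm ?_).const_mul _
    exact hp.imp_right fun h => h.1 k k.isLt
  above r ε p hp := by
    simp only [branchG, Fin.sum_univ_castSucc, extend, Fin.snoc_castSucc, Fin.snoc_last,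
      Fin.val_castSucc, Fin.val_last]
    rw [tailG_eq_add (r := r) (Or.inl hp.ne'), rightTerm_of_im_pos hp]
    simp only [signVal, if_true]
    ring
  below r ε p hp := by
    simp only [branchG, Fin.sum_univ_castSucc, extend, Fin.snoc_castSucc, Fin.snoc_last,
      Fin.val_castSucc, Fin.val_last]
    rw [tailG_eq_add (r := r) (Or.inl hp.ne), rightTerm_of_im_neg hp]
    simp only [signVal, Bool.false_eq_true, if_false]
    ring

lemma branchG_zero (ε : Fin 0 → Bool) (p : ℂ) : branchG 0 ε p = G p := by
  simp [branchG, tailG_zero]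

lemma extend_const (r : ℕ) (b : Bool) :
    extend (fun _ : Fin r => b) b = fun _ => b := by
  funext i
  refine Fin.lastCases ?_ (fun i => ?_) i
  · simp [extend]
  · simp [extend]

lemma IsRamified.const_true {η : ℕ → ℝ} {g : Branches} (hg : IsRamified η g) (r : ℕ) {p : ℂ}
    (hp : 0 < p.im) : g r (fun _ => true) p = g 0 emptyAddr p := by
  induction r with
  | zero => exact congrArg (fun e => g 0 e p) (Subsingleton.elim _ _)
  | succ r ih => rw [← ih, ← extend_const, hg.above _ _ _ hp]

lemma IsRamified.const_false {η : ℕ → ℝ} {g : Branches} (hg : IsRamified η g) (r : ℕ) {p : ℂ}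
    (hp : p.im < 0) : g r (fun _ => false) p = g 0 emptyAddr p := by
  induction r with
  | zero => exact congrArg (fun e => g 0 e p) (Subsingleton.elim _ _)
  | succ r ih => rw [← ih, ← extend_const, hg.below _ _ _ hp]

/-! ### The median average -/

lemma mur_emptyAddr : mur 0 emptyAddr = 1 := by simp [mur]

lemma mul_emptyAddr : mul 0 emptyAddr = 1 := by simp [mul]

lemma mur_extend {r : ℕ} (ε : Fin r → Bool) (b : Bool) :
    mur (r + 1) (extend ε b) = if b then mur r ε else 0 := by
  cases b <;> simp [mur, extend, Fin.forall_fin_succ']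

lemma mul_extend {r : ℕ} (ε : Fin r → Bool) (b : Bool) :
    mul (r + 1) (extend ε b) = if b then 0 else mul r ε := by
  cases b <;> simp [mul, extend, Fin.forall_fin_succ']

lemma isAverage_med : IsAverage med where
  total := by simp [med, mur_emptyAddr, mul_emptyAddr]
  consistent r ε := by
    simp only [med, mur_extend, mul_extend]
    simp
    ring

lemma sum_mur {r : ℕ} (f : (Fin r → Bool) → ℂ) : ∑ ε, mur r ε * f ε = f fun _ => true := by
  rw [Finset.sum_eq_single fun _ => true]
  · simp [mur]
  · intro ε _ h
    simp only [mur]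
    rw [if_neg fun h' => h (funext h'), zero_mul]
  · simp

lemma sum_mul {r : ℕ} (f : (Fin r → Bool) → ℂ) : ∑ ε, mul r ε * f ε = f fun _ => false := by
  rw [Finset.sum_eq_single fun _ => false]
  · simp [mul]
  · intro ε _ h
    simp only [mul]
    rw [if_neg fun h' => h (funext h'), zero_mul]
  · simp

lemma sum_med {r : ℕ} (f : (Fin r → Bool) → ℂ) :
    ∑ ε, med r ε * f ε = ((f fun _ => true) + f fun _ => false) / 2 := by
  rw [← sum_mur f, ← sum_mul f, ← Finset.sum_add_distrib, Finset.sum_div]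
  exact Finset.sum_congr rfl fun ε _ => by simp only [med]; ring

lemma conj_mem_sheet {η : ℕ → ℝ} {r : ℕ} {p : ℂ} (hp : p ∈ sheet η r) :
    starRingEnd ℂ p ∈ sheet η r := by
  simpa [sheet] using hp

lemma isPreconnected_sheet_zero (η : ℕ → ℝ) : IsPreconnected (sheet η 0) := by
  have : StarConvex ℝ ((η 0 - 1 : ℝ) : ℂ) (sheet η 0) := by
    intro y hy a b ha hb hab
    simp only [sheet, not_lt_zero, false_implies, implies_true, true_and, mem_ofPred_eq,
      Complex.add_im, Complex.add_re, Complex.real_smul, Complex.mul_im, Complex.mul_re,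
      Complex.ofReal_re, Complex.ofReal_im, mul_zero, zero_mul, add_zero, zero_add, sub_zero]
      at hy ⊢
    rcases hb.eq_or_lt with rfl | hb
    · right; have : a = 1 := by linarith
      rw [this]; linarith
    · rcases hy with hy | hy
      · left; exact mul_ne_zero hb.ne' hy
      · right
        have h1 : b * y.re < b * η 0 := mul_lt_mul_of_pos_left hy hb
        have h2 : a * (η 0 - 1) ≤ a * η 0 := mul_le_mul_of_nonneg_left (by linarith) ha
        have h3 : a * η 0 + b * η 0 = η 0 := by rw [← add_mul, hab, one_mul]
        linarith
  exact (this.isPathConnected (Or.inr ⟨by simp, by simp⟩)).isConnected.isPreconnected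

/-- Schwarz reflection for the branch on the first sheet. -/
lemma IsRamified.conj_zero {η : ℕ → ℝ} {g : Branches} (hg : IsRamified η g)
    (hreal : ∀ t : ℝ, t < η 0 → (g 0 emptyAddr (t : ℂ)).im = 0) {p : ℂ} (hp : p ∈ sheet η 0) :
    starRingEnd ℂ (g 0 emptyAddr (starRingEnd ℂ p)) = g 0 emptyAddr p := by
  have h1 : AnalyticOnNhd ℂ (g 0 emptyAddr) (sheet η 0) :=
    (hg.analytic 0 _).analyticOnNhd (isOpen_sheet η 0)
  have h2 : AnalyticOnNhd ℂ (fun p => starRingEnd ℂ (g 0 emptyAddr (starRingEnd ℂ p)))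
      (sheet η 0) := by
    refine DifferentiableOn.analyticOnNhd (fun q hq => ?_) (isOpen_sheet η 0)
    refine DifferentiableAt.differentiableWithinAt ?_
    have := (h1 _ (conj_mem_sheet hq)).differentiableAt.conj_conj
    simpa [Function.comp_def] using this
  have hz : ((η 0 - 1 : ℝ) : ℂ) ∈ sheet η 0 := Or.inr ⟨by simp, by simp⟩
  refine h2.eqOn_of_preconnected_of_frequently_eq h1 (isPreconnected_sheet_zero η) hz ?_ hp
  have ht : Tendsto (fun n : ℕ => ((η 0 - 1 - 1 / ((n : ℝ) + 1) : ℝ) : ℂ)) atTop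
      (𝓝[≠] ((η 0 - 1 : ℝ) : ℂ)) := by
    refine tendsto_nhdsWithin_iff.2 ⟨?_, Eventually.of_forall fun n => ?_⟩
    · refine (Complex.continuous_ofReal.tendsto _).comp ?_
      simpa using (tendsto_const_nhds (x := η 0 - 1)).sub
        (tendsto_one_div_add_atTop_nhds_zero_nat (𝕜 := ℝ))
    · have : (0 : ℝ) < 1 / ((n : ℝ) + 1) := by positivity
      simp only [mem_compl_iff, mem_singleton_iff, Complex.ofReal_inj]
      linarith
  refine ht.frequently (Eventually.frequently (Eventually.of_forall fun n => ?_))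
  have hlt : η 0 - 1 - 1 / ((n : ℝ) + 1) < η 0 := by
    have : (0 : ℝ) < 1 / ((n : ℝ) + 1) := by positivity
    linarith
  have := hreal _ hlt
  rw [Complex.conj_ofReal]
  exact Complex.conj_eq_iff_im.2 this

/-- By Schwarz reflection on the first sheet the branches with all signs + and all signs - are
conjugate to each other. These branches agree with the first sheet only off the axis, so the
relation at a real point is obtained as a limit from the lower half-plane. -/
lemma isRealityPreserving_med {η : ℕ → ℝ} : IsRealityPreserving η med := by
  refine ⟨fun r ε => ?_, fun g hg hreal r t ht1 ht2 => ?_⟩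
  · unfold med mur mul
    split_ifs <;> norm_num
  rw [average, sum_med]
  suffices h : g r (fun _ => false) t = starRingEnd ℂ (g r (fun _ => true) t) by
    rw [h, Complex.add_conj]
    simp
  have hmem : (t : ℂ) ∈ sheet η r := Or.inr ⟨by simpa using ht1, by simpa using ht2⟩
  have hc : ∀ ε, ContinuousAt (g r ε) t := fun ε =>
    ((hg.analytic r ε).differentiableAt ((isOpen_sheet η r).mem_nhds hmem)).continuousAt
  have hlim : Tendsto (fun n : ℕ => (t : ℂ) - (1 / ((n : ℝ) + 1) : ℝ) * Complex.I) atTop (𝓝 t) := by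
    have := (Complex.continuous_ofReal.tendsto _).comp
      (tendsto_one_div_add_atTop_nhds_zero_nat (𝕜 := ℝ))
    simpa using (tendsto_const_nhds (x := (t : ℂ))).sub (this.mul_const Complex.I)
  have hlim' := (Complex.continuous_conj.tendsto _).comp hlim
  rw [Complex.conj_ofReal] at hlim'
  refine tendsto_nhds_unique ((hc _).tendsto.comp hlim)
    (((Complex.continuous_conj.tendsto _).comp ((hc _).tendsto.comp hlim')).congr fun n => ?_)
  have hn : (0 : ℝ) < 1 / ((n : ℝ) + 1) := by positivity
  set q : ℂ := (t : ℂ) - (1 / ((n : ℝ) + 1) : ℝ) * Complex.I with hq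
  have him : q.im < 0 := by
    simp only [hq, Complex.sub_im, Complex.ofReal_im, Complex.mul_im, Complex.ofReal_re,
      Complex.I_im, Complex.I_re, mul_one, mul_zero, add_zero, zero_sub]
    linarith
  show starRingEnd ℂ (g r (fun _ => true) (starRingEnd ℂ q)) = g r (fun _ => false) q
  rw [hg.const_true r (by simpa using him), hg.const_false r him]
  exact hg.conj_zero hreal (Or.inl him.ne)

/-! ### Integrals along rays -/

lemma exp_add_mul_I (u θ : ℝ) :
    Complex.exp (u + θ * Complex.I) = (Real.exp u : ℂ) * Complex.exp (Complex.I * θ) := by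
  rw [Complex.exp_add, Complex.ofReal_exp, mul_comm Complex.I]

lemma norm_exp_I_mul (θ : ℝ) : ‖Complex.exp (Complex.I * θ)‖ = 1 := by
  rw [mul_comm, Complex.norm_exp_ofReal_mul_I]

lemma image_exp_univ : Real.exp '' univ = Ioi 0 := by rw [image_univ, Real.range_exp]

/-- In the coordinate p = e^{u + iθ} rays become horizontal lines, and rotating a ray becomes moving
the side of a rectangle. -/
lemma rayInt_eq_integral (f : ℂ → ℂ) (θ : ℝ) :
    rayInt f θ = ∫ u : ℝ, f (Complex.exp (u + θ * Complex.I)) * Complex.exp (u + θ * Complex.I) := by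
  have := integral_image_eq_integral_abs_deriv_smul (s := univ) (f := Real.exp) (f' := Real.exp)
    MeasurableSet.univ (fun x _ => (Real.hasDerivAt_exp x).hasDerivWithinAt)
    Real.exp_injective.injOn
    (fun r : ℝ => f ((r : ℂ) * Complex.exp (Complex.I * θ)) * Complex.exp (Complex.I * θ))
  rw [image_exp_univ, setIntegral_univ] at this
  rw [rayInt, this]
  refine integral_congr_ae (Eventually.of_forall fun u => ?_)
  simp only [exp_add_mul_I, abs_of_pos (Real.exp_pos u), Complex.real_smul]
  ring

lemma RayIntegrable.integrable {f : ℂ → ℂ} {θ : ℝ} (h : RayIntegrable f θ) :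
    Integrable fun u : ℝ =>
      f (Complex.exp (u + θ * Complex.I)) * Complex.exp (u + θ * Complex.I) := by
  have h' : IntegrableOn (fun r : ℝ => f ((r : ℂ) * Complex.exp (Complex.I * θ)) *
    Complex.exp (Complex.I * θ)) (Ioi 0) := h.mul_const _
  rw [← image_exp_univ, integrableOn_image_iff_integrableOn_abs_deriv_smul (f' := Real.exp)
    MeasurableSet.univ (fun x _ => (Real.hasDerivAt_exp x).hasDerivWithinAt)
    Real.exp_injective.injOn, integrableOn_univ] at h'
  refine h'.congr (Eventually.of_forall fun u => ?_)
  simp only [exp_add_mul_I, abs_of_pos (Real.exp_pos u), Complex.real_smul]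
  ring

lemma integrableOn_exp_neg_mul {c : ℝ} (hc : 0 < c) (M : ℝ) :
    IntegrableOn (fun r : ℝ => M * Real.exp (-c * r)) (Ioi 0) :=
  (integrableOn_exp_mul_Ioi (neg_lt_zero.2 hc) 0).const_mul M

lemma continuous_ray (θ : ℝ) : Continuous fun r : ℝ => (r : ℂ) * Complex.exp (Complex.I * θ) := by
  fun_prop

lemma aestronglyMeasurable_ray {f : ℂ → ℂ} {θ : ℝ}
    (hf : ∀ r : ℝ, 0 < r → ContinuousAt f ((r : ℂ) * Complex.exp (Complex.I * θ))) :
    AEStronglyMeasurable (fun r : ℝ => f ((r : ℂ) * Complex.exp (Complex.I * θ)))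
      (volume.restrict (Ioi 0)) := by
  refine ContinuousOn.aestronglyMeasurable (fun r hr => ?_) measurableSet_Ioi
  exact (ContinuousAt.comp (f := fun r : ℝ => (r : ℂ) * Complex.exp (Complex.I * θ)) (hf r hr)
    (continuous_ray θ).continuousAt).continuousWithinAt

lemma rayIntegrable_of_le {f : ℂ → ℂ} {θ M c : ℝ} (hc : 0 < c)
    (hf : ∀ r : ℝ, 0 < r → ContinuousAt f ((r : ℂ) * Complex.exp (Complex.I * θ)))
    (hb : ∀ r : ℝ, 0 < r → ‖f ((r : ℂ) * Complex.exp (Complex.I * θ))‖ ≤ M * Real.exp (-c * r)) :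
    RayIntegrable f θ := by
  refine (integrableOn_exp_neg_mul hc M).mono' (aestronglyMeasurable_ray hf) ?_
  exact (ae_restrict_iff' measurableSet_Ioi).2 (Eventually.of_forall fun r hr => hb r hr)

/-- Rotation of the path of integration. -/
theorem rayInt_eq_rayInt {f : ℂ → ℂ} {a b M c : ℝ} (hab : a ≤ b) (hc : 0 < c)
    (hf : ∀ r : ℝ, 0 < r → ∀ θ ∈ Icc a b,
      DifferentiableAt ℂ f ((r : ℂ) * Complex.exp (Complex.I * θ)))
    (hb : ∀ r : ℝ, 0 < r → ∀ θ ∈ Icc a b,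
      ‖f ((r : ℂ) * Complex.exp (Complex.I * θ))‖ ≤ M * Real.exp (-c * r)) :
    rayInt f a = rayInt f b := by
  have hM : 0 ≤ M := by
    have := (norm_nonneg _).trans (hb 1 one_pos a (left_mem_Icc.2 hab))
    exact nonneg_of_mul_nonneg_left this (Real.exp_pos _)
  set F : ℂ → ℂ := fun w => f (Complex.exp w) * Complex.exp w with hF
  have hFb : ∀ u : ℝ, ∀ θ ∈ Icc a b,
      ‖F (u + θ * Complex.I)‖ ≤ M * (Real.exp u * Real.exp (-c * Real.exp u)) := by
    intro u θ hθ
    simp only [hF, exp_add_mul_I, norm_mul, norm_exp_I_mul, Complex.norm_real, Real.norm_eq_abs,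
      abs_of_pos (Real.exp_pos u), mul_one]
    calc _ ≤ M * Real.exp (-c * Real.exp u) * Real.exp u := by
          gcongr; exact hb _ (Real.exp_pos u) θ hθ
      _ = _ := by ring
  have hFd : ∀ u : ℝ, ∀ θ ∈ Icc a b, DifferentiableAt ℂ F (u + θ * Complex.I) := by
    intro u θ hθ
    have := hf _ (Real.exp_pos u) θ hθ
    rw [← exp_add_mul_I] at this
    exact (this.comp _ Complex.differentiableAt_exp).mul Complex.differentiableAt_exp
  have hint : ∀ θ ∈ Icc a b, Integrable fun u : ℝ => F (u + θ * Complex.I) := fun θ hθ =>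
    (rayIntegrable_of_le hc (fun r hr => (hf r hr θ hθ).continuousAt)
      fun r hr => hb r hr θ hθ).integrable
  rw [rayInt_eq_integral, rayInt_eq_integral]
  -- Bounds for the two vertical sides of the rectangle: at u = R the exponential decay of f wins
  -- over dp = p du, and at u = -R the factor |p| = e^{-R} alone suffices.
  have hbound : Tendsto (fun R : ℝ => M * (Real.exp R * Real.exp (-c * Real.exp R)) * |b - a| +
      M * Real.exp (-R) * |b - a|) atTop (𝓝 0) := by
    have h1 : Tendsto (fun y : ℝ => y * Real.exp (-c * y)) atTop (𝓝 0) := by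
      simpa using Real.tendsto_pow_mul_exp_neg_atTop_nhds_zero 1 |>.comp
        (tendsto_id.const_mul_atTop hc) |>.const_mul c⁻¹ |>.congr fun y => by
          simp only [Function.comp, id, pow_one]; field_simp
    have h2 := ((h1.comp Real.tendsto_exp_atTop).const_mul M).mul_const |b - a|
    have h3 := ((Real.tendsto_exp_atBot.comp tendsto_neg_atTop_atBot).const_mul M).mul_const |b - a|
    simpa using h2.add h3
  have hrect : ∀ R : ℝ, 0 < R →
      ‖(∫ u in (-R)..R, F (u + a * Complex.I)) - ∫ u in (-R)..R, F (u + b * Complex.I)‖ ≤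
        M * (Real.exp R * Real.exp (-c * Real.exp R)) * |b - a| +
          M * Real.exp (-R) * |b - a| := by
    intro R hR
    have h := Complex.integral_boundary_rect_eq_zero_of_differentiableOn F
      (((-R : ℝ) : ℂ) + a * Complex.I) ((R : ℂ) + b * Complex.I) ?_
    · simp only [Complex.add_re, Complex.ofReal_re, Complex.mul_re, Complex.ofReal_im,
        Complex.I_re, Complex.I_im, mul_zero, mul_one, sub_self, add_zero, Complex.add_im,
        Complex.mul_im, zero_add] at h
      have h1 : ‖∫ y in a..b, F ((R : ℂ) + y * Complex.I)‖ ≤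
          M * (Real.exp R * Real.exp (-c * Real.exp R)) * |b - a| :=
        intervalIntegral.norm_integral_le_of_norm_le_const fun y hy => by
          rw [uIoc_of_le hab] at hy
          exact hFb R y ⟨hy.1.le, hy.2⟩
      have h2 : ‖∫ y in a..b, F (((-R : ℝ) : ℂ) + y * Complex.I)‖ ≤
          M * Real.exp (-R) * |b - a| :=
        intervalIntegral.norm_integral_le_of_norm_le_const fun y hy => by
          rw [uIoc_of_le hab] at hy
          refine (hFb (-R) y ⟨hy.1.le, hy.2⟩).trans ?_
          gcongr
          refine mul_le_of_le_one_right (Real.exp_pos _).le (Real.exp_le_one_iff.2 ?_)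
          have := Real.exp_pos (-R)
          nlinarith
      have h3 : (∫ u in (-R)..R, F (u + a * Complex.I)) - ∫ u in (-R)..R, F (u + b * Complex.I) =
          Complex.I • (∫ y in a..b, F (((-R : ℝ) : ℂ) + y * Complex.I)) -
          Complex.I • ∫ y in a..b, F ((R : ℂ) + y * Complex.I) := by
        linear_combination h
      rw [h3]
      refine (norm_sub_le _ _).trans ?_
      rw [norm_smul, norm_smul, Complex.norm_I, one_mul, one_mul, add_comm]
      exact add_le_add h1 h2
    · intro w hw
      rw [Complex.mem_reProdIm] at hw
      have h2 := hw.2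
      simp only [Complex.add_im, Complex.mul_im, Complex.ofReal_im, Complex.ofReal_re,
        Complex.I_im, Complex.I_re, mul_one, mul_zero, add_zero, zero_add, uIcc_of_le hab] at h2
      have := hFd w.re w.im h2
      rw [Complex.re_add_im] at this
      exact this.differentiableWithinAt
  have hlim : ∀ θ ∈ Icc a b, Tendsto (fun R : ℝ => ∫ u in (-R)..R, F (u + θ * Complex.I)) atTop
      (𝓝 (∫ u : ℝ, F (u + θ * Complex.I))) := fun θ hθ =>
    intervalIntegral_tendsto_integral (hint θ hθ) tendsto_neg_atTop_atBot tendsto_id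
  have h0 : Tendsto (fun R : ℝ => (∫ u in (-R)..R, F (u + a * Complex.I)) -
      ∫ u in (-R)..R, F (u + b * Complex.I)) atTop (𝓝 0) :=
    squeeze_zero_norm' ((eventually_gt_atTop 0).mono hrect) hbound
  exact sub_eq_zero.1 (tendsto_nhds_unique
    ((hlim a (left_mem_Icc.2 hab)).sub (hlim b (right_mem_Icc.2 hab))) h0)

/-! ### Distances from a ray -/

/-- The half angle makes the bound positive for every θ in (0, 2π), degenerating only at the cut. It
follows from |A - re^{iθ}|² = A² - 2Ar cos θ + r² and sin²(θ/2) = (1 - cos θ)/2, according to the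
sign of cos θ. -/
lemma mul_sin_half_le_norm_sub {A r θ : ℝ} (hA : 0 ≤ A) (hr : 0 ≤ r) :
    A * |Real.sin (θ / 2)| ≤ ‖(A : ℂ) - r * Complex.exp (Complex.I * θ)‖ := by
  have h1 : ‖(A : ℂ) - r * Complex.exp (Complex.I * θ)‖ ^ 2 =
      A ^ 2 - 2 * A * r * Real.cos θ + r ^ 2 := by
    rw [mul_comm Complex.I, Complex.exp_mul_I, ← Complex.ofReal_cos, ← Complex.ofReal_sin,
      ← Complex.normSq_eq_norm_sq, Complex.normSq_apply]
    simp only [Complex.sub_re, Complex.ofReal_re, Complex.mul_re, Complex.add_re, Complex.add_im,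
      Complex.ofReal_im, Complex.I_re, Complex.I_im, Complex.mul_im, Complex.sub_im]
    nlinarith [Real.sin_sq_add_cos_sq θ]
  have h2 : Real.sin (θ / 2) ^ 2 = (1 - Real.cos θ) / 2 := by
    have := Real.cos_sq (θ / 2)
    rw [mul_div_cancel₀ _ (two_ne_zero)] at this
    linarith [Real.sin_sq_add_cos_sq (θ / 2)]
  refine abs_le_of_sq_le_sq' ?_ (norm_nonneg _) |>.2
  rw [h1, mul_pow, sq_abs, h2]
  have h3 := Real.cos_le_one θ
  have h4 := Real.neg_one_le_cos θ
  rcases le_total 0 (Real.cos θ) with h | h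
  · nlinarith [mul_nonneg h (sq_nonneg (A - r)), mul_nonneg (sub_nonneg.2 h3) (sq_nonneg A),
      mul_nonneg (sub_nonneg.2 h3) (sq_nonneg r)]
  · nlinarith [mul_nonneg (mul_nonneg hA hr) (neg_nonneg.2 h), sq_nonneg r,
      mul_nonneg (sq_nonneg A) (by linarith : (0 : ℝ) ≤ 1 + Real.cos θ)]

lemma summable_rpow_three_half : Summable fun n : ℕ => 4 * (n : ℝ) ^ (-(3 / 2) : ℝ) :=
  (Real.summable_nat_rpow.2 (by norm_num)).mul_left _

/-- The constant of the bound `norm_G_le`. -/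
noncomputable def boundG : ℝ := ∑' n : ℕ, 4 * (n : ℝ) ^ (-(3 / 2) : ℝ)

lemma boundG_nonneg : 0 ≤ boundG := tsum_nonneg fun n => by positivity

/-- A lower bound linear in n suffices, because n · n^{-5/2} = n^{-3/2} is summable. The linear form
applies both to rays and to the vertical lines through the break points. -/
lemma norm_termG_le {c : ℝ} (hc : 0 < c) {p : ℂ}
    (h : ∀ n ∈ chiSupport, c * n ≤ ‖(pt n : ℂ) - p‖) (n : ℕ) :
    ‖termG n p‖ ≤ c ^ (-(5 / 2) : ℝ) * (4 * (n : ℝ) ^ (-(3 / 2) : ℝ)) := by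
  by_cases hn : n ∈ chiSupport
  · have hn0 : (0 : ℝ) < n := by exact_mod_cast pos_of_mem_chiSupport hn
    rw [norm_termG]
    have h1 : ‖(pt n : ℂ) - p‖ ^ (-(5 / 2) : ℝ) ≤ c ^ (-(5 / 2) : ℝ) * (n : ℝ) ^ (-(5 / 2) : ℝ) := by
      rw [← Real.mul_rpow hc.le hn0.le]
      exact Real.rpow_le_rpow_of_nonpos (by positivity) (h n hn) (by norm_num)
    have h2 : (n : ℝ) ^ (-(3 / 2) : ℝ) = n * (n : ℝ) ^ (-(5 / 2) : ℝ) := by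
      rw [← Real.rpow_one_add' hn0.le (by norm_num)]; norm_num
    calc _ ≤ (4 * n) * (c ^ (-(5 / 2) : ℝ) * (n : ℝ) ^ (-(5 / 2) : ℝ)) := by
          gcongr; exact norm_coeffG_le n
      _ = _ := by rw [h2]; ring
  · rw [termG_eq_zero hn, norm_zero]; positivity

lemma norm_G_le {c : ℝ} (hc : 0 < c) {p : ℂ} (h : ∀ n ∈ chiSupport, c * n ≤ ‖(pt n : ℂ) - p‖) :
    ‖G p‖ ≤ c ^ (-(5 / 2) : ℝ) * boundG := by
  rw [boundG, ← tsum_mul_left]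
  exact tsum_of_norm_bounded ((summable_rpow_three_half.mul_left _).hasSum) (norm_termG_le hc h)

lemma mul_le_norm_pt_sub_ray {c r θ : ℝ} (hc : c ≤ |Real.sin (θ / 2)|) (hr : 0 ≤ r) {n : ℕ}
    (hn : n ∈ chiSupport) :
    c * n ≤ ‖(pt n : ℂ) - r * Complex.exp (Complex.I * θ)‖ := by
  have h1 := mul_sin_half_le_norm_sub (pt_pos_of_mem hn).le hr (θ := θ)
  have h2 : (1 : ℝ) ≤ n := by exact_mod_cast pos_of_mem_chiSupport hn
  have h3 := sq_le_pt n
  have h4 : (n : ℝ) ≤ pt n := by nlinarith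
  calc c * n ≤ |Real.sin (θ / 2)| * pt n := by gcongr
    _ = pt n * |Real.sin (θ / 2)| := mul_comm _ _
    _ ≤ _ := h1

lemma norm_exp_neg_mul_ray (X : ℂ) (r θ : ℝ) :
    ‖Complex.exp (-X * (r * Complex.exp (Complex.I * θ)))‖ =
      Real.exp (-(X * Complex.exp (Complex.I * θ)).re * r) := by
  rw [Complex.norm_exp, show -X * (r * Complex.exp (Complex.I * θ)) =
    (r : ℂ) * -(X * Complex.exp (Complex.I * θ)) by ring, Complex.re_ofReal_mul, Complex.neg_re]
  congr 1; ring

lemma norm_laplace_integrand_le {X : ℂ} {c κ r θ : ℝ} (hc : 0 < c) (hs : c ≤ |Real.sin (θ / 2)|)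
    (hκ : κ ≤ (X * Complex.exp (Complex.I * θ)).re) (hr : 0 < r) :
    ‖Complex.exp (-X * (r * Complex.exp (Complex.I * θ))) *
      G (r * Complex.exp (Complex.I * θ))‖ ≤
        c ^ (-(5 / 2) : ℝ) * boundG * Real.exp (-κ * r) := by
  rw [norm_mul, norm_exp_neg_mul_ray, mul_comm]
  have := norm_G_le hc fun n hn => mul_le_norm_pt_sub_ray hs hr.le hn
  have := boundG_nonneg
  gcongr

lemma ray_mem_sheet {r θ : ℝ} (hr : 0 < r) (hθ : θ ∈ Ioo 0 (2 * π)) :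
    (r : ℂ) * Complex.exp (Complex.I * θ) ∈ sheet sing 0 := by
  rw [mem_sheet_zero_iff, mul_comm Complex.I, Complex.exp_mul_I, ← Complex.ofReal_cos,
    ← Complex.ofReal_sin]
  by_cases h : Real.sin θ = 0
  · right
    obtain ⟨n, hn⟩ := Real.sin_eq_zero_iff.1 h
    have h1 : 0 < n := by
      by_contra! hneg
      have : (n : ℝ) ≤ 0 := by exact_mod_cast hneg
      nlinarith [hθ.1, Real.pi_pos]
    have h2 : n < 2 := by
      by_contra! hneg
      have : (2 : ℝ) ≤ n := by exact_mod_cast hneg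
      nlinarith [hθ.2, Real.pi_pos]
    have h3 : n = 1 := by omega
    rw [← hn, h3]
    have : 0 < π ^ 2 / 6 := by positivity
    simp
    linarith
  · left
    simpa [hr.ne', -Complex.ofReal_sin, -Complex.ofReal_cos] using h

lemma sin_half_pos {θ : ℝ} (hθ : θ ∈ Ioo 0 (2 * π)) : 0 < |Real.sin (θ / 2)| :=
  abs_pos.2 (Real.sin_pos_of_pos_of_lt_pi (by linarith [hθ.1]) (by linarith [hθ.2])).ne'

lemma differentiableAt_laplace_integrand (X : ℂ) {p : ℂ} (hp : p ∈ sheet sing 0) :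
    DifferentiableAt ℂ (fun p => Complex.exp (-X * p) * G p) p :=
  DifferentiableAt.mul (by fun_prop) (analyticAt_G hp).differentiableAt

lemma rayIntegrable_laplace {X : ℂ} {θ : ℝ} (hθ : θ ∈ Ioo 0 (2 * π))
    (hX : 0 < (X * Complex.exp (Complex.I * θ)).re) :
    RayIntegrable (fun p => Complex.exp (-X * p) * G p) θ :=
  rayIntegrable_of_le hX (fun _ hr =>
    (differentiableAt_laplace_integrand X (ray_mem_sheet hr hθ)).continuousAt)
    fun _ hr => norm_laplace_integrand_le (sin_half_pos hθ) le_rfl le_rfl hr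

lemma exp_mul_exp_I_re (s : ℂ) (θ : ℝ) :
    (Complex.exp s * Complex.exp (Complex.I * θ)).re = Real.exp s.re * Real.cos (s.im + θ) := by
  rw [← Complex.exp_add, Complex.exp_re]
  simp

lemma cos_pos_of_abs_lt {y : ℝ} (h : |y| < π / 2) : 0 < Real.cos y :=
  Real.cos_pos_of_mem_Ioo (abs_lt.1 h)

lemma rayInt_laplace_eq_of_le {s : ℂ} {a b : ℝ} (hab : a ≤ b) (ha : a ∈ Ioo 0 (2 * π))
    (hb : b ∈ Ioo 0 (2 * π)) (ha' : |s.im + a| < π / 2) (hb' : |s.im + b| < π / 2) :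
    rayInt (fun p => Complex.exp (-Complex.exp s * p) * G p) a =
      rayInt (fun p => Complex.exp (-Complex.exp s * p) * G p) b := by
  have hmem : ∀ θ ∈ Icc a b, θ ∈ Ioo 0 (2 * π) := fun θ hθ =>
    ⟨ha.1.trans_le hθ.1, hθ.2.trans_lt hb.2⟩
  obtain ⟨θ₁, hθ₁, h1⟩ := isCompact_Icc.exists_isMinOn (nonempty_Icc.2 hab)
    (f := fun θ : ℝ => |Real.sin (θ / 2)|) (by fun_prop)
  obtain ⟨θ₂, hθ₂, h2⟩ := isCompact_Icc.exists_isMinOn (nonempty_Icc.2 hab)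
    (f := fun θ : ℝ => Real.exp s.re * Real.cos (s.im + θ)) (by fun_prop)
  have hpos : 0 < Real.exp s.re * Real.cos (s.im + θ₂) := by
    refine mul_pos (Real.exp_pos _) (cos_pos_of_abs_lt ?_)
    rw [abs_lt] at *
    constructor <;> linarith [hθ₂.1, hθ₂.2]
  refine rayInt_eq_rayInt hab hpos (fun r hr θ hθ =>
    differentiableAt_laplace_integrand _ (ray_mem_sheet hr (hmem θ hθ))) fun r hr θ hθ =>
    norm_laplace_integrand_le (sin_half_pos (hmem θ₁ hθ₁)) (h1 hθ) ?_ hr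
  rw [exp_mul_exp_I_re]
  exact h2 hθ

lemma rayInt_laplace_eq {s : ℂ} {a b : ℝ} (ha : a ∈ Ioo 0 (2 * π))
    (hb : b ∈ Ioo 0 (2 * π)) (ha' : |s.im + a| < π / 2) (hb' : |s.im + b| < π / 2) :
    rayInt (fun p => Complex.exp (-Complex.exp s * p) * G p) a =
      rayInt (fun p => Complex.exp (-Complex.exp s * p) * G p) b := by
  rcases le_total a b with h | h
  · exact rayInt_laplace_eq_of_le h ha hb ha' hb'
  · exact (rayInt_laplace_eq_of_le h hb ha hb' ha').symm

/-! ### The right and left lateral sums -/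

/-- The value at `x = e^s` of the right lateral sum. -/
noncomputable def sumRight (s : ℂ) : ℂ :=
  -- For Im s in (-5π/2, π/2) this angle lies in (0, 2π), and its sum with Im s is (π + Im s)/3,
  -- which lies in (-π/2, π/2); so one formula covers the whole sector.
  1 + rayInt (fun p => Complex.exp (-Complex.exp s * p) * G p) ((π / 2 - s.im) * 2 / 3)

/-- The value at `x = e^s` of the left lateral sum. -/
noncomputable def sumLeft (s : ℂ) : ℂ := starRingEnd ℂ (sumRight (starRingEnd ℂ s))

lemma sumRight_eq {s : ℂ} {ε : ℝ} (hε : ε ∈ Ioo 0 (2 * π)) (h : |s.im + ε| < π / 2) :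
    sumRight s = 1 + rayInt (fun p => Complex.exp (-Complex.exp s * p) * G p) ε := by
  rw [sumRight, rayInt_laplace_eq _ hε _ h]
  · rw [abs_lt] at h
    constructor <;> linarith [hε.1, hε.2]
  · rw [abs_lt] at *
    constructor <;> linarith [hε.1, hε.2]

lemma rayInt_conj {f g : ℂ → ℂ} (θ : ℝ) (h : ∀ r : ℝ, 0 < r →
    g ((r : ℂ) * Complex.exp (Complex.I * (-θ : ℝ))) =
      starRingEnd ℂ (f (r * Complex.exp (Complex.I * θ)))) :
    rayInt g (-θ) = starRingEnd ℂ (rayInt f θ) := by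
  rw [rayInt, rayInt, ← integral_conj]
  refine setIntegral_congr_fun measurableSet_Ioi fun r hr => ?_
  simp only [map_mul]
  rw [h r hr, ← Complex.exp_conj]
  simp

lemma RayIntegrable.conj {f g : ℂ → ℂ} {θ : ℝ} (hf : RayIntegrable f θ) (h : ∀ r : ℝ, 0 < r →
    g ((r : ℂ) * Complex.exp (Complex.I * (-θ : ℝ))) =
      starRingEnd ℂ (f (r * Complex.exp (Complex.I * θ)))) :
    RayIntegrable g (-θ) := by
  have : IntegrableOn (fun r : ℝ => starRingEnd ℂ (f (r * Complex.exp (Complex.I * θ)))) (Ioi 0) :=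
    (Complex.conjCLE : ℂ →L[ℝ] ℂ).integrable_comp hf
  exact this.congr_fun (fun r hr => (h r hr).symm) measurableSet_Ioi

lemma conj_ray (r θ : ℝ) : starRingEnd ℂ ((r : ℂ) * Complex.exp (Complex.I * θ)) =
    (r : ℂ) * Complex.exp (Complex.I * (-θ : ℝ)) := by
  rw [map_mul, ← Complex.exp_conj]; simp

lemma conj_cpow_ofReal {z : ℂ} (hz : z ∈ Complex.slitPlane) (a : ℝ) :
    starRingEnd ℂ (z ^ (a : ℂ)) = starRingEnd ℂ z ^ (a : ℂ) := by
  rw [Complex.conj_cpow _ _ (Complex.mem_slitPlane_iff_arg.1 hz).1, Complex.conj_ofReal]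

lemma conj_coeffG (n : ℕ) : starRingEnd ℂ (coeffG n) = coeffG n := by
  simp only [coeffG, map_mul, Complex.conj_ofReal, map_intCast, map_natCast]

lemma conj_termG {n : ℕ} {p : ℂ} (h : p.im ≠ 0 ∨ p.re < pt n) :
    starRingEnd ℂ (termG n p) = termG n (starRingEnd ℂ p) := by
  have := conj_cpow_ofReal (mem_slitPlane_pt_sub h) (-(5 / 2))
  rw [map_sub, Complex.conj_ofReal] at this
  push_cast at this
  rw [termG, termG, map_mul, conj_coeffG, this]

lemma conj_G {p : ℂ} (hp : p ∈ sheet sing 0) : starRingEnd ℂ (G p) = G (starRingEnd ℂ p) := by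
  unfold G
  rw [Complex.conj_tsum]
  refine tsum_congr fun n => ?_
  by_cases hn : n ∈ chiSupport
  · exact conj_termG (im_ne_zero_or_lt_of_mem_sheet hp hn)
  · simp [termG_eq_zero hn]

lemma conj_laplace_integrand (X : ℂ) {r θ : ℝ} (hr : 0 < r) (hθ : θ ∈ Ioo 0 (2 * π)) :
    (fun p => Complex.exp (-X * p) * G p) ((r : ℂ) * Complex.exp (Complex.I * (-θ : ℝ))) =
      starRingEnd ℂ ((fun p => Complex.exp (-starRingEnd ℂ X * p) * G p)
        (r * Complex.exp (Complex.I * θ))) := by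
  simp only []
  rw [map_mul, conj_G (ray_mem_sheet hr hθ), ← Complex.exp_conj, map_mul, map_neg, conj_ray]
  simp only [Complex.conj_conj]

/-- Conjugation sends the ray at angle ε to the one at -ε, and G commutes with it; everything about
the left sum is inherited from the right one in this way. -/
lemma sumLeft_eq {s : ℂ} {ε : ℝ} (hε : ε ∈ Ioo 0 (2 * π)) (h : |s.im - ε| < π / 2) :
    sumLeft s = 1 + rayInt (fun p => Complex.exp (-Complex.exp s * p) * G p) (-ε) := by
  have h' : |(starRingEnd ℂ s).im + ε| < π / 2 := by
    rwa [Complex.conj_im, neg_add_eq_sub, abs_sub_comm]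
  rw [sumLeft, sumRight_eq hε h', map_add, map_one,
    rayInt_conj (g := fun p => Complex.exp (-Complex.exp s * p) * G p) ε]
  intro r hr
  have := conj_laplace_integrand (Complex.exp s) hr hε
  rw [← Complex.exp_conj] at this
  exact this

lemma rayIntegrable_laplace_neg {X : ℂ} {θ : ℝ} (hθ : θ ∈ Ioo 0 (2 * π))
    (hX : 0 < (X * Complex.exp (Complex.I * (-θ : ℝ))).re) :
    RayIntegrable (fun p => Complex.exp (-X * p) * G p) (-θ) := by
  refine RayIntegrable.conj (rayIntegrable_laplace (X := starRingEnd ℂ X) hθ ?_) fun r hr =>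
    conj_laplace_integrand _ hr hθ
  have := conj_ray 1 (-θ)
  rw [Complex.ofReal_one, one_mul, one_mul, neg_neg] at this
  rw [← this, ← map_mul, Complex.conj_re]
  exact hX

/-- The angle in the definition depends on s, so near a given s it is replaced by a fixed ε. The
integral with fixed ε is differentiated under the integral sign, dominated by a multiple of r
e^{-κr}. -/
lemma differentiableAt_sumRight {s : ℂ} (hs : s.im ∈ Ioo (-(5 * π / 2)) (π / 2)) :
    DifferentiableAt ℂ sumRight s := by
  set ε := (π / 2 - s.im) * 2 / 3 with hε
  have hmem : ε ∈ Ioo 0 (2 * π) := ⟨by linarith [hs.2], by linarith [hs.1]⟩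
  have habs : |s.im + ε| < π / 2 := by rw [abs_lt]; constructor <;> linarith [hs.1, hs.2]
  set d : ℝ := (π / 2 - |s.im + ε|) / 2 with hd
  have hd0 : 0 < d := by linarith
  have hball : ∀ z ∈ Metric.ball s (min d 1), |z.im + ε| ≤ π / 2 - d ∧ |z.re - s.re| ≤ 1 := by
    intro z hz
    rw [Metric.mem_ball, dist_eq_norm, lt_min_iff] at hz
    have h1 := (Complex.abs_im_le_norm (z - s)).trans_lt hz.1
    have h2 := (Complex.abs_re_le_norm (z - s)).trans_lt hz.2
    rw [Complex.sub_im] at h1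
    rw [Complex.sub_re] at h2
    refine ⟨?_, h2.le⟩
    have := abs_add_le (z.im - s.im) (s.im + ε)
    rw [show z.im - s.im + (s.im + ε) = z.im + ε by ring] at this
    linarith
  have hnhds : Metric.ball s (min d 1) ∈ 𝓝 s := Metric.ball_mem_nhds s (by positivity)
  set κ : ℝ := Real.exp (s.re - 1) * Real.cos (π / 2 - d) with hκ
  have hκ0 : 0 < κ := by
    refine mul_pos (Real.exp_pos _) (Real.cos_pos_of_mem_Ioo ⟨?_, ?_⟩)
    · have := abs_nonneg (s.im + ε); linarith
    · linarith
  have hκle : ∀ z ∈ Metric.ball s (min d 1),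
      κ ≤ (Complex.exp z * Complex.exp (Complex.I * ε)).re := by
    intro z hz
    obtain ⟨h1, h2⟩ := hball z hz
    rw [exp_mul_exp_I_re, ← Real.cos_abs (z.im + ε)]
    have h3 : Real.cos (π / 2 - d) ≤ Real.cos |z.im + ε| :=
      Real.cos_le_cos_of_nonneg_of_le_pi (abs_nonneg _) (by linarith [Real.pi_pos]) h1
    have h4 : Real.exp (s.re - 1) ≤ Real.exp z.re :=
      Real.exp_le_exp.2 (by linarith [(abs_le.1 h2).1])
    have h6 : 0 ≤ Real.cos (π / 2 - d) := (pos_of_mul_pos_right hκ0 (Real.exp_pos _).le).le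
    exact mul_le_mul h4 h3 h6 (Real.exp_pos _).le
  set C := |Real.sin (ε / 2)| ^ (-(5 / 2) : ℝ) * boundG with hC
  have hC0 : 0 ≤ C := mul_nonneg (Real.rpow_nonneg (abs_nonneg _) _) boundG_nonneg
  have hderiv := hasDerivAt_integral_of_dominated_loc_of_deriv_le (μ := volume.restrict (Ioi 0))
    (F := fun (z : ℂ) (r : ℝ) => Complex.exp (-Complex.exp z * (r * Complex.exp (Complex.I * ε))) *
      G (r * Complex.exp (Complex.I * ε)) * Complex.exp (Complex.I * ε))
    (F' := fun (z : ℂ) (r : ℝ) => -Complex.exp z * (r * Complex.exp (Complex.I * ε)) *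
      (Complex.exp (-Complex.exp z * (r * Complex.exp (Complex.I * ε))) *
      G (r * Complex.exp (Complex.I * ε))) * Complex.exp (Complex.I * ε))
    (bound := fun r => Real.exp (s.re + 1) * C * (r * Real.exp (-κ * r))) hnhds ?_ ?_ ?_ ?_ ?_ ?_
  · have := hderiv.2.differentiableAt.const_add (1 : ℂ)
    refine this.congr_of_eventuallyEq ?_
    filter_upwards [hnhds] with z hz
    exact sumRight_eq hmem (by linarith [(hball z hz).1])
  · refine Eventually.of_forall fun z => (aestronglyMeasurable_ray
      (f := fun p => Complex.exp (-Complex.exp z * p) * G p) fun r hr => ?_).mul_const _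
    exact (differentiableAt_laplace_integrand _ (ray_mem_sheet hr hmem)).continuousAt
  · exact (rayIntegrable_laplace hmem
      (hκ0.trans_le (hκle s (mem_of_mem_nhds hnhds)))).mul_const _
  · refine (aestronglyMeasurable_ray
      (f := fun p => -Complex.exp s * p * (Complex.exp (-Complex.exp s * p) * G p))
        fun r hr => ?_).mul_const _
    exact (DifferentiableAt.mul (by fun_prop)
      (differentiableAt_laplace_integrand _ (ray_mem_sheet hr hmem))).continuousAt
  · refine (ae_restrict_iff' measurableSet_Ioi).2 (Eventually.of_forall fun r hr z hz => ?_)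
    have hr' : 0 < r := hr
    have h1 := norm_laplace_integrand_le (sin_half_pos hmem) le_rfl (hκle z hz) hr
    rw [norm_mul, norm_mul, norm_mul, norm_mul, norm_exp_I_mul, norm_neg, Complex.norm_exp,
      Complex.norm_real, Real.norm_eq_abs, abs_of_pos hr', mul_one, mul_one]
    have h2 : Real.exp z.re ≤ Real.exp (s.re + 1) :=
      Real.exp_le_exp.2 (by linarith [(abs_le.1 (hball z hz).2).2])
    calc _ ≤ Real.exp (s.re + 1) * r * (C * Real.exp (-κ * r)) := by gcongr
      _ = _ := by ring
  · refine Integrable.const_mul ?_ _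
    have := integrableOn_rpow_mul_exp_neg_mul_rpow (s := 1) (p := 1) (b := κ) (by norm_num)
      one_pos hκ0
    have h : IntegrableOn (fun r : ℝ => r * Real.exp (-κ * r)) (Ioi 0) := by simpa using this
    exact h
  · refine (ae_restrict_iff' measurableSet_Ioi).2 (Eventually.of_forall fun r hr z hz => ?_)
    have h1 : HasDerivAt (fun z : ℂ => -Complex.exp z * (r * Complex.exp (Complex.I * ε)))
        (-Complex.exp z * (r * Complex.exp (Complex.I * ε))) z :=
      (Complex.hasDerivAt_exp z).neg.mul_const _
    refine ((h1.cexp.mul_const (G (r * Complex.exp (Complex.I * ε)))).mul_const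
      (Complex.exp (Complex.I * ε))).congr_deriv ?_
    ring

lemma differentiableAt_sumLeft {s : ℂ} (hs : s.im ∈ Ioo (-(π / 2)) (5 * π / 2)) :
    DifferentiableAt ℂ sumLeft s := by
  have := (differentiableAt_sumRight (s := starRingEnd ℂ s) (by
    rw [Complex.conj_im]; exact ⟨by linarith [hs.2], by linarith [hs.1]⟩)).conj_conj
  rw [Complex.conj_conj] at this
  exact this

/-! ### The pentagonal number theorem and the eta function -/

lemma norm_prod_one_sub_pow_le {x : ℂ} (hx : ‖x‖ < 1) (k n : ℕ) :
    ‖∏ i ∈ Finset.range n, (1 - x ^ (k + i + 1))‖ ≤ Real.exp (1 - ‖x‖)⁻¹ := by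
  have h1 : ∀ i ∈ Finset.range n, ‖1 - x ^ (k + i + 1)‖ ≤ Real.exp (‖x‖ ^ i) := by
    intro i _
    calc ‖1 - x ^ (k + i + 1)‖ ≤ 1 + ‖x‖ ^ (k + i + 1) := by
          refine (norm_sub_le _ _).trans ?_
          rw [norm_one, norm_pow]
      _ ≤ 1 + ‖x‖ ^ i := by
          gcongr 1 + ?_
          exact pow_le_pow_of_le_one (norm_nonneg _) hx.le (by omega)
      _ ≤ _ := by rw [add_comm]; exact Real.add_one_le_exp _
  rw [norm_prod]
  refine (Finset.prod_le_prod (fun _ _ => norm_nonneg _) h1).trans ?_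
  rw [← Real.exp_sum, ← tsum_geometric_of_lt_one (norm_nonneg _) hx]
  exact Real.exp_le_exp.2 ((summable_geometric_of_lt_one (norm_nonneg _) hx).sum_le_tsum _
    fun i _ => by positivity)

lemma summable_pow_of_le {x : ℂ} (hx : ‖x‖ < 1) {e : ℕ → ℕ} (he : ∀ k, k ≤ e k) :
    Summable fun k => ‖x ^ e k‖ := by
  refine Summable.of_nonneg_of_le (fun _ => norm_nonneg _) (fun k => ?_)
    (summable_geometric_of_lt_one (norm_nonneg _) hx)
  rw [norm_pow]
  exact pow_le_pow_of_le_one (norm_nonneg _) hx.le (he k)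

lemma two_mul_pentagonal (k : ℤ) : 2 * (pentagonal k : ℤ) = k * (3 * k - 1) :=
  two_mul_natCast_pentagonal k

lemma norm_pentagonal_tail_term_le {x : ℂ} (hx : ‖x‖ < 1) (k n : ℕ) :
    ‖x ^ ((k + 1) * n) * ∏ i ∈ Finset.range (n + 1), (1 - x ^ (k + i + 1))‖ ≤
      ‖x‖ ^ n * Real.exp (1 - ‖x‖)⁻¹ := by
  rw [norm_mul, norm_pow]
  exact mul_le_mul (pow_le_pow_of_le_one (norm_nonneg _) hx.le (by nlinarith))
    (norm_prod_one_sub_pow_le hx k (n + 1)) (norm_nonneg _) (by positivity)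

/-- Euler's pentagonal number theorem for complex numbers. -/
theorem tprod_one_sub_pow_eq {x : ℂ} (hx : ‖x‖ < 1) :
    ∏' n : ℕ, (1 - x ^ (n + 1)) = ∑' k : ℕ, (-1) ^ k *
      (x ^ pentagonal (-k) - x ^ pentagonal (k + 1)) := by
  have hgeo := (summable_geometric_of_lt_one (norm_nonneg _) hx).mul_right (Real.exp (1 - ‖x‖)⁻¹)
  refine Pentagonal.tprod_one_sub_pow ?_ (fun k => ?_) (fun k => ?_) ?_ ?_
  · exact tendsto_pow_atTop_nhds_zero_of_norm_lt_one hx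
  · exact Summable.of_norm_bounded hgeo (norm_pentagonal_tail_term_le hx k)
  · have : Multipliable fun n : ℕ => 1 + -x ^ (n + k + 1) := by
      refine multipliable_one_add_of_summable ?_
      simp only [norm_neg]
      exact summable_pow_of_le hx fun n => by omega
    simpa only [← sub_eq_add_neg] using this
  · refine Summable.of_norm ?_
    refine Summable.of_nonneg_of_le (fun _ => norm_nonneg _) (fun k => ?_)
      ((summable_pow_of_le hx (e := fun k => pentagonal (-(k : ℤ))) fun k => ?_).add
        (summable_pow_of_le hx (e := fun k => pentagonal ((k : ℤ) + 1)) fun k => ?_))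
    · rw [norm_mul, norm_pow, norm_neg, norm_one, one_pow, one_mul]
      exact norm_sub_le _ _
    · have := two_mul_pentagonal (-(k : ℤ))
      zify
      nlinarith
    · have := two_mul_pentagonal ((k : ℤ) + 1)
      zify
      nlinarith
  · have hC : ∀ k : ℕ, ‖∑' n : ℕ, x ^ ((k + 1) * n) *
        ∏ i ∈ Finset.range (n + 1), (1 - x ^ (k + i + 1))‖ ≤
          ∑' n : ℕ, ‖x‖ ^ n * Real.exp (1 - ‖x‖)⁻¹ := fun k =>
      tsum_of_norm_bounded hgeo.hasSum (norm_pentagonal_tail_term_le hx k)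
    have hlim := (tendsto_pow_atTop_nhds_zero_of_lt_one (norm_nonneg _) hx).mul_const
      (∑' n : ℕ, ‖x‖ ^ n * Real.exp (1 - ‖x‖)⁻¹)
    rw [zero_mul] at hlim
    refine squeeze_zero_norm (fun k => ?_) hlim
    rw [norm_mul, norm_mul, norm_pow, norm_neg, norm_one, one_pow, one_mul, norm_pow]
    refine mul_le_mul (pow_le_pow_of_le_one (norm_nonneg _) hx.le ?_) (hC k) (norm_nonneg _)
      (by positivity)
    rw [Nat.le_div_iff_mul_le two_pos]
    nlinarith

lemma chi_coprimeSix (m : ℕ) : chi (coprimeSix (2 * m)) = (-1) ^ m ∧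
    chi (coprimeSix (2 * m + 1)) = -(-1) ^ m := by
  rcases Nat.even_or_odd' m with ⟨k, rfl | rfl⟩
  · have h : (-1 : ℤ) ^ (2 * k) = 1 := by simp
    simp only [chi, coprimeSix, h]
    constructor <;> split_ifs <;> omega
  · have h : (-1 : ℤ) ^ (2 * k + 1) = -1 := by simp [pow_succ]
    simp only [chi, coprimeSix, h]
    constructor <;> split_ifs <;> omega

lemma norm_exp_neg_pt_mul (n : ℕ) (z : ℂ) :
    ‖Complex.exp (-(pt n : ℂ) * z)‖ = Real.exp (-(pt n * z.re)) := by
  rw [Complex.norm_exp, ← Complex.ofReal_neg, Complex.re_ofReal_mul, neg_mul]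

lemma summable_pow_mul_exp_neg_pt {c : ℝ} (hc : 0 < c) (k : ℕ) :
    Summable fun n : ℕ => (n : ℝ) ^ k * Real.exp (-(pt n * c)) := by
  refine Summable.of_nonneg_of_le (fun n => by positivity) (fun n => ?_)
    (Real.summable_pow_mul_exp_neg_nat_mul k hc)
  gcongr
  have h1 : (n : ℝ) ≤ (n : ℝ) ^ 2 := by
    rcases Nat.eq_zero_or_pos n with rfl | h
    · simp
    · have : (1 : ℝ) ≤ n := by exact_mod_cast h
      nlinarith
  have h2 := h1.trans (sq_le_pt n)
  nlinarith

lemma summable_norm_chi_mul_exp {z : ℂ} (hz : 0 < z.re) :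
    Summable fun n : ℕ => ‖(chi n : ℂ) * Complex.exp (-(pt n : ℂ) * z)‖ := by
  refine Summable.of_nonneg_of_le (fun _ => norm_nonneg _) (fun n => ?_)
    (summable_pow_mul_exp_neg_pt hz 0)
  rw [norm_mul, norm_exp_neg_pt_mul, pow_zero]
  gcongr
  exact norm_chi_le n

lemma hasSum_comp_coprimeSix {f : ℕ → ℂ} {s : ℂ} (hf : ∀ n ∉ chiSupport, f n = 0) :
    HasSum (fun m => f (coprimeSix m)) s ↔ HasSum f s := by
  refine coprimeSix_strictMono.injective.hasSum_iff fun n hn => hf n fun hmem => hn ?_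
  exact ⟨n / 3, coprimeSix_of_mem hmem⟩

/-- The eta function as a theta series. -/
theorem hasSum_eta {z : ℂ} (hz : 0 < z.re) :
    HasSum (fun n : ℕ => (chi n : ℂ) * Complex.exp (-(pt n : ℂ) * z))
      (ModularForm.eta (2 * π * Complex.I * z)) := by
  obtain ⟨f, hf⟩ : ∃ f : ℕ → ℂ, f = fun n => (chi n : ℂ) * Complex.exp (-(pt n : ℂ) * z) := ⟨_, rfl⟩
  obtain ⟨x, hx⟩ : ∃ x : ℂ, x = Complex.exp (-(4 * π ^ 2) * z) := ⟨_, rfl⟩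
  have hI : (Complex.I) ^ 2 = -1 := Complex.I_sq
  have hx1 : ‖x‖ < 1 := by
    rw [hx, Complex.norm_exp, Real.exp_lt_one_iff]
    rw [show (-(4 * π ^ 2) * z : ℂ) = ((-(4 * π ^ 2) : ℝ) : ℂ) * z by push_cast; ring,
      Complex.re_ofReal_mul]
    have : 0 < π ^ 2 := by positivity
    nlinarith
  -- With x = e^{-4π²z} in the role of q, this is q^{n²/24} = q^{1/24} q^e.
  have hexp : ∀ n e : ℕ, n ^ 2 = 24 * e + 1 →
      Complex.exp (-(pt n : ℂ) * z) = Complex.exp (-(π ^ 2 / 6) * z) * x ^ e := by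
    intro n e h
    rw [hx, ← Complex.exp_nat_mul, ← Complex.exp_add, pt]
    congr 1
    have : (n : ℂ) ^ 2 = 24 * e + 1 := by exact_mod_cast h
    push_cast
    rw [this]
    ring
  -- The integers 6k+1 and 6k+5 correspond to the two families of pentagonal exponents, since
  -- (6k+1)² and (6k+5)² are 24 times these numbers plus 1.
  have hterm : ∀ k : ℕ, f (coprimeSix (2 * k)) + f (coprimeSix (2 * k + 1)) =
      Complex.exp (-(π ^ 2 / 6) * z) * ((-1) ^ k *
        (x ^ pentagonal (-k) - x ^ pentagonal (k + 1))) := by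
    intro k
    have h1 := two_mul_pentagonal (-(k : ℤ))
    have h2 := two_mul_pentagonal ((k : ℤ) + 1)
    have e1 := hexp (coprimeSix (2 * k)) (pentagonal (-k)) (by
      have : coprimeSix (2 * k) = 6 * k + 1 := by unfold coprimeSix; omega
      rw [this]; zify; nlinarith)
    have e2 := hexp (coprimeSix (2 * k + 1)) (pentagonal (k + 1)) (by
      have : coprimeSix (2 * k + 1) = 6 * k + 5 := by unfold coprimeSix; omega
      rw [this]; zify; nlinarith)
    simp only [hf, e1, e2, (chi_coprimeSix k).1, (chi_coprimeSix k).2]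
    push_cast
    ring
  have hsf : Summable f := by rw [hf]; exact (summable_norm_chi_mul_exp hz).of_norm
  have hs : Summable fun m => f (coprimeSix m) :=
    hsf.comp_injective coprimeSix_strictMono.injective
  have hval : ModularForm.eta (2 * π * Complex.I * z) = ∑' m, f (coprimeSix m) := by
    have hinj2 : Function.Injective fun k : ℕ => 2 * k := fun a b h => by simpa using h
    have hinj3 : Function.Injective fun k : ℕ => 2 * k + 1 := fun a b h => by simpa using h
    have hs2 : Summable fun k => f (coprimeSix (2 * k)) := hs.comp_injective hinj2
    have hs3 : Summable fun k => f (coprimeSix (2 * k + 1)) := hs.comp_injective hinj3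
    rw [← tsum_even_add_odd (f := fun m => f (coprimeSix m)) hs2 hs3, ← hs2.tsum_add hs3]
    rw [tsum_congr hterm, tsum_mul_left, ← tprod_one_sub_pow_eq hx1, ModularForm.eta]
    congr 1
    · rw [Function.Periodic.qParam]
      congr 1
      push_cast
      linear_combination (π ^ 2 * z / 6) * hI
    · refine tprod_congr fun n => ?_
      rw [ModularForm.eta_q_eq_pow, hx]
      congr 3
      linear_combination (4 * π ^ 2 * z) * hI
  rw [hval, ← hf]
  exact (hasSum_comp_coprimeSix fun n hn => by simp [hf, chi_eq_zero_of_notMem hn]).1 hs.hasSum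

/-! ### The Laplace integrals of the terms of `G` -/

lemma sub_ray_mem_slitPlane {A r θ : ℝ} (hA : 0 < A) (hr : 0 ≤ r) (hθ : θ ∈ Ioo 0 (2 * π)) :
    (A : ℂ) - r * Complex.exp (Complex.I * θ) ∈ Complex.slitPlane := by
  refine mem_slitPlane_pt_sub ?_
  rcases hr.eq_or_lt with rfl | hr
  · right; simpa using hA
  · have hpos : 0 < r * (π ^ 2 / 6) / A := by positivity
    have := (mem_sheet_zero_iff _).1 (ray_mem_sheet hpos hθ)
    have e : ((r * (π ^ 2 / 6) / A : ℝ) : ℂ) * Complex.exp (Complex.I * θ) =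
        ((π ^ 2 / 6 / A : ℝ) : ℂ) * (r * Complex.exp (Complex.I * θ)) := by push_cast; ring
    have hq : 0 < π ^ 2 / 6 / A := by positivity
    rw [e, Complex.re_ofReal_mul, Complex.im_ofReal_mul] at this
    refine this.imp (fun h => (mul_ne_zero_iff.1 h).2) fun h => ?_
    have h2 : π ^ 2 / 6 / A * (r * Complex.exp (Complex.I * θ)).re < π ^ 2 / 6 / A * A := by
      rwa [div_mul_cancel₀ _ hA.ne']
    exact lt_of_mul_lt_mul_left h2 hq.le

lemma norm_sub_ray_cpow_le {A r θ b : ℝ} (hA : 0 < A) (hr : 0 ≤ r) (hθ : θ ∈ Ioo 0 (2 * π))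
    (hb : b ≤ 0) : ‖((A : ℂ) - r * Complex.exp (Complex.I * θ)) ^ (b : ℂ)‖ ≤
      (A * |Real.sin (θ / 2)|) ^ b := by
  rw [Complex.norm_cpow_real]
  exact Real.rpow_le_rpow_of_nonpos (mul_pos hA (sin_half_pos hθ))
    (mul_sin_half_le_norm_sub hA.le hr) hb

lemma norm_power_integrand_le {X : ℂ} {A r θ b : ℝ} (hA : 0 < A) (hr : 0 ≤ r)
    (hθ : θ ∈ Ioo 0 (2 * π)) (hb : b ≤ 0) :
    ‖Complex.exp (-X * (r * Complex.exp (Complex.I * θ))) *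
      ((A : ℂ) - r * Complex.exp (Complex.I * θ)) ^ (b : ℂ)‖ ≤
      (A * |Real.sin (θ / 2)|) ^ b * Real.exp (-(X * Complex.exp (Complex.I * θ)).re * r) := by
  rw [norm_mul, norm_exp_neg_mul_ray, mul_comm]
  gcongr
  exact norm_sub_ray_cpow_le hA hr hθ hb

lemma rayIntegrable_power {X : ℂ} {A θ b : ℝ} (hA : 0 < A) (hθ : θ ∈ Ioo 0 (2 * π)) (hb : b ≤ 0)
    (hX : 0 < (X * Complex.exp (Complex.I * θ)).re) :
    RayIntegrable (fun p => Complex.exp (-X * p) * ((A : ℂ) - p) ^ (b : ℂ)) θ :=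
  rayIntegrable_of_le hX (fun r hr => (DifferentiableAt.mul (by fun_prop)
    (DifferentiableAt.cpow_const (by fun_prop) (sub_ray_mem_slitPlane hA hr.le hθ))).continuousAt)
    fun r hr => norm_power_integrand_le hA hr.le hθ hb

/-- Integration by parts. -/
lemma rayInt_power_parts {X : ℂ} {A θ b : ℝ} (hA : 0 < A) (hθ : θ ∈ Ioo 0 (2 * π)) (hb : b ≤ 0)
    (hX : 0 < (X * Complex.exp (Complex.I * θ)).re) :
    b * rayInt (fun p => Complex.exp (-X * p) * ((A : ℂ) - p) ^ ((b - 1 : ℝ) : ℂ)) θ =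
      (A : ℂ) ^ (b : ℂ) - X * rayInt (fun p => Complex.exp (-X * p) * ((A : ℂ) - p) ^ (b : ℂ)) θ := by
  set E := Complex.exp (Complex.I * θ) with hE
  have h1 := (rayIntegrable_power (X := X) hA hθ (by linarith : b - 1 ≤ 0) hX).mul_const E
  have h2 := (rayIntegrable_power (X := X) hA hθ hb hX).mul_const E
  have hd : ∀ r ∈ Ioi (0 : ℝ), HasDerivAt
      (fun r : ℝ => Complex.exp (-X * (r * E)) * ((A : ℂ) - r * E) ^ (b : ℂ))
      (-b * (Complex.exp (-X * (r * E)) * ((A : ℂ) - r * E) ^ ((b - 1 : ℝ) : ℂ) * E) -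
        X * (Complex.exp (-X * (r * E)) * ((A : ℂ) - r * E) ^ (b : ℂ) * E)) r := by
    intro r hr
    have e1 : HasDerivAt (fun r : ℝ => (r : ℂ) * E) E r := by
      simpa using (Complex.ofRealCLM.hasDerivAt (x := r)).mul_const E
    have e2 : HasDerivAt (fun p : ℂ => Complex.exp (-X * p) * ((A : ℂ) - p) ^ (b : ℂ))
        (Complex.exp (-X * (r * E)) * (-X) * ((A : ℂ) - r * E) ^ (b : ℂ) +
        Complex.exp (-X * (r * E)) * (b * ((A : ℂ) - r * E) ^ ((b : ℂ) - 1) * (-1))) (r * E) := by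
      refine HasDerivAt.mul ?_ ?_
      · simpa using ((hasDerivAt_id ((r : ℂ) * E)).const_mul (-X)).cexp
      · exact ((hasDerivAt_id ((r : ℂ) * E)).const_sub (A : ℂ)).cpow_const
          (sub_ray_mem_slitPlane hA (le_of_lt hr) hθ)
    refine (e2.comp r e1).congr_deriv ?_
    push_cast
    ring
  have hcont : ContinuousWithinAt
      (fun r : ℝ => Complex.exp (-X * (r * E)) * ((A : ℂ) - r * E) ^ (b : ℂ)) (Ici 0) 0 := by
    refine ContinuousAt.continuousWithinAt (ContinuousAt.mul (by fun_prop) ?_)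
    exact ContinuousAt.cpow (by fun_prop) continuousAt_const (sub_ray_mem_slitPlane hA le_rfl hθ)
  have hlim : Tendsto (fun r : ℝ => Complex.exp (-X * (r * E)) * ((A : ℂ) - r * E) ^ (b : ℂ))
      atTop (𝓝 0) := by
    have h3 := ((Real.tendsto_exp_atBot.comp (tendsto_id.const_mul_atTop_of_neg
      (neg_lt_zero.2 hX))).const_mul ((A * |Real.sin (θ / 2)|) ^ b))
    rw [mul_zero] at h3
    exact squeeze_zero_norm' ((eventually_ge_atTop 0).mono fun r hr =>
      norm_power_integrand_le hA hr hθ hb) h3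
  have := integral_Ioi_of_hasDerivAt_of_tendsto hcont hd
    ((h1.const_mul (-b : ℂ)).sub (h2.const_mul X)) hlim
  rw [integral_sub (h1.const_mul (-b : ℂ)) (h2.const_mul X), integral_const_mul,
    integral_const_mul] at this
  simp only [Complex.ofReal_zero, zero_mul, mul_zero, Complex.exp_zero, one_mul, sub_zero] at this
  simp only [rayInt]
  linear_combination -this

/-- The substitution `z = X p / A`. -/
lemma rayInt_power_subst {s : ℂ} {A θ b : ℝ} (hA : 0 < A) (hθ : θ ∈ Ioo 0 (2 * π)) :
    Complex.exp s * rayInt (fun p => Complex.exp (-Complex.exp s * p) * ((A : ℂ) - p) ^ (b : ℂ)) θ =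
      (A : ℂ) ^ ((b + 1 : ℝ) : ℂ) *
        rayInt (fun z => Complex.exp (-(A : ℂ) * z) * (1 - z / Complex.exp s) ^ (b : ℂ))
          (s.im + θ) := by
  -- The point z = e^s p / A has modulus c r and argument Im s + θ, so on radii the substitution is
  -- a scaling by c.
  set c : ℝ := Real.exp s.re / A with hc
  have hc0 : 0 < c := by positivity
  have hA' : (A : ℂ) ≠ 0 := by exact_mod_cast hA.ne'
  have hexp : Complex.exp s = (Real.exp s.re : ℂ) * Complex.exp (Complex.I * s.im) := by
    rw [Complex.ofReal_exp, ← Complex.exp_add, mul_comm, Complex.re_add_im]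
  have hsub := integral_comp_mul_left_Ioi' (fun r : ℝ =>
    (Complex.exp (-(A : ℂ) * (r * Complex.exp (Complex.I * (s.im + θ : ℝ)))) *
      (1 - (r * Complex.exp (Complex.I * (s.im + θ : ℝ))) / Complex.exp s) ^ (b : ℂ)) *
      Complex.exp (Complex.I * (s.im + θ : ℝ))) 0 hc0
  rw [mul_zero] at hsub
  rw [rayInt, rayInt, ← hsub, ← integral_smul, ← integral_const_mul, ← integral_const_mul]
  refine setIntegral_congr_fun measurableSet_Ioi fun r hr => ?_
  have hz : ((c * r : ℝ) : ℂ) * Complex.exp (Complex.I * (s.im + θ : ℝ)) =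
      Complex.exp s * (r * Complex.exp (Complex.I * θ)) / A := by
    rw [hexp, hc]
    push_cast
    rw [mul_add, Complex.exp_add]
    ring
  have h1 : (A : ℂ) - r * Complex.exp (Complex.I * θ) = A * (1 - ((c * r : ℝ) : ℂ) *
      Complex.exp (Complex.I * (s.im + θ : ℝ)) / Complex.exp s) := by
    rw [hz]
    have := Complex.exp_ne_zero s
    field_simp
  have h2 : 1 - ((c * r : ℝ) : ℂ) * Complex.exp (Complex.I * (s.im + θ : ℝ)) / Complex.exp s ≠ 0 := by
    intro h
    rw [h, mul_zero] at h1
    have := sub_ray_mem_slitPlane hA (le_of_lt hr) hθ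
    rw [h1] at this
    exact Complex.zero_notMem_slitPlane this
  have h3 : (A : ℂ) ^ ((b + 1 : ℝ) : ℂ) = (A : ℂ) ^ (b : ℂ) * A := by
    rw [Complex.ofReal_add, Complex.ofReal_one, Complex.cpow_add _ _ hA', Complex.cpow_one]
  have h4 : -Complex.exp s * (r * Complex.exp (Complex.I * θ)) = -(A : ℂ) * (((c * r : ℝ) : ℂ) *
      Complex.exp (Complex.I * (s.im + θ : ℝ))) := by
    rw [hz]; field_simp
  have h5 : (c : ℂ) * (A * Complex.exp (Complex.I * (s.im + θ : ℝ))) =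
      Complex.exp s * Complex.exp (Complex.I * θ) := by
    rw [hexp, hc]
    push_cast
    rw [mul_add, Complex.exp_add]
    field_simp
  rw [h1, ofReal_mul_cpow hA h2, h3, h4, Complex.real_smul]
  linear_combination -(Complex.exp (-(A : ℂ) * (((c * r : ℝ) : ℂ) *
      Complex.exp (Complex.I * (s.im + θ : ℝ)))) * (A : ℂ) ^ (b : ℂ) * (1 - ((c * r : ℝ) : ℂ) *
      Complex.exp (Complex.I * (s.im + θ : ℝ)) / Complex.exp s) ^ (b : ℂ)) * h5

/-! ### The lateral sums as integrals of the eta function -/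

/-- This yields integrability of a sum without a pointwise majorant, which the theta series does not
readily supply near z = 0. -/
lemma integrable_of_summable_integral_norm {α : Type*} [MeasurableSpace α] {μ : Measure α}
    {f : α → ℂ} {F : ℕ → α → ℂ} (hF : ∀ n, Integrable (F n) μ)
    (hs : Summable fun n => ∫ a, ‖F n a‖ ∂μ) (hf : AEStronglyMeasurable f μ)
    (hfF : ∀ᵐ a ∂μ, f a = ∑' n, F n a) : Integrable f μ := by
  refine ⟨hf, ?_⟩
  rw [hasFiniteIntegral_iff_enorm]
  calc ∫⁻ a, ‖f a‖ₑ ∂μ ≤ ∫⁻ a, ∑' n, ‖F n a‖ₑ ∂μ := by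
        refine lintegral_mono_ae (hfF.mono fun a ha => ?_)
        rw [ha]
        exact enorm_tsum_le_tsum_enorm
    _ = ∑' n, ENNReal.ofReal (∫ a, ‖F n a‖ ∂μ) := by
        rw [lintegral_tsum fun n => (hF n).1.enorm]
        exact tsum_congr fun n => (ofReal_integral_norm_eq_lintegral_enorm (hF n)).symm
    _ < ⊤ := hs.tsum_ofReal_lt_top

lemma integral_exp_neg_mul {c : ℝ} (hc : 0 < c) :
    ∫ r in Ioi (0 : ℝ), Real.exp (-c * r) = c⁻¹ := by
  rw [integral_exp_mul_Ioi (neg_lt_zero.2 hc)]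
  simp [neg_div_neg_eq]

lemma hasSum_rayInt_termG {X : ℂ} {θ : ℝ} (hθ : θ ∈ Ioo 0 (2 * π))
    (hX : 0 < (X * Complex.exp (Complex.I * θ)).re) :
    HasSum (fun n => rayInt (fun p => Complex.exp (-X * p) * termG n p) θ)
      (rayInt (fun p => Complex.exp (-X * p) * G p) θ) := by
  set κ := (X * Complex.exp (Complex.I * θ)).re with hκ
  have hsin := sin_half_pos hθ
  set C : ℕ → ℝ := fun n =>
    |Real.sin (θ / 2)| ^ (-(5 / 2) : ℝ) * (4 * (n : ℝ) ^ (-(3 / 2) : ℝ)) with hC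
  have hb : ∀ n, ∀ r : ℝ, 0 < r → ‖Complex.exp (-X * (r * Complex.exp (Complex.I * θ))) *
      termG n (r * Complex.exp (Complex.I * θ))‖ ≤ C n * Real.exp (-κ * r) := by
    intro n r hr
    rw [norm_mul, norm_exp_neg_mul_ray, mul_comm]
    gcongr
    exact norm_termG_le hsin (fun m hm => mul_le_norm_pt_sub_ray le_rfl hr.le hm) n
  have hint : ∀ n, RayIntegrable (fun p => Complex.exp (-X * p) * termG n p) θ := by
    intro n
    refine rayIntegrable_of_le hX (fun r hr => ?_) (hb n)
    by_cases hn : n ∈ chiSupport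
    · exact (DifferentiableAt.mul (by fun_prop) (differentiableAt_termG
        (im_ne_zero_or_lt_of_mem_sheet (ray_mem_sheet hr hθ) hn))).continuousAt
    · simp only [termG_eq_zero hn, mul_zero]
      exact continuousAt_const
  have h := hasSum_integral_of_summable_integral_norm (μ := volume.restrict (Ioi (0 : ℝ)))
    (F := fun (n : ℕ) (r : ℝ) => Complex.exp (-X * (r * Complex.exp (Complex.I * θ))) *
      termG n (r * Complex.exp (Complex.I * θ)) * Complex.exp (Complex.I * θ))
    (fun n => (hint n).mul_const _) ?_
  · have e : rayInt (fun p => Complex.exp (-X * p) * G p) θ = ∫ r in Ioi (0 : ℝ), ∑' n,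
        Complex.exp (-X * (r * Complex.exp (Complex.I * θ))) *
          termG n (r * Complex.exp (Complex.I * θ)) * Complex.exp (Complex.I * θ) :=
      setIntegral_congr_fun measurableSet_Ioi fun r _ => by
        simp only [G]
        rw [tsum_mul_right, tsum_mul_left]
    rw [e]
    exact h
  · refine Summable.of_nonneg_of_le (fun n => integral_nonneg fun _ => norm_nonneg _) (fun n => ?_)
      ((summable_rpow_three_half.mul_left (|Real.sin (θ / 2)| ^ (-(5 / 2) : ℝ))).mul_right κ⁻¹)
    rw [← integral_exp_neg_mul hX, ← integral_const_mul]
    refine setIntegral_mono_on ((hint n).mul_const _).norm (integrableOn_exp_neg_mul hX _)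
      measurableSet_Ioi fun r hr => ?_
    rw [norm_mul, norm_exp_I_mul, mul_one]
    exact hb n r hr

lemma exp_mul_ray (s : ℂ) (r θ : ℝ) : (r : ℂ) * Complex.exp (Complex.I * (s.im + θ : ℝ)) /
    Complex.exp s = ((r / Real.exp s.re : ℝ) : ℂ) * Complex.exp (Complex.I * θ) := by
  have hexp : Complex.exp s = (Real.exp s.re : ℂ) * Complex.exp (Complex.I * s.im) := by
    rw [Complex.ofReal_exp, ← Complex.exp_add, mul_comm, Complex.re_add_im]
  have h1 : (Real.exp s.re : ℂ) ≠ 0 := by exact_mod_cast (Real.exp_pos _).ne'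
  rw [hexp, Complex.ofReal_add, mul_add, Complex.exp_add, Complex.ofReal_div]
  have := Complex.exp_ne_zero (Complex.I * s.im)
  field_simp

lemma ray_re (r φ : ℝ) : ((r : ℂ) * Complex.exp (Complex.I * φ)).re = r * Real.cos φ := by
  rw [Complex.re_ofReal_mul, mul_comm Complex.I, Complex.exp_ofReal_mul_I_re]

/-- The integral of the eta kernel along a ray, term by term. -/
lemma rayIntegrable_etaKernel_and_hasSum {s : ℂ} {θ : ℝ} (hθ : θ ∈ Ioo 0 (2 * π))
    (hs : |s.im + θ| < π / 2) :
    RayIntegrable (etaKernel (Complex.exp s)) (s.im + θ) ∧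
    HasSum (fun n : ℕ => (chi n : ℂ) * rayInt (fun z => Complex.exp (-(pt n : ℂ) * z) *
        (1 - z / Complex.exp s) ^ ((-(3 / 2) : ℝ) : ℂ)) (s.im + θ))
      (rayInt (etaKernel (Complex.exp s)) (s.im + θ)) := by
  set φ := s.im + θ with hφ
  have hcos := cos_pos_of_abs_lt hs
  set D : ℝ := (1 * |Real.sin (θ / 2)|) ^ (-(3 / 2) : ℝ) with hD
  have hslit : ∀ r : ℝ, 0 < r →
      1 - (r * Complex.exp (Complex.I * φ)) / Complex.exp s ∈ Complex.slitPlane := by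
    intro r hr
    rw [exp_mul_ray]
    have := sub_ray_mem_slitPlane one_pos (r := r / Real.exp s.re) (by positivity) hθ
    rwa [Complex.ofReal_one] at this
  have hDb : ∀ r : ℝ, 0 < r →
      ‖(1 - (r * Complex.exp (Complex.I * φ)) / Complex.exp s) ^ ((-(3 / 2) : ℝ) : ℂ)‖ ≤ D := by
    intro r hr
    rw [exp_mul_ray]
    have := norm_sub_ray_cpow_le one_pos (r := r / Real.exp s.re) (by positivity) hθ
      (b := -(3 / 2)) (by norm_num)
    rwa [Complex.ofReal_one] at this
  have hb : ∀ n ∈ chiSupport, ∀ r : ℝ, 0 < r →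
      ‖Complex.exp (-(pt n : ℂ) * (r * Complex.exp (Complex.I * φ))) *
      (1 - (r * Complex.exp (Complex.I * φ)) / Complex.exp s) ^ ((-(3 / 2) : ℝ) : ℂ)‖ ≤
      D * Real.exp (-(pt n * Real.cos φ) * r) := by
    intro n hn r hr
    rw [norm_mul, norm_exp_neg_pt_mul, ray_re, mul_comm]
    have := hDb r hr
    rw [show -(pt n * (r * Real.cos φ)) = -(pt n * Real.cos φ) * r by ring]
    gcongr
  have hcpow : ∀ r : ℝ, 0 < r → ContinuousAt (fun z : ℂ =>
      (1 - z / Complex.exp s) ^ ((-(3 / 2) : ℝ) : ℂ)) (r * Complex.exp (Complex.I * φ)) :=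
    fun r hr => ContinuousAt.cpow (by fun_prop) continuousAt_const (hslit r hr)
  have hint : ∀ n ∈ chiSupport, RayIntegrable (fun z => Complex.exp (-(pt n : ℂ) * z) *
      (1 - z / Complex.exp s) ^ ((-(3 / 2) : ℝ) : ℂ)) φ := fun n hn =>
    rayIntegrable_of_le (mul_pos (pt_pos_of_mem hn) hcos)
      (fun r hr => ContinuousAt.mul (by fun_prop) (hcpow r hr)) (hb n hn)
  set T : ℕ → ℝ → ℂ := fun n r => (chi n : ℂ) * (Complex.exp (-(pt n : ℂ) *
    (r * Complex.exp (Complex.I * φ))) * (1 - (r * Complex.exp (Complex.I * φ)) / Complex.exp s) ^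
      ((-(3 / 2) : ℝ) : ℂ)) with hT
  have hTint : ∀ n, IntegrableOn (T n) (Ioi 0) := by
    intro n
    by_cases hn : n ∈ chiSupport
    · exact (hint n hn).const_mul _
    · simp only [hT, chi_eq_zero_of_notMem hn, Int.cast_zero, zero_mul]
      exact integrable_zero _ _ _
  -- Integration over r gains a factor 1/pt n, so the L¹ norms of the terms are summable even though
  -- their exponential decay degenerates at r = 0.
  have hTsum : Summable fun n => ∫ r in Ioi (0 : ℝ), ‖T n r‖ := by
    refine Summable.of_nonneg_of_le (fun n => integral_nonneg fun _ => norm_nonneg _) (fun n => ?_)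
      (summable_inv_sq.mul_right (D * (Real.cos φ)⁻¹))
    have hD0 : 0 ≤ D := (norm_nonneg _).trans (hDb 1 one_pos)
    by_cases hn : n ∈ chiSupport
    · have hn0 : (0 : ℝ) < n := by exact_mod_cast pos_of_mem_chiSupport hn
      have hpos := mul_pos (pt_pos_of_mem hn) hcos
      calc ∫ r in Ioi (0 : ℝ), ‖T n r‖ ≤
            ∫ r in Ioi (0 : ℝ), D * Real.exp (-(pt n * Real.cos φ) * r) := by
            refine setIntegral_mono_on (hTint n).norm (integrableOn_exp_neg_mul hpos _)
              measurableSet_Ioi fun r hr => ?_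
            simp only [hT]
            rw [norm_mul, norm_chi_of_mem hn, one_mul]
            exact hb n hn r hr
        _ = (pt n)⁻¹ * (D * (Real.cos φ)⁻¹) := by
            rw [integral_const_mul, integral_exp_neg_mul hpos, mul_inv]; ring
        _ ≤ _ := by
            gcongr
            exact sq_le_pt n
    · simp only [hT, chi_eq_zero_of_notMem hn, Int.cast_zero, zero_mul, norm_zero, integral_zero]
      positivity
  have heq : ∀ r : ℝ, 0 < r →
      etaKernel (Complex.exp s) (r * Complex.exp (Complex.I * φ)) = ∑' n, T n r := by
    intro r hr
    have hre : 0 < ((r : ℂ) * Complex.exp (Complex.I * φ)).re := by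
      rw [ray_re]; exact mul_pos hr hcos
    rw [etaKernel, ← (hasSum_eta hre).tsum_eq, ← tsum_mul_right]
    refine tsum_congr fun n => ?_
    simp only [hT]
    push_cast
    ring
  have hmeas : AEStronglyMeasurable (fun r : ℝ => etaKernel (Complex.exp s)
      (r * Complex.exp (Complex.I * φ))) (volume.restrict (Ioi 0)) := by
    refine aestronglyMeasurable_ray fun r hr => ?_
    have hre : 0 < ((r : ℂ) * Complex.exp (Complex.I * φ)).re := by
      rw [ray_re]; exact mul_pos hr hcos
    unfold etaKernel
    refine ContinuousAt.mul ?_ (ContinuousAt.cpow (by fun_prop) continuousAt_const (hslit r hr))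
    have him : 0 < (2 * π * Complex.I * (r * Complex.exp (Complex.I * φ))).im := by
      rw [show 2 * π * Complex.I * (r * Complex.exp (Complex.I * φ)) =
        ((2 * π : ℝ) : ℂ) * (Complex.I * (r * Complex.exp (Complex.I * φ))) by push_cast; ring,
        Complex.im_ofReal_mul, Complex.I_mul_im]
      have := Real.pi_pos
      positivity
    exact ContinuousAt.comp (f := fun z => 2 * π * Complex.I * z)
      (ModularForm.differentiableAt_eta_of_mem_upperHalfPlaneSet him).continuousAt (by fun_prop)
  refine ⟨integrable_of_summable_integral_norm hTint hTsum hmeas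
    ((ae_restrict_iff' measurableSet_Ioi).2 (Eventually.of_forall heq)), ?_⟩
  have h := (hasSum_integral_of_summable_integral_norm hTint hTsum).mul_right
    (Complex.exp (Complex.I * φ))
  unfold rayInt
  convert! h using 1
  · ext n
    rw [← integral_mul_const, ← integral_const_mul]
    simp only [hT, mul_assoc]
  · rw [← integral_mul_const]
    exact setIntegral_congr_fun measurableSet_Ioi fun r hr => by simp only [heq r hr]

lemma coeffG_mul_rpow_neg_half (n : ℕ) :
    coeffG n * (2 / 3) * (pt n : ℂ) ^ ((-(1 / 2) : ℝ) : ℂ) = √3 * chi n := by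
  rcases Nat.eq_zero_or_pos n with rfl | hn
  · simp [coeffG, chi]
  have hn' : (n : ℝ) ≠ 0 := by exact_mod_cast hn.ne'
  have h6 : √6 = √2 * √3 := by rw [← Real.sqrt_mul (by norm_num)]; norm_num
  have h2 : √2 ^ 2 = 2 := Real.sq_sqrt (by norm_num)
  have : 3 * π / (2 * √2) * chi n * n * (2 / 3) * pt n ^ (-(1 / 2) : ℝ) = √3 * chi n := by
    rw [pt_rpow, show (2 * -(1 / 2) : ℝ) = -1 by norm_num, Real.rpow_neg_one, h6]
    have := Real.pi_pos.ne'
    field_simp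
  rw [← Complex.ofReal_cpow (pt_pos hn).le, coeffG]
  have h := congrArg (fun t : ℝ => (t : ℂ)) this
  push_cast at h ⊢
  exact h

/-- Term by term, integration by parts leaves -⅔ cₙ A^{-3/2}, which sum to -1 by `hasSum_boundary`,
plus ⅔ cₙ x times the integral with exponent -3/2. The substitution z = xp/A makes the latter √3
χ(n) times the integral of e^{-Az}(1 - z/x)^{-3/2}. -/
lemma one_add_rayInt_eq {s : ℂ} {θ : ℝ} (hθ : θ ∈ Ioo 0 (2 * π)) (hs : |s.im + θ| < π / 2) :
    1 + rayInt (fun p => Complex.exp (-Complex.exp s * p) * G p) θ =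
      √3 * rayInt (etaKernel (Complex.exp s)) (s.im + θ) := by
  have hX : 0 < (Complex.exp s * Complex.exp (Complex.I * θ)).re := by
    rw [exp_mul_exp_I_re]
    exact mul_pos (Real.exp_pos _) (cos_pos_of_abs_lt hs)
  have h1 := (hasSum_rayInt_termG hθ hX).add hasSum_boundary
  have h2 := (rayIntegrable_etaKernel_and_hasSum hθ hs).2.mul_left (√3 : ℂ)
  rw [add_comm]
  refine HasSum.unique h1 ?_
  convert! h2 using 1
  ext n
  by_cases hn : n ∈ chiSupport
  · have hA := pt_pos_of_mem hn
    have e1 := rayInt_power_parts (b := -(3 / 2)) hA hθ (by norm_num) hX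
    have e2 := rayInt_power_subst (s := s) (b := -(3 / 2)) hA hθ
    have e3 := coeffG_mul_rpow_neg_half n
    have e4 : rayInt (fun p => Complex.exp (-Complex.exp s * p) * termG n p) θ = coeffG n *
        rayInt (fun p => Complex.exp (-Complex.exp s * p) *
          ((pt n : ℂ) - p) ^ ((-(3 / 2) - 1 : ℝ) : ℂ)) θ := by
      unfold rayInt
      rw [← integral_const_mul]
      refine setIntegral_congr_fun measurableSet_Ioi fun r hr => ?_
      simp only [termG]
      rw [show ((-(3 / 2) - 1 : ℝ) : ℂ) = -(5 / 2) by push_cast; norm_num]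
      ring
    rw [show (-(3 / 2) + 1 : ℝ) = -(1 / 2) by norm_num] at e2
    rw [e2] at e1
    rw [e4]
    have e5 : (pt n : ℂ) ^ ((-(3 / 2) : ℝ) : ℂ) = (pt n : ℂ) ^ (-(3 / 2) : ℂ) := by
      congr 1; push_cast; rfl
    rw [e5] at e1
    generalize rayInt (fun p => Complex.exp (-Complex.exp s * p) *
          ((pt n : ℂ) - p) ^ ((-(3 / 2) - 1 : ℝ) : ℂ)) θ = I1 at *
    generalize rayInt (fun z => Complex.exp (-(pt n : ℂ) * z) *
        (1 - z / Complex.exp s) ^ ((-(3 / 2) : ℝ) : ℂ)) (s.im + θ) = I2 at *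
    push_cast at e1 e3 ⊢
    linear_combination (-2 / 3 * coeffG n) * e1 + I2 * e3
  · have : ∀ p, termG n p = 0 := fun p => termG_eq_zero hn p
    simp [this, rayInt, coeffG_eq_zero hn, chi_eq_zero_of_notMem hn]

lemma sumRight_eq_eta {s : ℂ} {ε : ℝ} (hε : ε ∈ Ioo 0 (2 * π)) (hs : |s.im + ε| < π / 2) :
    sumRight s = √3 * rayInt (etaKernel (Complex.exp s)) (s.im + ε) := by
  rw [sumRight_eq hε hs, one_add_rayInt_eq hε hs]

lemma conj_eta {z : ℂ} (hz : 0 < z.re) :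
    starRingEnd ℂ (ModularForm.eta (2 * π * Complex.I * z)) =
      ModularForm.eta (2 * π * Complex.I * starRingEnd ℂ z) := by
  have h1 := Complex.hasSum_conj'.2 (hasSum_eta hz)
  have h2 := hasSum_eta (z := starRingEnd ℂ z) (by simpa using hz)
  refine h1.unique ?_
  convert! h2 using 1
  ext n
  rw [map_mul, map_intCast, ← Complex.exp_conj, map_mul, map_neg, Complex.conj_ofReal]

lemma conj_etaKernel {s : ℂ} {ε : ℝ} (hε : ε ∈ Ioo 0 (2 * π)) (hs : |s.im + ε| < π / 2) {r : ℝ}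
    (hr : 0 < r) : etaKernel (starRingEnd ℂ (Complex.exp s))
      (r * Complex.exp (Complex.I * (-(s.im + ε) : ℝ))) =
      starRingEnd ℂ (etaKernel (Complex.exp s) (r * Complex.exp (Complex.I * (s.im + ε : ℝ)))) := by
  have hre : 0 < ((r : ℂ) * Complex.exp (Complex.I * (s.im + ε : ℝ))).re := by
    rw [ray_re]; exact mul_pos hr (cos_pos_of_abs_lt hs)
  have hslit : 1 - (r * Complex.exp (Complex.I * (s.im + ε : ℝ))) / Complex.exp s ∈
      Complex.slitPlane := by
    rw [exp_mul_ray]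
    have := sub_ray_mem_slitPlane one_pos (r := r / Real.exp s.re) (by positivity) hε
    rwa [Complex.ofReal_one] at this
  have h := conj_cpow_ofReal hslit (-(3 / 2))
  rw [show ((-(3 / 2) : ℝ) : ℂ) = -(3 / 2) by push_cast; rfl] at h
  rw [etaKernel, etaKernel, map_mul, conj_eta hre, conj_ray]
  rw [← conj_ray] at *
  rw [map_sub, map_div₀, map_one] at h
  rw [← h]

lemma sumLeft_eq_eta {s : ℂ} {ε : ℝ} (hε : ε ∈ Ioo 0 (2 * π)) (hs : |s.im - ε| < π / 2) :
    RayIntegrable (etaKernel (Complex.exp s)) (s.im - ε) ∧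
      sumLeft s = √3 * rayInt (etaKernel (Complex.exp s)) (s.im - ε) := by
  have h' : |(starRingEnd ℂ s).im + ε| < π / 2 := by
    rwa [Complex.conj_im, neg_add_eq_sub, abs_sub_comm]
  have e : s.im - ε = -((starRingEnd ℂ s).im + ε) := by rw [Complex.conj_im]; ring
  have hc : ∀ r : ℝ, 0 < r → etaKernel (Complex.exp s)
      (r * Complex.exp (Complex.I * (-((starRingEnd ℂ s).im + ε) : ℝ))) =
      starRingEnd ℂ (etaKernel (Complex.exp (starRingEnd ℂ s))
        (r * Complex.exp (Complex.I * ((starRingEnd ℂ s).im + ε : ℝ)))) := by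
    intro r hr
    rw [← conj_etaKernel hε h' hr, ← Complex.exp_conj, Complex.conj_conj]
  rw [e]
  refine ⟨(rayIntegrable_etaKernel_and_hasSum hε h').1.conj hc, ?_⟩
  rw [sumLeft, sumRight_eq_eta hε h', rayInt_conj _ hc, map_mul, Complex.conj_ofReal]

/-! ### The difference of the lateral sums -/

/-- The ray at angle -ε is written with angle 2π - ε so that the estimates on (0, 2π) apply to it.
-/
lemma rayInt_two_pi_sub (f : ℂ → ℂ) (θ : ℝ) : rayInt f (2 * π - θ) = rayInt f (-θ) := by
  have : Complex.exp (Complex.I * (2 * π - θ : ℝ)) = Complex.exp (Complex.I * (-θ : ℝ)) := by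
    rw [show Complex.I * (2 * π - θ : ℝ) = Complex.I * (-θ : ℝ) + 2 * π * Complex.I by
      push_cast; ring, Complex.exp_add, Complex.exp_two_pi_mul_I, mul_one]
  simp only [rayInt, this]

lemma intervalIntegrable_norm_cpow_neg_half (A a b : ℝ) :
    IntervalIntegrable (fun r : ℝ => |A - r| ^ (-(1 / 2) : ℝ)) volume a b := by
  have h := (intervalIntegral.intervalIntegrable_cpow' (a := A - a) (b := A - b)
    (r := ((-(1 / 2) : ℝ) : ℂ)) (by rw [Complex.ofReal_re]; norm_num)).norm
  have h2 := h.comp_sub_left A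
  simp only [sub_sub_cancel] at h2
  refine h2.congr fun r _ => ?_
  simp only [Complex.norm_cpow_real, Complex.norm_real, Real.norm_eq_abs]

lemma integrableOn_abs_rpow_mul_exp {A κ : ℝ} (hA : 0 < A) (hκ : 0 < κ) :
    IntegrableOn (fun r : ℝ => |A - r| ^ (-(1 / 2) : ℝ) * Real.exp (-κ * r)) (Ioi 0) := by
  rw [← Ioc_union_Ioi_eq_Ioi (by linarith : (0 : ℝ) ≤ A + 1)]
  have hm : Measurable fun r : ℝ => |A - r| ^ (-(1 / 2) : ℝ) * Real.exp (-κ * r) := by fun_prop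
  refine IntegrableOn.union ?_ ?_
  · have h := (intervalIntegrable_iff_integrableOn_Ioc_of_le (by linarith : (0 : ℝ) ≤ A + 1)).1
      (intervalIntegrable_norm_cpow_neg_half A 0 (A + 1))
    refine h.mono' hm.aestronglyMeasurable ?_
    refine (ae_restrict_iff' measurableSet_Ioc).2 (Eventually.of_forall fun r hr => ?_)
    rw [Real.norm_of_nonneg (by positivity)]
    refine mul_le_of_le_one_right (by positivity) (Real.exp_le_one_iff.2 ?_)
    nlinarith [hr.1]
  · refine ((integrableOn_exp_neg_mul hκ 1).mono_set (Ioi_subset_Ioi (by linarith))).mono'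
      hm.aestronglyMeasurable ?_
    refine (ae_restrict_iff' measurableSet_Ioi).2 (Eventually.of_forall fun r hr => ?_)
    rw [Real.norm_of_nonneg (by positivity)]
    gcongr
    have hr' : A + 1 < r := hr
    refine Real.rpow_le_one_of_one_le_of_nonpos ?_ (by norm_num)
    rw [abs_sub_comm]
    exact le_trans (by linarith) (le_abs_self _)

lemma abs_sub_le_norm_sub_ray (A : ℝ) {r : ℝ} (hr : 0 ≤ r) (θ : ℝ) :
    |A - r| ≤ ‖(A : ℂ) - r * Complex.exp (Complex.I * θ)‖ + (|A| - A) := by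
  have h := abs_norm_sub_norm_le (A : ℂ) (r * Complex.exp (Complex.I * θ))
  rw [norm_mul, norm_exp_I_mul, mul_one, Complex.norm_real, Complex.norm_real, Real.norm_eq_abs,
    Real.norm_eq_abs, abs_of_nonneg hr] at h
  rcases le_total 0 A with hA | hA
  · rw [abs_of_nonneg hA] at *; linarith
  · rw [abs_of_nonpos hA] at *
    rw [abs_of_nonpos (by linarith)]
    linarith [le_abs_self (-A - r), neg_abs_le (-A - r)]

/-- The path of integration may be moved onto the cut from below if the singularity is
integrable. -/
lemma rayInt_neg_half_eq_integral {X : ℂ} {A κ a : ℝ} (hA : 0 < A) (hκ : 0 < κ)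
    (ha : a ∈ Ioo 0 (2 * π))
    (hX : ∀ θ ∈ Icc a (2 * π), κ ≤ (X * Complex.exp (Complex.I * θ)).re) :
    rayInt (fun p => Complex.exp (-X * p) * ((A : ℂ) - p) ^ ((-(1 / 2) : ℝ) : ℂ)) a =
      ∫ r in Ioi (0 : ℝ), Complex.exp (-X * r) * ((A : ℂ) - r) ^ ((-(1 / 2) : ℝ) : ℂ) := by
  -- Angles increasing to 2π. All the corresponding ray integrals are equal, and the limit on the
  -- cut is taken by dominated convergence with the majorant |A - r|^{-1/2} e^{-κr}.
  set u : ℕ → ℝ := fun m => 2 * π - (2 * π - a) * (1 / ((m : ℝ) + 1)) with hu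
  have hinv : ∀ m : ℕ, 0 < 1 / ((m : ℝ) + 1) ∧ 1 / ((m : ℝ) + 1) ≤ 1 := fun m => by
    refine ⟨by positivity, ?_⟩
    rw [div_le_one (by positivity)]
    linarith [(Nat.cast_nonneg m : (0 : ℝ) ≤ m)]
  have hum : ∀ m, u m ∈ Ico a (2 * π) := fun m => by
    have := hinv m
    have h2 : 0 < 2 * π - a := by linarith [ha.2]
    constructor <;> simp only [hu] <;> nlinarith
  have hulim : Tendsto u atTop (𝓝 (2 * π)) := by
    have := (tendsto_one_div_add_atTop_nhds_zero_nat (𝕜 := ℝ)).const_mul (2 * π - a)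
    have h := (tendsto_const_nhds (x := 2 * π)).sub this
    rw [mul_zero, sub_zero] at h
    exact h
  have hmem : ∀ m, u m ∈ Ioo 0 (2 * π) := fun m => ⟨ha.1.trans_le (hum m).1, (hum m).2⟩
  have hrot : ∀ m, rayInt (fun p => Complex.exp (-X * p) * ((A : ℂ) - p) ^ ((-(1 / 2) : ℝ) : ℂ)) a =
      rayInt (fun p => Complex.exp (-X * p) * ((A : ℂ) - p) ^ ((-(1 / 2) : ℝ) : ℂ)) (u m) := by
    intro m
    obtain ⟨θ₁, hθ₁, h1⟩ := isCompact_Icc.exists_isMinOn (nonempty_Icc.2 (hum m).1)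
      (f := fun θ : ℝ => |Real.sin (θ / 2)|) (by fun_prop)
    have hmem' : ∀ θ ∈ Icc a (u m), θ ∈ Ioo 0 (2 * π) := fun θ hθ =>
      ⟨ha.1.trans_le hθ.1, hθ.2.trans_lt (hum m).2⟩
    have hs0 := sin_half_pos (hmem' θ₁ hθ₁)
    refine rayInt_eq_rayInt (M := (A * |Real.sin (θ₁ / 2)|) ^ (-(1 / 2) : ℝ)) (hum m).1 hκ
      (fun r hr θ hθ => DifferentiableAt.mul (by fun_prop) (DifferentiableAt.cpow_const
        (by fun_prop) (sub_ray_mem_slitPlane hA hr.le (hmem' θ hθ)))) fun r hr θ hθ => ?_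
    refine (norm_power_integrand_le hA hr.le (hmem' θ hθ) (by norm_num)).trans ?_
    have h2 : |Real.sin (θ₁ / 2)| ≤ |Real.sin (θ / 2)| := h1 hθ
    refine mul_le_mul (Real.rpow_le_rpow_of_nonpos (by positivity) (by gcongr) (by norm_num))
      (Real.exp_le_exp.2 ?_) (Real.exp_pos _).le (by positivity)
    have := hX θ ⟨hθ.1, hθ.2.trans (hum m).2.le⟩
    nlinarith
  have h0 : Tendsto (fun m => rayInt (fun p => Complex.exp (-X * p) *
      ((A : ℂ) - p) ^ ((-(1 / 2) : ℝ) : ℂ)) (u m)) atTop (𝓝 (rayInt (fun p =>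
        Complex.exp (-X * p) * ((A : ℂ) - p) ^ ((-(1 / 2) : ℝ) : ℂ)) a)) :=
    tendsto_const_nhds.congr hrot
  refine tendsto_nhds_unique h0 ?_
  unfold rayInt
  have hne : ∀ᵐ r ∂(volume.restrict (Ioi (0 : ℝ))), r ≠ A := by
    refine ae_restrict_of_ae ?_
    simp [ae_iff]
  refine tendsto_integral_of_dominated_convergence
    (fun r => |A - r| ^ (-(1 / 2) : ℝ) * Real.exp (-κ * r)) (fun m => ?_)
    (integrableOn_abs_rpow_mul_exp hA hκ) (fun m => ?_) ?_
  · refine (aestronglyMeasurable_ray (f := fun p => Complex.exp (-X * p) *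
      ((A : ℂ) - p) ^ ((-(1 / 2) : ℝ) : ℂ)) fun r hr => ?_).mul_const _
    exact ContinuousAt.mul (by fun_prop) (ContinuousAt.cpow (by fun_prop) continuousAt_const
      (sub_ray_mem_slitPlane hA hr.le (hmem m)))
  · filter_upwards [hne, ae_restrict_mem measurableSet_Ioi] with r hr hr0
    have hr0' : 0 < r := hr0
    have hX' := hX (u m) ⟨(hum m).1, (hum m).2.le⟩
    rw [norm_mul, norm_exp_I_mul, mul_one, norm_mul, norm_exp_neg_mul_ray, mul_comm,
      Complex.norm_cpow_real]
    have h1 := abs_sub_le_norm_sub_ray A hr0'.le (u m)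
    rw [abs_of_pos hA, sub_self, add_zero] at h1
    refine mul_le_mul (Real.rpow_le_rpow_of_nonpos (abs_pos.2 (sub_ne_zero.2 hr.symm)) h1
      (by norm_num)) (Real.exp_le_exp.2 (by nlinarith)) (Real.exp_pos _).le (by positivity)
  · filter_upwards [hne, ae_restrict_mem measurableSet_Ioi] with r hr hr0
    have hr0' : 0 < r := hr0
    have hE : Tendsto (fun m => Complex.exp (Complex.I * (u m : ℝ))) atTop (𝓝 1) := by
      have : Tendsto (fun θ : ℝ => Complex.exp (Complex.I * θ)) (𝓝 (2 * π))
          (𝓝 (Complex.exp (Complex.I * (2 * π : ℝ)))) := Continuous.tendsto (by fun_prop) _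
      rw [show Complex.I * (2 * π : ℝ) = 2 * π * Complex.I by push_cast; ring,
        Complex.exp_two_pi_mul_I] at this
      exact this.comp hulim
    have hp : Tendsto (fun m => (r : ℂ) * Complex.exp (Complex.I * (u m : ℝ))) atTop (𝓝 r) := by
      simpa using hE.const_mul (r : ℂ)
    have h1 : Tendsto (fun m => Complex.exp (-X * (r * Complex.exp (Complex.I * (u m : ℝ)))))
        atTop (𝓝 (Complex.exp (-X * r))) :=
      (Complex.continuous_exp.tendsto _).comp (hp.const_mul (-X))
    have hz : Tendsto (fun m => (A : ℂ) - r * Complex.exp (Complex.I * (u m : ℝ))) atTop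
        (𝓝 ((A : ℂ) - r)) := tendsto_const_nhds.sub hp
    have h2 : Tendsto (fun m => ((A : ℂ) - r * Complex.exp (Complex.I * (u m : ℝ))) ^
        ((-(1 / 2) : ℝ) : ℂ)) atTop (𝓝 (((A : ℂ) - r) ^ ((-(1 / 2) : ℝ) : ℂ))) := by
      have hne0 : (A : ℂ) - r ≠ 0 := by
        rw [sub_ne_zero]; exact_mod_cast hr.symm
      have hlog : Tendsto (fun m => Complex.log
          ((A : ℂ) - r * Complex.exp (Complex.I * (u m : ℝ)))) atTop
            (𝓝 (Complex.log ((A : ℂ) - r))) := by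
        rcases lt_or_gt_of_ne hr with hlt | hgt
        · refine (continuousAt_clog ?_).tendsto.comp hz
          rw [← Complex.ofReal_sub]
          exact Complex.ofReal_mem_slitPlane.2 (by linarith)
        -- For r > A the limit lies on the branch cut, where the principal logarithm is continuous
        -- only from the closed upper half-plane. The approach is from that side since sin is
        -- nonpositive on (π, 2π).
        · refine (Complex.continuousWithinAt_log_of_re_neg_of_im_zero (z := (A : ℂ) - r)
            (by simpa using hgt) (by simp)).tendsto.comp
            (tendsto_nhdsWithin_iff.2 ⟨hz, ?_⟩)
          have hev : ∀ᶠ m in atTop, π < u m := hulim.eventually (lt_mem_nhds (by linarith [Real.pi_pos]))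
          filter_upwards [hev] with m hm
          have hsin : Real.sin (u m) ≤ 0 := by
            rw [← Real.sin_sub_two_pi]
            exact (Real.sin_neg_of_neg_of_neg_pi_lt (by linarith [(hum m).2]) (by linarith)).le
          simp only [Complex.sub_im, Complex.ofReal_im, Complex.im_ofReal_mul]
          rw [mul_comm Complex.I, Complex.exp_ofReal_mul_I_im]
          nlinarith
      have hne' : ∀ m, (A : ℂ) - r * Complex.exp (Complex.I * (u m : ℝ)) ≠ 0 := fun m =>
        Complex.slitPlane_ne_zero (sub_ray_mem_slitPlane hA hr0'.le (hmem m))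
      simp only [Complex.cpow_def_of_ne_zero hne0, Complex.cpow_def_of_ne_zero (hne' _)]
      exact (Complex.continuous_exp.tendsto _).comp (hlog.mul_const _)
    simpa using (h1.mul h2).mul hE

/-- The substitution of v² for v gives the Gaussian integral over a half-line. -/
lemma integral_exp_mul_rpow_neg_half {X : ℂ} (hX : 0 < X.re) :
    ∫ v in Ioi (0 : ℝ), Complex.exp (-X * v) * ((v ^ (-(1 / 2) : ℝ) : ℝ) : ℂ) =
      (π / X) ^ (1 / 2 : ℂ) := by
  have h := integral_comp_rpow_Ioi_of_pos (g := fun v : ℝ => Complex.exp (-X * v) *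
    ((v ^ (-(1 / 2) : ℝ) : ℝ) : ℂ)) (p := 2) two_pos
  rw [← h, show (π / X) ^ (1 / 2 : ℂ) = 2 * ((π / X) ^ (1 / 2 : ℂ) / 2) by ring,
    ← integral_gaussian_complex_Ioi hX, ← integral_const_mul]
  refine setIntegral_congr_fun measurableSet_Ioi fun v hv => ?_
  have hv' : 0 < v := hv
  have e1 : ((v ^ (2 : ℝ)) ^ (-(1 / 2) : ℝ)) = v⁻¹ := by
    rw [← Real.rpow_mul hv'.le]; norm_num [Real.rpow_neg_one]
  simp only [Complex.real_smul, e1, show (2 : ℝ) - 1 = 1 by norm_num, Real.rpow_one]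
  have : (v : ℂ) ≠ 0 := by exact_mod_cast hv'.ne'
  rw [Real.rpow_two]
  push_cast
  field_simp

lemma conj_sub_self_cpow_neg_half {t : ℝ} (ht : t ≠ 0) :
    starRingEnd ℂ ((t : ℂ) ^ ((-(1 / 2) : ℝ) : ℂ)) - (t : ℂ) ^ ((-(1 / 2) : ℝ) : ℂ) =
      if t < 0 then 2 * Complex.I * (((-t) ^ (-(1 / 2) : ℝ) : ℝ) : ℂ) else 0 := by
  split_ifs with h
  · rw [Complex.ofReal_cpow_of_nonpos h.le, ← Complex.ofReal_neg, ← Complex.ofReal_cpow (by linarith),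
      map_mul, Complex.conj_ofReal, ← Complex.exp_conj]
    have e : π * Complex.I * ((-(1 / 2) : ℝ) : ℂ) = -(π / 2 * Complex.I) := by push_cast; ring
    have e2 : starRingEnd ℂ (-(π / 2 * Complex.I)) = π / 2 * Complex.I := by
      rw [map_neg, map_mul, map_div₀, Complex.conj_ofReal, Complex.conj_I, map_ofNat]; ring
    rw [e, e2, Complex.exp_neg, Complex.exp_pi_div_two_mul_I]
    simp
    ring
  · have ht' : 0 < t := lt_of_le_of_ne (not_lt.1 h) ht.symm
    rw [← Complex.ofReal_cpow ht'.le, Complex.conj_ofReal, sub_self]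

lemma exp_mul_I_re_pos {s : ℂ} {θ : ℝ} (h : |s.im + θ| < π / 2) :
    0 < (Complex.exp s * Complex.exp (Complex.I * θ)).re := by
  rw [exp_mul_exp_I_re]
  exact mul_pos (Real.exp_pos _) (cos_pos_of_abs_lt h)

lemma integrableOn_cut {X : ℂ} (hX : 0 < X.re) {A : ℝ} (hA : 0 < A) :
    IntegrableOn (fun r : ℝ => Complex.exp (-X * r) * ((A : ℂ) - r) ^ ((-(1 / 2) : ℝ) : ℂ))
      (Ioi 0) := by
  refine (integrableOn_abs_rpow_mul_exp hA hX).mono' (by fun_prop) (ae_of_all _ fun r => ?_)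
  rw [norm_mul, Complex.norm_cpow_real, mul_comm, Complex.norm_exp, ← Complex.ofReal_sub,
    Complex.norm_real, Real.norm_eq_abs, mul_comm (-X), Complex.re_ofReal_mul, Complex.neg_re,
    mul_comm r]

/-- Hankel's integral. -/
lemma rayInt_half_sub_eq {s : ℂ} {A ε : ℝ} (hA : 0 < A) (hε : 0 < ε) (hs : |s.im| + ε < π / 2) :
    rayInt (fun p => Complex.exp (-Complex.exp s * p) * ((A : ℂ) - p) ^ ((-(1 / 2) : ℝ) : ℂ)) ε -
      rayInt (fun p => Complex.exp (-Complex.exp s * p) * ((A : ℂ) - p) ^ ((-(1 / 2) : ℝ) : ℂ)) (-ε)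
      = 2 * Complex.I * (Complex.exp (-(A : ℂ) * Complex.exp s) *
        (π / Complex.exp s) ^ (1 / 2 : ℂ)) := by
  have habs := abs_nonneg s.im
  have key : ∀ w : ℂ, |w.im| + ε < π / 2 →
      rayInt (fun p => Complex.exp (-Complex.exp w * p) * ((A : ℂ) - p) ^ ((-(1 / 2) : ℝ) : ℂ)) (-ε)
      = ∫ r in Ioi (0 : ℝ), Complex.exp (-Complex.exp w * r) *
          ((A : ℂ) - r) ^ ((-(1 / 2) : ℝ) : ℂ) := by
    intro w hw
    rw [← rayInt_two_pi_sub]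
    have hcos : 0 < Real.cos (|w.im| + ε) :=
      Real.cos_pos_of_mem_Ioo ⟨by have := abs_nonneg w.im; linarith [Real.pi_pos], hw⟩
    refine rayInt_neg_half_eq_integral hA (mul_pos (Real.exp_pos w.re) hcos)
      ⟨by linarith [abs_nonneg w.im, Real.pi_pos], by linarith⟩ fun θ hθ => ?_
    rw [exp_mul_exp_I_re, show Real.cos (w.im + θ) = Real.cos |w.im + θ - 2 * π| by
      rw [Real.cos_abs, Real.cos_sub_two_pi]]
    refine mul_le_mul_of_nonneg_left (Real.cos_le_cos_of_nonneg_of_le_pi (abs_nonneg _)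
      (by linarith [Real.pi_pos]) ?_) (Real.exp_pos _).le
    rw [abs_le]
    constructor <;> linarith [hθ.1, hθ.2, neg_abs_le w.im, le_abs_self w.im]
  have hre : ∀ w : ℂ, |w.im| + ε < π / 2 → 0 < (Complex.exp w).re := by
    intro w hw
    rw [Complex.exp_re]
    exact mul_pos (Real.exp_pos _) (cos_pos_of_abs_lt (by linarith))
  have hs' : |(starRingEnd ℂ s).im| + ε < π / 2 := by rwa [Complex.conj_im, abs_neg]
  -- The value on the upper side of the cut is obtained from the lower side at the conjugate point,
  -- so the two integrands differ only by conjugating the power.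
  have hup : rayInt (fun p => Complex.exp (-Complex.exp s * p) *
      ((A : ℂ) - p) ^ ((-(1 / 2) : ℝ) : ℂ)) ε = ∫ r in Ioi (0 : ℝ), Complex.exp (-Complex.exp s * r) *
        starRingEnd ℂ (((A : ℂ) - r) ^ ((-(1 / 2) : ℝ) : ℂ)) := by
    have h := rayInt_conj (f := fun p => Complex.exp (-Complex.exp (starRingEnd ℂ s) * p) *
      ((A : ℂ) - p) ^ ((-(1 / 2) : ℝ) : ℂ)) (g := fun p => Complex.exp (-Complex.exp s * p) *
      ((A : ℂ) - p) ^ ((-(1 / 2) : ℝ) : ℂ)) (-ε) fun r hr => by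
        have hmem : ε ∈ Ioo 0 (2 * π) := ⟨hε, by linarith [Real.pi_pos]⟩
        have := conj_cpow_ofReal (sub_ray_mem_slitPlane hA hr.le hmem) (-(1 / 2))
        rw [map_sub, Complex.conj_ofReal, conj_ray] at this
        simp only [neg_neg]
        rw [← this, map_mul, Complex.conj_conj, ← Complex.exp_conj, map_mul, map_neg,
          ← Complex.exp_conj, Complex.conj_conj, conj_ray, neg_neg]
    rw [neg_neg] at h
    rw [h, key _ hs', ← integral_conj]
    refine setIntegral_congr_fun measurableSet_Ioi fun r _ => ?_
    simp only [map_mul]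
    rw [← Complex.exp_conj, map_mul, map_neg, ← Complex.exp_conj, Complex.conj_conj,
      Complex.conj_ofReal]
  have hint := integrableOn_cut (hre s hs) hA
  have hint' : IntegrableOn (fun r : ℝ => Complex.exp (-Complex.exp s * r) *
        starRingEnd ℂ (((A : ℂ) - r) ^ ((-(1 / 2) : ℝ) : ℂ))) (Ioi 0) := by
    refine hint.congr' ?_ (ae_of_all _ fun r => ?_)
    · have : Measurable fun r : ℝ => starRingEnd ℂ (((A : ℂ) - r) ^ ((-(1 / 2) : ℝ) : ℂ)) :=
        Complex.continuous_conj.measurable.comp (by fun_prop)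
      exact (Measurable.mul (by fun_prop) this).aestronglyMeasurable
    · simp
  rw [hup, key s hs, ← integral_sub hint' hint]
  have e : ∀ᵐ r ∂(volume : Measure ℝ), r ∈ Ioi (0 : ℝ) → Complex.exp (-Complex.exp s * r) *
        starRingEnd ℂ (((A : ℂ) - r) ^ ((-(1 / 2) : ℝ) : ℂ)) - Complex.exp (-Complex.exp s * r) *
        ((A : ℂ) - r) ^ ((-(1 / 2) : ℝ) : ℂ) = (Ioi A).indicator (fun r : ℝ =>
          Complex.exp (-Complex.exp s * r) *
            (2 * Complex.I * (((r - A) ^ (-(1 / 2) : ℝ) : ℝ) : ℂ))) r := by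
    have hne : ∀ᵐ r ∂(volume : Measure ℝ), r ≠ A := by simp [ae_iff]
    filter_upwards [hne] with r hr _
    have := conj_sub_self_cpow_neg_half (sub_ne_zero.2 hr.symm)
    rw [← mul_sub, ← Complex.ofReal_sub, this]
    by_cases h : A < r
    · rw [if_pos (by linarith), indicator_of_mem (mem_Ioi.2 h), neg_sub]
    · rw [if_neg (by linarith), indicator_of_notMem (show r ∉ Ioi A from h), mul_zero]
  rw [setIntegral_congr_ae measurableSet_Ioi e, setIntegral_indicator measurableSet_Ioi,
    Ioi_inter_Ioi, sup_of_le_right hA.le]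
  have hshift := (measurePreserving_add_right volume A).setIntegral_preimage_emb
    (measurableEmbedding_addRight A) (fun r : ℝ => Complex.exp (-Complex.exp s * r) *
            (2 * Complex.I * (((r - A) ^ (-(1 / 2) : ℝ) : ℝ) : ℂ))) (Ioi A)
  rw [preimage_add_const_Ioi, sub_self] at hshift
  rw [← hshift, ← integral_exp_mul_rpow_neg_half (hre s hs), ← integral_const_mul,
    ← integral_const_mul]
  refine setIntegral_congr_fun measurableSet_Ioi fun r _ => ?_
  simp only [add_sub_cancel_right]
  have : Complex.exp (-Complex.exp s * ((r + A : ℝ) : ℂ)) =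
      Complex.exp (-(A : ℂ) * Complex.exp s) * Complex.exp (-Complex.exp s * r) := by
    rw [← Complex.exp_add]; congr 1; push_cast; ring
  rw [this]
  ring

/-- Two integrations by parts reach the exponent -1/2, for which the ray can be moved onto the cut.
The boundary terms do not depend on θ and cancel in the difference of the lateral sums. -/
lemma rayInt_termG_eq {X : ℂ} {θ : ℝ} (hθ : θ ∈ Ioo 0 (2 * π))
    (hX : 0 < (X * Complex.exp (Complex.I * θ)).re) {n : ℕ} (hn : n ∈ chiSupport) :
    rayInt (fun p => Complex.exp (-X * p) * termG n p) θ = coeffG n *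
      (-2 / 3 * (pt n : ℂ) ^ ((-(3 / 2) : ℝ) : ℂ) - 4 / 3 * X * (pt n : ℂ) ^ ((-(1 / 2) : ℝ) : ℂ) +
        4 / 3 * X ^ 2 * rayInt (fun p => Complex.exp (-X * p) *
          ((pt n : ℂ) - p) ^ ((-(1 / 2) : ℝ) : ℂ)) θ) := by
  have e1 := rayInt_power_parts (b := -(3 / 2)) (pt_pos_of_mem hn) hθ (by norm_num) hX
  have e2 := rayInt_power_parts (b := -(1 / 2)) (pt_pos_of_mem hn) hθ (by norm_num) hX
  have e4 : rayInt (fun p => Complex.exp (-X * p) * termG n p) θ = coeffG n *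
        rayInt (fun p => Complex.exp (-X * p) *
          ((pt n : ℂ) - p) ^ ((-(3 / 2) - 1 : ℝ) : ℂ)) θ := by
      unfold rayInt
      rw [← integral_const_mul]
      refine setIntegral_congr_fun measurableSet_Ioi fun r hr => ?_
      simp only [termG]
      rw [show ((-(3 / 2) - 1 : ℝ) : ℂ) = -(5 / 2) by push_cast; norm_num]
      ring
  rw [show (-(1 / 2) - 1 : ℝ) = -(3 / 2) by norm_num] at e2
  rw [e4]
  generalize rayInt (fun p => Complex.exp (-X * p) *
          ((pt n : ℂ) - p) ^ ((-(3 / 2) - 1 : ℝ) : ℂ)) θ = I1 at *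
  generalize rayInt (fun p => Complex.exp (-X * p) *
          ((pt n : ℂ) - p) ^ ((-(3 / 2) : ℝ) : ℂ)) θ = I2 at *
  rw [Complex.ofReal_neg, Complex.ofReal_div] at e1 e2
  push_cast at e1 e2 ⊢
  linear_combination (-2 / 3 * coeffG n) * e1 + (-4 / 3 * coeffG n * X) * e2

lemma pi_mul_sq_mul_cpow {x : ℂ} (hx : 0 < x.re) :
    π * x ^ 2 * (π / x) ^ (1 / 2 : ℂ) = (π * x) ^ (3 / 2 : ℂ) := by
  have hx0 : x ≠ 0 := by rintro rfl; simp at hx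
  have hpi : (π : ℂ) ≠ 0 := by exact_mod_cast Real.pi_ne_zero
  set y : ℂ := π * x with hy
  have hy0 : y ≠ 0 := mul_ne_zero hpi hx0
  have hyre : 0 < y.re := by rw [hy, Complex.re_ofReal_mul]; exact mul_pos Real.pi_pos hx
  have harg : y.arg ≠ π := by
    have := abs_lt.1 (Complex.abs_arg_lt_pi_div_two_iff.2 (Or.inl hyre))
    linarith [Real.pi_pos]
  have e1 : (π / x : ℂ) = ((π ^ 2 : ℝ) : ℂ) * y⁻¹ := by
    rw [hy]; push_cast; field_simp
  have e2 : (((π ^ 2 : ℝ) : ℂ)) ^ (1 / 2 : ℂ) = π := by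
    have : (1 / 2 : ℂ) = ((1 / 2 : ℝ) : ℂ) := by push_cast; rfl
    rw [this, ← Complex.ofReal_cpow (by positivity), ← Real.sqrt_eq_rpow,
      Real.sqrt_sq Real.pi_pos.le]
  have e3 : y ^ (3 / 2 : ℂ) = y ^ 2 * (y ^ (1 / 2 : ℂ))⁻¹ := by
    rw [← Complex.cpow_neg, ← Complex.cpow_natCast, ← Complex.cpow_add _ _ hy0]
    norm_num
  rw [e1, ofReal_mul_cpow (by positivity) (inv_ne_zero hy0), e2, Complex.inv_cpow _ _ harg, e3, hy]
  ring

/-- Half of the difference of the lateral sums. -/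
noncomputable def lateralDiff (x : ℂ) : ℂ :=
  (sumRight (Complex.log x) - sumLeft (Complex.log x)) / 2

lemma abs_log_im_lt {x : ℂ} (hx : 0 < x.re) : |(Complex.log x).im| < π / 2 := by
  rw [Complex.log_im]
  exact Complex.abs_arg_lt_pi_div_two_iff.2 (Or.inl hx)

theorem hasSum_lateralDiff {x : ℂ} (hx : 0 < x.re) :
    HasSum (fun n : ℕ => Complex.I * √2 * (π * x) ^ (3 / 2 : ℂ) *
      ((chi n : ℂ) * (n : ℂ) * Complex.exp (-(pt n : ℂ) * x))) (lateralDiff x) := by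
  have hx0 : x ≠ 0 := by rintro rfl; simp at hx
  obtain ⟨s, hs⟩ : ∃ s, s = Complex.log x := ⟨_, rfl⟩
  have hxs : Complex.exp s = x := by rw [hs, Complex.exp_log hx0]
  have him : |s.im| < π / 2 := hs ▸ abs_log_im_lt hx
  set ε := (π / 2 - |s.im|) / 2 with hε
  have hε0 : 0 < ε := by linarith
  have hε1 : |s.im| + ε < π / 2 := by linarith
  have hmem : ε ∈ Ioo 0 (2 * π) := ⟨hε0, by linarith [abs_nonneg s.im, Real.pi_pos]⟩
  have hmem' : 2 * π - ε ∈ Ioo 0 (2 * π) := ⟨by linarith [hmem.2], by linarith⟩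
  have h1 : |s.im + ε| < π / 2 := by
    rw [abs_lt]; constructor <;> linarith [neg_abs_le s.im, le_abs_self s.im]
  have h2 : |s.im - ε| < π / 2 := by
    rw [abs_lt]; constructor <;> linarith [neg_abs_le s.im, le_abs_self s.im]
  have hX1 := exp_mul_I_re_pos h1
  have hX2 : 0 < (Complex.exp s * Complex.exp (Complex.I * (2 * π - ε : ℝ))).re := by
    rw [exp_mul_exp_I_re, show s.im + (2 * π - ε) = s.im - ε + 2 * π by ring, Real.cos_add_two_pi]
    exact mul_pos (Real.exp_pos _) (cos_pos_of_abs_lt h2)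
  have hsum := ((hasSum_rayInt_termG hmem hX1).sub (hasSum_rayInt_termG hmem' hX2)).div_const 2
  rw [lateralDiff, ← hs, sumRight_eq hmem h1, sumLeft_eq hmem h2, add_sub_add_left_eq_sub,
    ← rayInt_two_pi_sub _ ε]
  convert! hsum using 1
  ext n
  by_cases hn : n ∈ chiSupport
  · rw [rayInt_termG_eq hmem hX1 hn, rayInt_termG_eq hmem' hX2 hn]
    have h3 := rayInt_half_sub_eq (pt_pos_of_mem hn) hε0 hε1
    rw [← rayInt_two_pi_sub] at h3
    rw [hxs] at *
    have h4 := pi_mul_sq_mul_cpow hx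
    generalize rayInt (fun p => Complex.exp (-x * p) *
          ((pt n : ℂ) - p) ^ ((-(1 / 2) : ℝ) : ℂ)) ε = I1 at *
    generalize rayInt (fun p => Complex.exp (-x * p) *
          ((pt n : ℂ) - p) ^ ((-(1 / 2) : ℝ) : ℂ)) (2 * π - ε) = I2 at *
    have h5 : coeffG n * (4 / 3) = √2 * π * chi n * n := by
      have h2' : √2 ^ 2 = 2 := Real.sq_sqrt (by norm_num)
      have : 3 * π / (2 * √2) * (4 / 3) = √2 * π := by
        field_simp
        nlinarith
      have h := congrArg (fun t : ℝ => (t : ℂ)) this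
      push_cast at h
      rw [coeffG]
      push_cast
      linear_combination (chi n * n : ℂ) * h
    rw [← h4]
    linear_combination (-(1 / 2) * coeffG n * (4 / 3) * x ^ 2) * h3 - (Complex.I * x ^ 2 *
      Complex.exp (-(pt n : ℂ) * x) * (π / x) ^ (1 / 2 : ℂ)) * h5
  · have : ∀ p, termG n p = 0 := fun p => termG_eq_zero hn p
    simp [this, rayInt, chi_eq_zero_of_notMem hn]

lemma lateralDiff_eq {x : ℂ} (hx : 0 < x.re) :
    lateralDiff x = Complex.I * √2 * (π * x) ^ (3 / 2 : ℂ) *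
      etaTilde (2 * π * Complex.I * x) := by
  rw [← (hasSum_lateralDiff hx).tsum_eq, tsum_mul_left, etaTilde]
  congr 1
  refine tsum_congr fun n => ?_
  congr 2
  have hI : (Complex.I) ^ 2 = -1 := Complex.I_sq
  rw [pt]
  push_cast
  linear_combination (-(n : ℂ) ^ 2 * π ^ 2 * x / 6) * hI

/-! ### The natural boundary -/

/-- The lacunary series `∑ χ(n) n e^{-n²π²x/6}`. -/
noncomputable def lacunary (x : ℂ) : ℂ :=
  ∑' n : ℕ, (chi n : ℂ) * (n : ℂ) * Complex.exp (-(pt n : ℂ) * x)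

lemma norm_lacunary_term_le (n : ℕ) (x : ℂ) :
    ‖(chi n : ℂ) * (n : ℂ) * Complex.exp (-(pt n : ℂ) * x)‖ ≤
      (n : ℝ) ^ 1 * Real.exp (-(pt n * x.re)) := by
  rw [norm_mul, norm_mul, norm_exp_neg_pt_mul, Complex.norm_natCast, pow_one]
  gcongr
  exact mul_le_of_le_one_left (Nat.cast_nonneg n) (norm_chi_le n)

lemma summable_lacunary {x : ℂ} (hx : 0 < x.re) :
    Summable fun n : ℕ => (chi n : ℂ) * (n : ℂ) * Complex.exp (-(pt n : ℂ) * x) :=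
  Summable.of_norm_bounded (summable_pow_mul_exp_neg_pt hx 1) fun n => norm_lacunary_term_le n x

lemma lateralDiff_eq_lacunary {x : ℂ} (hx : 0 < x.re) :
    lateralDiff x = Complex.I * √2 * (π * x) ^ (3 / 2 : ℂ) * lacunary x := by
  rw [← (hasSum_lateralDiff hx).tsum_eq, tsum_mul_left, lacunary]

/-- The mean value inequality is applied first to g' and then to y ↦ g(y + L) - g(y). -/
lemma norm_second_difference_le {g g' g'' : ℝ → ℂ} {L M : ℝ} (hL : 0 ≤ L)
    (h1 : ∀ y, HasDerivAt g (g' y) y) (h2 : ∀ y, HasDerivAt g' (g'' y) y)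
    (hM : ∀ y ∈ Icc 0 (2 * L), ‖g'' y‖ ≤ M) :
    ‖g (2 * L) - 2 * g L + g 0‖ ≤ M * L * L := by
  have hd : ∀ y ∈ Icc 0 L, ‖g' (y + L) - g' y‖ ≤ M * L := by
    intro y hy
    have := (convex_Icc (0 : ℝ) (2 * L)).norm_image_sub_le_of_norm_hasDerivWithin_le
      (fun x _ => (h2 x).hasDerivWithinAt) hM (x := y) (y := y + L)
      ⟨hy.1, by linarith [hy.2]⟩ ⟨by linarith [hy.1], by linarith [hy.2]⟩
    rwa [add_sub_cancel_left, Real.norm_of_nonneg hL] at this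
  have := (convex_Icc (0 : ℝ) L).norm_image_sub_le_of_norm_hasDerivWithin_le
    (f := fun y => g (y + L) - g y) (f' := fun y => g' (y + L) - g' y)
    (fun x _ => (((h1 (x + L)).comp_add_const x L).sub (h1 x)).hasDerivWithinAt) hd
    (left_mem_Icc.2 hL) (right_mem_Icc.2 hL)
  rw [sub_zero, Real.norm_of_nonneg hL, zero_add] at this
  have e : g (2 * L) - 2 * g L + g 0 = g (L + L) - g L - (g L - g 0) := by rw [two_mul L]; ring
  rw [e]
  exact this

lemma sum_inv_sq_sub_le (n N : ℕ) :
    ∑ m ∈ Finset.range N, 1 / (((m : ℤ) - n : ℤ) : ℝ) ^ 2 ≤ ∑' k : ℤ, 1 / (k : ℝ) ^ 2 := by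
  have hinj : InjOn (fun m : ℕ => (m : ℤ) - n) (Finset.range N : Set ℕ) := fun a _ b _ h => by
    simpa using h
  rw [← Finset.sum_image (f := fun k : ℤ => 1 / (k : ℝ) ^ 2) hinj]
  exact (Real.summable_one_div_int_pow.2 one_lt_two).sum_le_tsum _ fun k _ => by positivity

/-- The gap pt m - pt n is π²/6 ≥ 1 times (m - n)(m + n), and (m + n)² ≥ m. For m = n both sides are
zero by the convention for division by zero. The resulting bound is independent of n after summation
over m. -/
lemma div_sq_pt_sub_le (m n : ℕ) :
    (m : ℝ) / (pt m - pt n) ^ 2 ≤ 1 / (((m : ℤ) - n : ℤ) : ℝ) ^ 2 := by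
  rcases eq_or_ne m n with rfl | hmn
  · simp
  have h0 : ((m : ℝ) - n) ^ 2 > 0 := by
    have : (m : ℝ) - n ≠ 0 := sub_ne_zero.2 (by exact_mod_cast hmn)
    positivity
  have hsum : (1 : ℝ) ≤ m + n := by
    have : 1 ≤ m + n := by omega
    exact_mod_cast this
  have e : (pt m - pt n) ^ 2 = (π ^ 2 / 6) ^ 2 * (((m : ℝ) - n) ^ 2 * (m + n) ^ 2) := by
    unfold pt; ring
  have hpi : 1 ≤ (π ^ 2 / 6) ^ 2 := one_le_pow₀ (by nlinarith [Real.pi_gt_three])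
  have hm0 : (0 : ℝ) ≤ m := Nat.cast_nonneg m
  have hn0 : (0 : ℝ) ≤ n := Nat.cast_nonneg n
  have hmm : (m : ℝ) ≤ (m + n) ^ 2 := by nlinarith
  push_cast
  rw [div_le_div_iff₀ (by rw [e]; positivity) h0, e, one_mul]
  calc (m : ℝ) * ((m : ℝ) - n) ^ 2 ≤ (m + n) ^ 2 * ((m : ℝ) - n) ^ 2 := by gcongr
    _ = 1 * (((m : ℝ) - n) ^ 2 * (m + n) ^ 2) := by ring
    _ ≤ _ := by gcongr

/-- If the lacunary series is bounded near a boundary point, then its coefficients are bounded. -/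
lemma coefficient_le_of_bounded {v L M : ℝ} (hL : 0 < L)
    (hb : ∀ t ∈ Ioo 0 L, ∀ y ∈ Icc 0 (2 * L), ‖lacunary ((t : ℂ) + (v + y : ℝ) * Complex.I)‖ ≤ M)
    {n : ℕ} (hn : n ∈ chiSupport) :
    n * L ^ 2 ≤ 2 * (M + 1) * L ^ 2 + 8 * ∑' k : ℤ, 1 / (k : ℝ) ^ 2 := by
  set K := ∑' k : ℤ, 1 / (k : ℝ) ^ 2 with hK
  have hA := pt_pos_of_mem hn
  -- Small enough that multiplication by e^{pt n · x}, with Re x = t, costs at most a factor 2.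
  set t : ℝ := min (L / 2) (Real.log 2 / pt n) with ht
  have hlog : 0 < Real.log 2 := Real.log_pos one_lt_two
  have ht0 : 0 < t := lt_min (by positivity) (by positivity)
  have htL : t < L := (min_le_left _ _).trans_lt (by linarith)
  have hexp : Real.exp (pt n * t) ≤ 2 := by
    rw [← Real.le_log_iff_exp_le two_pos]
    calc pt n * t ≤ pt n * (Real.log 2 / pt n) := by gcongr; exact min_le_right _ _
      _ = _ := by field_simp
  set x : ℝ → ℂ := fun y => (t : ℂ) + (v + y : ℝ) * Complex.I with hx
  have hxre : ∀ y, (x y).re = t := fun y => by simp [hx]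
  have hxd : ∀ y, HasDerivAt x Complex.I y := by
    intro y
    have h1 : HasDerivAt (fun y : ℝ => ((v + y : ℝ) : ℂ)) 1 y := by
      simpa using ((hasDerivAt_id y).const_add v).ofReal_comp
    have h := (h1.mul_const Complex.I).const_add (t : ℂ)
    rw [one_mul] at h
    exact h
  -- the partial sums approximate the series uniformly
  obtain ⟨N, hnN, hN⟩ : ∃ N, n < N ∧ ∀ y, ‖lacunary (x y) - ∑ m ∈ Finset.range N,
      (chi m : ℂ) * (m : ℂ) * Complex.exp (-(pt m : ℂ) * x y)‖ ≤ 1 := by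
    have hs := summable_pow_mul_exp_neg_pt ht0 1
    have h1 := (tendsto_sum_nat_add fun m : ℕ => (m : ℝ) ^ 1 * Real.exp (-(pt m * t)))
    obtain ⟨N, hN⟩ := ((h1.eventually (gt_mem_nhds one_pos)).and (eventually_gt_atTop n)).exists
    refine ⟨N, hN.2, fun y => ?_⟩
    have hsx := summable_lacunary (x := x y) (by rw [hxre]; exact ht0)
    rw [lacunary, ← hsx.sum_add_tsum_nat_add N, add_sub_cancel_left]
    refine (tsum_of_norm_bounded ((summable_nat_add_iff N).2 hs).hasSum fun m => ?_).trans hN.1.le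
    have := norm_lacunary_term_le (m + N) (x y)
    rwa [hxre] at this
  set c : ℕ → ℂ := fun m => (chi m : ℂ) * (m : ℂ) with hc
  set d : ℕ → ℂ := fun m => ((pt m - pt n : ℝ) : ℂ) with hd
  set S := (Finset.range N).erase n with hS
  -- After multiplication by e^{pt n · x} the n-th term of the partial sum is the constant c n and
  -- the rest is Φ''. The second antiderivative Φ gains 1/d m² and is bounded independently of n.
  -- The second difference with step L of c n · y²/2 is c n · L², so bounds for Φ and for Φ'' + c n
  -- bound c n.
  set Φ : ℝ → ℂ := fun y => ∑ m ∈ S, -(c m / d m ^ 2) * Complex.exp (-d m * x y) with hΦ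
  set Φ' : ℝ → ℂ := fun y => ∑ m ∈ S, (c m / d m) * Complex.I * Complex.exp (-d m * x y) with hΦ'
  set Φ'' : ℝ → ℂ := fun y => ∑ m ∈ S, c m * Complex.exp (-d m * x y) with hΦ''
  have hd0 : ∀ m ∈ S, d m ≠ 0 := by
    intro m hm
    have := (Finset.mem_erase.1 hm).1
    simp only [hd, Ne, Complex.ofReal_eq_zero, sub_eq_zero]
    exact fun h => this (pt_strictMono.injective h)
  have hde : ∀ m y, HasDerivAt (fun y => Complex.exp (-d m * x y))
      (Complex.exp (-d m * x y) * (-d m * Complex.I)) y := fun m y =>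
    ((hxd y).const_mul (-d m)).cexp
  have hΦd : ∀ y, HasDerivAt Φ (Φ' y) y := by
    intro y
    refine HasDerivAt.fun_sum fun m hm => ?_
    refine ((hde m y).const_mul _).congr_deriv ?_
    have := hd0 m hm
    field_simp
  have hΦd' : ∀ y, HasDerivAt Φ' (Φ'' y) y := by
    intro y
    refine HasDerivAt.fun_sum fun m hm => ?_
    refine ((hde m y).const_mul _).congr_deriv ?_
    have := hd0 m hm
    have hI : (Complex.I) ^ 2 = -1 := Complex.I_sq
    field_simp
    rw [hI]; ring
  have hq1 : ∀ y : ℝ, HasDerivAt (fun y : ℝ => c n * ((y : ℂ) ^ 2 / 2)) (c n * y) y := by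
    intro y
    have := (((hasDerivAt_id y).ofReal_comp.pow 2).div_const 2).const_mul (c n)
    refine this.congr_deriv ?_
    simp
  have hq2 : ∀ y : ℝ, HasDerivAt (fun y : ℝ => c n * (y : ℂ)) (c n) y := by
    intro y
    simpa using ((hasDerivAt_id y).ofReal_comp).const_mul (c n)
  have hval : ∀ y, Φ'' y + c n = Complex.exp (pt n * x y) * ∑ m ∈ Finset.range N,
      (chi m : ℂ) * (m : ℂ) * Complex.exp (-(pt m : ℂ) * x y) := by
    intro y
    rw [Finset.mul_sum, ← Finset.sum_erase_add _ _ (Finset.mem_range.2 hnN)]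
    congr 1
    · refine Finset.sum_congr rfl fun m _ => ?_
      have : Complex.exp (-d m * x y) =
          Complex.exp (pt n * x y) * Complex.exp (-(pt m : ℂ) * x y) := by
        rw [← Complex.exp_add]; congr 1; simp only [hd]; push_cast; ring
      rw [this]; simp only [hc]; ring
    · have : Complex.exp (pt n * x y) * Complex.exp (-(pt n : ℂ) * x y) = 1 := by
        rw [← Complex.exp_add]; simp
      simp only [hc]
      linear_combination -((chi n : ℂ) * (n : ℂ)) * this
  have h2nd := norm_second_difference_le hL.le (fun y => (hΦd y).add (hq1 y))
    (fun y => (hΦd' y).add (hq2 y)) (M := 2 * (M + 1)) fun y hy => by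
      rw [hval, norm_mul, Complex.norm_exp, Complex.re_ofReal_mul, hxre]
      have h3 := hb t ⟨ht0, htL⟩ y hy
      have h4 := hN y
      have h5 := norm_sub_norm_le (∑ m ∈ Finset.range N,
        (chi m : ℂ) * (m : ℂ) * Complex.exp (-(pt m : ℂ) * x y)) (lacunary (x y))
      rw [norm_sub_rev] at h5
      refine mul_le_mul hexp ?_ (norm_nonneg _) (by norm_num)
      linarith
  have hΦb : ∀ y, ‖Φ y‖ ≤ 2 * K := by
    intro y
    have h6 : ∀ m ∈ Finset.range N, ‖-(c m / d m ^ 2) * Complex.exp (-d m * x y)‖ ≤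
        2 * (1 / (((m : ℤ) - n : ℤ) : ℝ) ^ 2) := by
      intro m _
      have e1 : ‖c m / d m ^ 2‖ ≤ m / (pt m - pt n) ^ 2 := by
        rw [norm_div, norm_pow]
        simp only [hc, hd]
        rw [Complex.norm_real, Real.norm_eq_abs, sq_abs, norm_mul, Complex.norm_natCast]
        gcongr
        exact mul_le_of_le_one_left (Nat.cast_nonneg m) (norm_chi_le m)
      have e2 : ‖Complex.exp (-d m * x y)‖ ≤ 2 := by
        rw [Complex.norm_exp]
        simp only [hd]
        rw [← Complex.ofReal_neg, Complex.re_ofReal_mul, hxre]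
        refine (Real.exp_le_exp.2 ?_).trans hexp
        have : 0 ≤ pt m := by unfold pt; positivity
        nlinarith
      rw [norm_mul, norm_neg, mul_comm]
      exact mul_le_mul e2 (e1.trans (div_sq_pt_sub_le m n)) (norm_nonneg _) two_pos.le
    calc ‖Φ y‖ ≤ ∑ m ∈ S, ‖-(c m / d m ^ 2) * Complex.exp (-d m * x y)‖ := norm_sum_le _ _
      _ ≤ ∑ m ∈ Finset.range N, ‖-(c m / d m ^ 2) * Complex.exp (-d m * x y)‖ :=
          Finset.sum_le_sum_of_subset_of_nonneg (Finset.erase_subset _ _)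
            fun _ _ _ => norm_nonneg _
      _ ≤ ∑ m ∈ Finset.range N, 2 * (1 / (((m : ℤ) - n : ℤ) : ℝ) ^ 2) := Finset.sum_le_sum h6
      _ ≤ 2 * K := by
          rw [← Finset.mul_sum]
          gcongr
          exact sum_inv_sq_sub_le n N
  have hcn : ‖c n * (L : ℂ) ^ 2‖ = n * L ^ 2 := by
    rw [norm_mul, norm_pow, Complex.norm_real, Real.norm_of_nonneg hL.le]
    simp only [hc]
    rw [norm_mul, norm_chi_of_mem hn, Complex.norm_natCast, one_mul]
  have e : c n * (L : ℂ) ^ 2 = ((Φ (2 * L) + c n * (((2 * L : ℝ) : ℂ) ^ 2 / 2)) -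
      2 * (Φ L + c n * ((L : ℂ) ^ 2 / 2)) + (Φ 0 + c n * (((0 : ℝ) : ℂ) ^ 2 / 2))) -
      (Φ (2 * L) - 2 * Φ L + Φ 0) := by
    push_cast; ring
  rw [← hcn, e]
  refine (norm_sub_le _ _).trans ?_
  have h7 : ‖Φ (2 * L) - 2 * Φ L + Φ 0‖ ≤ 8 * K := by
    refine (norm_add_le _ _).trans ?_
    have := norm_sub_le (Φ (2 * L)) (2 * Φ L)
    rw [norm_mul, Complex.norm_ofNat] at this
    linarith [hΦb (2 * L), hΦb L, hΦb 0]
  refine add_le_add (h2nd.trans (le_of_eq ?_)) h7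
  ring

/-- A continuation would be bounded near x₀. Away from x = 0 the factor (πx)^{3/2} is bounded below,
so the lacunary series would be bounded near a boundary segment, contradicting the growth of its
coefficients. -/
theorem hasNaturalBoundary_lateralDiff : HasNaturalBoundary lateralDiff := by
  rintro x₀ hx₀ ⟨k, hk, hkeq⟩
  obtain ⟨ρ, hρ, hball⟩ : ∃ ρ > 0, ∀ x ∈ Metric.ball x₀ ρ, ‖k x‖ ≤ ‖k x₀‖ + 1 ∧
      (0 < x.re → k x = lateralDiff x) := by
    have h1 : ∀ᶠ x in 𝓝 x₀, ‖k x‖ ≤ ‖k x₀‖ + 1 :=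
      (hk.continuousAt.norm.eventually (gt_mem_nhds (by linarith))).mono fun _ h => h.le
    have h2 := eventually_nhdsWithin_iff.1 hkeq
    obtain ⟨ρ, hρ, h⟩ := Metric.eventually_nhds_iff_ball.1 (h1.and h2)
    exact ⟨ρ, hρ, fun x hx => ⟨(h x hx).1, fun h' => (h x hx).2 h'⟩⟩
  -- a boundary interval that does not contain zero
  obtain ⟨v, L, c, hL, hc, hv⟩ : ∃ v L c : ℝ, 0 < L ∧ 0 < c ∧ ∀ t ∈ Ioo 0 L, ∀ y ∈ Icc 0 (2 * L),
      ((t : ℂ) + (v + y : ℝ) * Complex.I) ∈ Metric.ball x₀ ρ ∧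
        c ≤ ‖(t : ℂ) + (v + y : ℝ) * Complex.I‖ := by
    set s : ℝ := if 0 ≤ x₀.im then 1 else -1 with hs
    have hs1 : s = 1 ∧ 0 ≤ x₀.im ∨ s = -1 ∧ x₀.im < 0 := by
      rw [hs]; split_ifs with h
      · exact Or.inl ⟨rfl, h⟩
      · exact Or.inr ⟨rfl, not_le.1 h⟩
    -- The segment is moved by ρ/2 away from the origin in the direction s and has length 2L = ρ/4:
    -- it stays at distance at least ρ/4 from 0, and the points considered are within 3ρ/4 + ρ/8 < ρ
    -- of x₀.
    refine ⟨x₀.im + s * (ρ / 2), ρ / 8, ρ / 4, by positivity, by positivity, fun t ht y hy => ⟨?_, ?_⟩⟩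
    · rw [Metric.mem_ball, dist_eq_norm]
      refine (Complex.norm_le_abs_re_add_abs_im _).trans_lt ?_
      simp only [Complex.sub_re, Complex.add_re, Complex.ofReal_re, Complex.mul_re, Complex.I_re,
        Complex.ofReal_im, Complex.I_im, Complex.sub_im, Complex.add_im, Complex.mul_im, hx₀]
      have h1 : |t + ((x₀.im + s * (ρ / 2) + y) * 0 - 0 * 1) - 0| < ρ / 8 := by
        rw [abs_lt]; constructor <;> linarith [ht.1, ht.2]
      have h2 : |0 + ((x₀.im + s * (ρ / 2) + y) * 1 + 0 * 0) - x₀.im| ≤ 3 * ρ / 4 := by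
        rcases hs1 with ⟨h, -⟩ | ⟨h, -⟩ <;> rw [h, abs_le] <;> constructor <;>
          linarith [hy.1, hy.2]
      linarith
    · refine le_trans ?_ (Complex.abs_im_le_norm _)
      simp only [Complex.add_im, Complex.ofReal_im, Complex.mul_im, Complex.ofReal_re, Complex.I_im,
        Complex.I_re, mul_one, mul_zero, add_zero, zero_add]
      rw [le_abs]
      rcases hs1 with ⟨h, h'⟩ | ⟨h, h'⟩
      · left; rw [h]; linarith [hy.1]
      · right; rw [h]; linarith [hy.2]
  set D : ℝ := √2 * (π * c) ^ (3 / 2 : ℝ) with hD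
  have hD0 : 0 < D := by positivity
  set M : ℝ := (‖k x₀‖ + 1) / D with hM
  have hb : ∀ t ∈ Ioo 0 L, ∀ y ∈ Icc 0 (2 * L),
      ‖lacunary ((t : ℂ) + (v + y : ℝ) * Complex.I)‖ ≤ M := by
    intro t ht y hy
    obtain ⟨h1, h2⟩ := hv t ht y hy
    obtain ⟨h3, h4⟩ := hball _ h1
    have hre : 0 < ((t : ℂ) + (v + y : ℝ) * Complex.I).re := by simpa using ht.1
    rw [h4 hre, lateralDiff_eq_lacunary hre, norm_mul] at h3
    rw [hM, le_div_iff₀ hD0, mul_comm]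
    refine le_trans ?_ h3
    gcongr
    rw [norm_mul, norm_mul, Complex.norm_I, one_mul, Complex.norm_real,
      Real.norm_of_nonneg (Real.sqrt_nonneg 2), show (3 / 2 : ℂ) = ((3 / 2 : ℝ) : ℂ) by
        push_cast; rfl, Complex.norm_cpow_real, norm_mul, Complex.norm_real,
      Real.norm_of_nonneg Real.pi_pos.le, hD]
    gcongr
  obtain ⟨j, hj⟩ := exists_nat_gt ((2 * (M + 1) * L ^ 2 + 8 * ∑' k : ℤ, 1 / (k : ℝ) ^ 2) / L ^ 2)
  have hle := coefficient_le_of_bounded hL hb (coprimeSix_mem j)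
  have hjle : (j : ℝ) ≤ coprimeSix j := by
    have : j ≤ coprimeSix j := by unfold coprimeSix; omega
    exact_mod_cast this
  rw [div_lt_iff₀ (by positivity)] at hj
  have : (j : ℝ) * L ^ 2 ≤ coprimeSix j * L ^ 2 := by gcongr
  linarith

lemma tendsto_sing_gap : Tendsto (fun k => sing (k + 1) - sing k) atTop atTop := by
  refine tendsto_atTop_mono (fun k => ?_) tendsto_natCast_atTop_atTop
  have h1 : (k : ℝ) ≤ coprimeSix k := by
    have : k ≤ coprimeSix k := by unfold coprimeSix; omega
    exact_mod_cast this
  have h2 : (coprimeSix k : ℝ) + 1 ≤ coprimeSix (k + 1) := by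
    exact_mod_cast coprimeSix_strictMono (Nat.lt_succ_self k)
  have hpi : 1 ≤ π ^ 2 / 6 := by nlinarith [Real.pi_gt_three]
  have e : sing (k + 1) - sing k = (π ^ 2 / 6) *
      ((coprimeSix (k + 1) - coprimeSix k) * (coprimeSix (k + 1) + coprimeSix k)) := by
    unfold sing pt; ring
  rw [e]
  have h3 : (0 : ℝ) ≤ k := Nat.cast_nonneg k
  have h4 : (k : ℝ) ≤ ((coprimeSix (k + 1) : ℝ) - coprimeSix k) *
      (coprimeSix (k + 1) + coprimeSix k) := by nlinarith
  nlinarith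

/-! ### Sums with periodic coefficients of mean zero -/

/-- The forward difference of a sequence. -/
def fwd (f : ℕ → ℂ) (n : ℕ) : ℂ := f (n + 1) - f n

lemma exists_norm_le_of_periodic {c : ℕ → ℂ} {P : ℕ} (hP : 0 < P) (hc : Function.Periodic c P) :
    ∃ B, 0 ≤ B ∧ ∀ n, ‖c n‖ ≤ B := by
  refine ⟨∑ n ∈ Finset.range P, ‖c n‖, Finset.sum_nonneg fun _ _ => norm_nonneg _, fun n => ?_⟩
  rw [← hc.map_mod_nat n]
  exact Finset.single_le_sum (f := fun n => ‖c n‖) (fun _ _ => norm_nonneg _)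
    (Finset.mem_range.2 (Nat.mod_lt n hP))

lemma summable_periodic_mul {c f : ℕ → ℂ} {P : ℕ} (hP : 0 < P) (hc : Function.Periodic c P)
    (hf : Summable fun n => ‖f n‖) : Summable fun n => c n * f n := by
  obtain ⟨B, -, hB⟩ := exists_norm_le_of_periodic hP hc
  refine Summable.of_norm_bounded (hf.mul_left B) fun n => ?_
  rw [norm_mul]
  gcongr
  exact hB n

lemma summable_norm_fwd {f : ℕ → ℂ} (hf : Summable fun n => ‖f n‖) :
    Summable fun n => ‖fwd f n‖ :=
  Summable.of_nonneg_of_le (fun _ => norm_nonneg _) (fun _ => norm_sub_le _ _)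
    (((summable_nat_add_iff 1).2 hf).add hf)

/-- A periodic sequence of mean zero is the difference of another one. -/
lemma exists_antidifference {c : ℕ → ℂ} {P : ℕ} (hP : 0 < P) (hc : Function.Periodic c P)
    (h0 : ∑ n ∈ Finset.range P, c n = 0) :
    ∃ C : ℕ → ℂ, Function.Periodic C P ∧ ∑ n ∈ Finset.range P, C (n + 1) = 0 ∧
      ∀ n, c n = C (n + 1) - C n := by
  -- The partial sums are normalized to have mean zero, so that the summation by parts can be
  -- repeated with the new coefficients.
  set μ : ℂ := (∑ n ∈ Finset.range P, ∑ j ∈ Finset.range (n + 1), c j) / P with hμ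
  have hPc : (P : ℂ) ≠ 0 := by exact_mod_cast hP.ne'
  refine ⟨fun n => ∑ j ∈ Finset.range n, c j - μ, fun n => ?_, ?_, fun n => ?_⟩
  · have : ∑ j ∈ Finset.range (n + P), c j = ∑ j ∈ Finset.range n, c j := by
      rw [add_comm n P, Finset.sum_range_add, h0, zero_add]
      exact Finset.sum_congr rfl fun j _ => by rw [add_comm P j, hc]
    simp only [this]
  · rw [Finset.sum_sub_distrib, Finset.sum_const, Finset.card_range, nsmul_eq_mul, hμ,
      mul_div_cancel₀ _ hPc, sub_self]
  · show c n = (∑ j ∈ Finset.range (n + 1), c j - μ) - (∑ j ∈ Finset.range n, c j - μ)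
    rw [Finset.sum_range_succ]; ring

/-- Summation by parts. -/
lemma tsum_fwd_mul {C f : ℕ → ℂ} {P : ℕ} (hP : 0 < P) (hC : Function.Periodic C P)
    (hf : Summable fun n => ‖f n‖) :
    ∑' n, (C (n + 1) - C n) * f n = -(C 0 * f 0) - ∑' n, C (n + 1) * fwd f n := by
  have hC1 : Function.Periodic (fun n => C (n + 1)) P := fun n => by
    show C (n + P + 1) = C (n + 1)
    rw [show n + P + 1 = n + 1 + P by ring, hC]
  have h1 := summable_periodic_mul hP hC hf
  have h2 := summable_periodic_mul hP hC1 hf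
  have h3 := summable_periodic_mul hP hC1 ((summable_nat_add_iff 1).2 hf)
  have e1 : ∑' n, (C (n + 1) - C n) * f n = ∑' n, C (n + 1) * f n - ∑' n, C n * f n := by
    rw [← h2.tsum_sub h1]
    exact tsum_congr fun n => by ring
  have e2 : ∑' n, C (n + 1) * fwd f n = ∑' n, C (n + 1) * f (n + 1) - ∑' n, C (n + 1) * f n := by
    rw [← h3.tsum_sub h2]
    exact tsum_congr fun n => by rw [fwd]; ring
  rw [e1, e2, h1.tsum_eq_zero_add]
  ring

/-- If the values of a family of sequences converge and the `j`-th differences tend to zero in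
`ℓ¹`, then the sums with periodic coefficients of mean zero converge. -/
lemma exists_tendsto_tsum_periodic {ι : Type*} {l : Filter ι} {P : ℕ} (hP : 0 < P) (j : ℕ) :
    ∀ {c : ℕ → ℂ} {f : ι → ℕ → ℂ}, Function.Periodic c P → ∑ n ∈ Finset.range P, c n = 0 →
      (∀ᶠ t in l, Summable fun n => ‖f t n‖) → (∀ n, ∃ a, Tendsto (fun t => f t n) l (𝓝 a)) →
      Tendsto (fun t => ∑' n, ‖fwd^[j] (f t) n‖) l (𝓝 0) →
      ∃ a, Tendsto (fun t => ∑' n, c n * f t n) l (𝓝 a) := by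
  induction j with
  | zero =>
    intro c f hc _ hs _ hlim
    obtain ⟨B, hB0, hB⟩ := exists_norm_le_of_periodic hP hc
    refine ⟨0, squeeze_zero_norm' (hs.mono fun t ht => ?_) (by simpa using hlim.const_mul B)⟩
    show _ ≤ B * ∑' n, ‖f t n‖
    rw [← tsum_mul_left]
    refine tsum_of_norm_bounded (ht.mul_left B).hasSum fun n => ?_
    rw [norm_mul]
    gcongr
    exact hB n
  | succ j ih =>
    intro c f hc h0 hs hpt hlim
    obtain ⟨C, hC, hC0, hcC⟩ := exists_antidifference hP hc h0
    have hC1 : Function.Periodic (fun n => C (n + 1)) P := fun n => by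
      show C (n + P + 1) = C (n + 1)
      rw [show n + P + 1 = n + 1 + P by ring, hC]
    obtain ⟨a, ha⟩ := ih (f := fun t => fwd (f t)) hC1 hC0
      (hs.mono fun t ht => summable_norm_fwd ht) (fun n => by
        obtain ⟨a, ha⟩ := hpt n
        obtain ⟨b, hb⟩ := hpt (n + 1)
        exact ⟨b - a, hb.sub ha⟩) (by simpa only [Function.iterate_succ_apply] using hlim)
    obtain ⟨b, hb⟩ := hpt 0
    refine ⟨-(C 0 * b) - a, ((hb.const_mul (C 0)).neg.sub ha).congr' (hs.mono fun t ht => ?_)⟩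
    show _ = ∑' n, c n * f t n
    rw [tsum_congr fun n => congrArg (· * f t n) (hcC n)]
    exact (tsum_fwd_mul hP hC ht).symm

/-! ### The differences of `y e^{-τy²}` -/

lemma norm_fwd_le {g g' : ℝ → ℂ} {M y : ℝ} (h : ∀ y, HasDerivAt g (g' y) y)
    (hM : ∀ z ∈ Icc y (y + 1), ‖g' z‖ ≤ M) : ‖g (y + 1) - g y‖ ≤ M := by
  have := (convex_Icc y (y + 1)).norm_image_sub_le_of_norm_hasDerivWithin_le
    (fun x _ => (h x).hasDerivWithinAt) hM (left_mem_Icc.2 (by linarith))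
    (right_mem_Icc.2 (by linarith))
  rwa [add_sub_cancel_left, norm_one, mul_one] at this

lemma norm_fwd_three_le {g g₁ g₂ g₃ : ℝ → ℂ} {M : ℝ} {n : ℕ} (h1 : ∀ y, HasDerivAt g (g₁ y) y)
    (h2 : ∀ y, HasDerivAt g₁ (g₂ y) y) (h3 : ∀ y, HasDerivAt g₂ (g₃ y) y)
    (hM : ∀ y, (n : ℝ) ≤ y → ‖g₃ y‖ ≤ M) : ‖fwd^[3] (fun n : ℕ => g n) n‖ ≤ M := by
  have hd : ∀ {u u' : ℝ → ℂ}, (∀ y, HasDerivAt u (u' y) y) →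
      ∀ y, HasDerivAt (fun y => u (y + 1) - u y) (u' (y + 1) - u' y) y := fun h y =>
    ((h (y + 1)).comp_add_const y 1).sub (h y)
  have e : fwd^[3] (fun n : ℕ => g n) n =
      ((g (n + 1 + 1 + 1) - g (n + 1 + 1)) - (g (n + 1 + 1) - g (n + 1))) -
        ((g (n + 1 + 1) - g (n + 1)) - (g (n + 1) - g n)) := by
    simp only [Function.iterate_succ, Function.iterate_zero, Function.comp, id, fwd]
    push_cast
    ring
  rw [e]
  refine norm_fwd_le (hd (hd h1)) fun z hz => norm_fwd_le (hd h2) fun w hw =>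
    norm_fwd_le h3 fun u hu => hM u ?_
  linarith [hz.1, hw.1, hu.1]

/-- The product (6 + 24z + 8z²)(1 + z) is 6 + 30z + 32z² + 8z³, and z^k ≤ k! e^z gives the constant
6 + 30 + 64 + 48 = 148. -/
lemma cubic_mul_exp_neg_le {z : ℝ} (hz : 0 ≤ z) :
    (6 + 24 * z + 8 * z ^ 2) * Real.exp (-z) ≤ 148 / (1 + z) := by
  have h0 : 1 ≤ Real.exp z := Real.one_le_exp hz
  have h1 := Real.pow_div_factorial_le_exp z hz 1
  have h2 := Real.pow_div_factorial_le_exp z hz 2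
  have h3 := Real.pow_div_factorial_le_exp z hz 3
  norm_num [Nat.factorial] at h1 h2 h3
  rw [Real.exp_neg, ← div_eq_mul_inv, div_le_div_iff₀ (Real.exp_pos z) (by linarith)]
  nlinarith

lemma hasDerivAt_mul_exp {τ : ℝ} (p : ℝ → ℝ) (p' y : ℝ) (hp : HasDerivAt p p' y) :
    HasDerivAt (fun y => ((p y * Real.exp (-(τ * y ^ 2)) : ℝ) : ℂ))
      (((p' - 2 * τ * y * p y) * Real.exp (-(τ * y ^ 2)) : ℝ) : ℂ) y := by
  have h1 : HasDerivAt (fun y : ℝ => -(τ * y ^ 2)) (-(τ * (2 * y))) y := by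
    exact ((hasDerivAt_pow 2 y).const_mul τ).fun_neg.congr_deriv (by norm_num)
  refine (hp.mul h1.exp).ofReal_comp.congr_deriv ?_
  congr 1
  ring

/-- The sequence `n e^{-τn²}`. -/
noncomputable def thetaSeq (τ : ℝ) (n : ℕ) : ℂ :=
  (((n : ℝ) * Real.exp (-(τ * (n : ℝ) ^ 2)) : ℝ) : ℂ)

/-- The third derivative of y e^{-τy²} is τ times a function of τy² alone, and third differences are
bounded by third derivatives. The factor τ is what makes three differences enough. -/
lemma norm_third_difference_le {τ : ℝ} (hτ : 0 < τ) (n : ℕ) :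
    ‖fwd^[3] (thetaSeq τ) n‖ ≤ 148 * τ / (1 + τ * (n : ℝ) ^ 2) := by
  refine norm_fwd_three_le (g := fun y : ℝ => ((y * Real.exp (-(τ * y ^ 2)) : ℝ) : ℂ))
    (g₁ := fun y => (((1 - 2 * τ * y ^ 2) * Real.exp (-(τ * y ^ 2)) : ℝ) : ℂ))
    (g₂ := fun y => (((-6 * τ * y + 4 * τ ^ 2 * y ^ 3) * Real.exp (-(τ * y ^ 2)) : ℝ) : ℂ))
    (g₃ := fun y => ((τ * (-6 + 24 * (τ * y ^ 2) - 8 * (τ * y ^ 2) ^ 2) *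
      Real.exp (-(τ * y ^ 2)) : ℝ) : ℂ)) (fun y => ?_) (fun y => ?_) (fun y => ?_) fun y hy => ?_
  · refine (hasDerivAt_mul_exp (fun y => y) 1 y (hasDerivAt_id y)).congr_deriv ?_
    congr 2; ring
  · refine (hasDerivAt_mul_exp (fun y => 1 - 2 * τ * y ^ 2) (-(2 * τ * (2 * y))) y ?_).congr_deriv ?_
    · simpa using ((hasDerivAt_pow 2 y).const_mul (2 * τ)).const_sub 1
    · congr 2; ring
  · refine (hasDerivAt_mul_exp (fun y => -6 * τ * y + 4 * τ ^ 2 * y ^ 3)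
      (-6 * τ + 4 * τ ^ 2 * (3 * y ^ 2)) y ?_).congr_deriv ?_
    · exact (((hasDerivAt_id y).const_mul (-6 * τ)).fun_add
        ((hasDerivAt_pow 3 y).const_mul (4 * τ ^ 2))).congr_deriv (by norm_num)
    · congr 2; ring
  · have hn : (0 : ℝ) ≤ n := Nat.cast_nonneg n
    have hz : 0 ≤ τ * y ^ 2 := by positivity
    rw [Complex.norm_real, Real.norm_eq_abs, abs_mul, abs_mul, abs_of_pos hτ, Real.abs_exp]
    have h1 : |-6 + 24 * (τ * y ^ 2) - 8 * (τ * y ^ 2) ^ 2| ≤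
        6 + 24 * (τ * y ^ 2) + 8 * (τ * y ^ 2) ^ 2 := by
      rw [abs_le]; constructor <;> nlinarith [sq_nonneg (τ * y ^ 2)]
    calc τ * |-6 + 24 * (τ * y ^ 2) - 8 * (τ * y ^ 2) ^ 2| * Real.exp (-(τ * y ^ 2))
        ≤ τ * ((6 + 24 * (τ * y ^ 2) + 8 * (τ * y ^ 2) ^ 2) * Real.exp (-(τ * y ^ 2))) := by
          rw [mul_assoc]; gcongr
      _ ≤ τ * (148 / (1 + τ * y ^ 2)) := by
          gcongr; exact cubic_mul_exp_neg_le hz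
      _ ≤ τ * (148 / (1 + τ * (n : ℝ) ^ 2)) := by gcongr
      _ = _ := by ring

/-- From 1 + w ≥ w^{3/4} with w = τy²: the exponent 3/4 leaves a positive power of τ together with a
summable power of y. -/
lemma div_one_add_le {τ : ℝ} (hτ : 0 < τ) (n : ℕ) :
    148 * τ / (1 + τ * ((n + 1 : ℕ) : ℝ) ^ 2) ≤
      148 * τ ^ (1 / 4 : ℝ) * ((n + 1 : ℕ) : ℝ) ^ (-(3 / 2) : ℝ) := by
  set y : ℝ := ((n + 1 : ℕ) : ℝ) with hy
  have hy0 : 0 < y := by rw [hy]; positivity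
  have hz : 0 < τ * y ^ 2 := by positivity
  have h1 : (τ * y ^ 2) ^ (3 / 4 : ℝ) ≤ 1 + τ * y ^ 2 := by
    rcases le_total (τ * y ^ 2) 1 with h | h
    · have := Real.rpow_le_one hz.le h (by norm_num : (0 : ℝ) ≤ 3 / 4)
      linarith
    · have := Real.rpow_le_rpow_of_exponent_le h (by norm_num : (3 / 4 : ℝ) ≤ 1)
      rw [Real.rpow_one] at this
      linarith
  have h2 : (τ * y ^ 2) ^ (3 / 4 : ℝ) = τ ^ (3 / 4 : ℝ) * y ^ (3 / 2 : ℝ) := by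
    rw [Real.mul_rpow hτ.le (by positivity), ← Real.rpow_natCast, ← Real.rpow_mul hy0.le]
    norm_num
  rw [div_le_iff₀ (by positivity)]
  have h3 : τ = τ ^ (1 / 4 : ℝ) * τ ^ (3 / 4 : ℝ) := by
    rw [← Real.rpow_add hτ]; norm_num
  have h4 : y ^ (-(3 / 2) : ℝ) * y ^ (3 / 2 : ℝ) = 1 := by
    rw [← Real.rpow_add hy0]; norm_num
  have h5 : 148 * τ = 148 * τ ^ (1 / 4 : ℝ) * y ^ (-(3 / 2) : ℝ) * (τ * y ^ 2) ^ (3 / 4 : ℝ) := by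
    rw [h2]; nth_rewrite 1 [h3]; linear_combination (-(148 * τ ^ (1 / 4 : ℝ) * τ ^ (3 / 4 : ℝ))) * h4
  rw [h5]
  gcongr

lemma tsum_norm_le_of_le {D : ℕ → ℂ} {u : ℕ → ℝ} {τ b : ℝ}
    (h0 : ‖D 0‖ ≤ 148 * τ / (1 + τ * ((0 : ℕ) : ℝ) ^ 2)) (h : ∀ n, ‖D (n + 1)‖ ≤ b * u n)
    (hu : Summable u) : ∑' n, ‖D n‖ ≤ 148 * τ + b * ∑' n, u n := by
  have hs1 : Summable fun n => ‖D (n + 1)‖ :=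
    Summable.of_nonneg_of_le (fun n => norm_nonneg _) h (hu.mul_left b)
  have hs : Summable fun n => ‖D n‖ := (summable_nat_add_iff (f := fun n => ‖D n‖) 1).1 hs1
  have h2 : ∑' n, ‖D (n + 1)‖ ≤ ∑' n, b * u n := hs1.tsum_le_tsum h (hu.mul_left b)
  rw [tsum_mul_left] at h2
  rw [hs.tsum_eq_zero_add]
  rw [Nat.cast_zero, zero_pow two_ne_zero, mul_zero, add_zero, div_one] at h0
  exact add_le_add h0 h2

lemma tendsto_tsum_norm_third_difference :
    Tendsto (fun τ : ℝ => ∑' n : ℕ, ‖fwd^[3] (thetaSeq τ) n‖) (𝓝[>] 0) (𝓝 0) := by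
  have hsum : Summable fun n : ℕ => ((n + 1 : ℕ) : ℝ) ^ (-(3 / 2) : ℝ) :=
    (summable_nat_add_iff 1).2 (Real.summable_nat_rpow.2 (by norm_num))
  set K := ∑' n : ℕ, ((n + 1 : ℕ) : ℝ) ^ (-(3 / 2) : ℝ)
  have hlim : Tendsto (fun τ : ℝ => 148 * τ + 148 * τ ^ (1 / 4 : ℝ) * K) (𝓝[>] 0) (𝓝 0) := by
    have h1 : ContinuousAt (fun τ : ℝ => 148 * τ + 148 * τ ^ (1 / 4 : ℝ) * K) 0 := by
      have := Real.continuousAt_rpow_const 0 (1 / 4) (Or.inr (by norm_num))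
      fun_prop
    have := h1.tendsto
    rw [Real.zero_rpow (by norm_num), mul_zero, zero_mul, add_zero] at this
    exact this.mono_left nhdsWithin_le_nhds
  refine squeeze_zero' (Eventually.of_forall fun τ => tsum_nonneg fun n => norm_nonneg _) ?_ hlim
  filter_upwards [self_mem_nhdsWithin] with τ hτ
  have hτ' : 0 < τ := hτ
  exact tsum_norm_le_of_le (norm_third_difference_le hτ' 0) (fun n =>
    (norm_third_difference_le hτ' (n + 1)).trans (div_one_add_le hτ' n)) hsum

/-! ### Radial limits -/

lemma chi_mod (n : ℕ) : chi (n % 12) = chi n := by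
  simp only [chi, Nat.mod_mod]

lemma chi_mul_five {m n : ℕ} (hm : m % 12 = 5) : chi (m * n) = -chi n := by
  rw [← chi_mod (m * n), Nat.mul_mod, hm, ← chi_mod n]
  have : n % 12 < 12 := Nat.mod_lt n (by norm_num)
  generalize n % 12 = k at this
  interval_cases k <;> rfl

/-- Write b = 3^t b' with 3 ∤ b', so that 24b = 8b' · 3^{t+1}. The Chinese remainder theorem gives m
≡ 1 modulo 8b' and m ≡ -1 modulo 3^{t+1}; then m² ≡ 1, and m ≡ 1 mod 4, m ≡ 2 mod 3 give m ≡ 5 mod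
12. -/
lemma exists_sq_modEq_one {b : ℕ} (hb : 0 < b) : ∃ m, m % 12 = 5 ∧ m ^ 2 ≡ 1 [MOD 24 * b] := by
  obtain ⟨t, b', hb', rfl⟩ := Nat.exists_eq_pow_mul_and_not_dvd hb.ne' 3 (by norm_num)
  have hcop3 : Nat.Coprime 3 b' := (Nat.Prime.coprime_iff_not_dvd Nat.prime_three).2 hb'
  have hcop : Nat.Coprime (8 * b') (3 ^ (t + 1)) :=
    Nat.Coprime.pow_right _ (Nat.Coprime.mul_left (by norm_num) hcop3.symm)
  obtain ⟨m, hm1, hm2⟩ := Nat.chineseRemainder hcop 1 (3 ^ (t + 1) - 1)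
  have h3pos : 0 < 3 ^ (t + 1) := by positivity
  have hm2' : m + 1 ≡ 0 [MOD 3 ^ (t + 1)] := by
    have := hm2.add_right 1
    rw [Nat.sub_add_cancel h3pos] at this
    exact this.trans (by simp [Nat.ModEq])
  refine ⟨m, ?_, ?_⟩
  · have h4 : m % 4 = 1 := by
      have h : m ≡ 1 [MOD 4] := hm1.of_dvd ⟨2 * b', by ring⟩
      exact h
    have h3 : (m + 1) % 3 = 0 := by
      have h : m + 1 ≡ 0 [MOD 3] := hm2'.of_dvd ⟨3 ^ t, by ring⟩
      exact h
    omega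
  · have e : 24 * (3 ^ t * b') = (8 * b') * 3 ^ (t + 1) := by ring
    rw [e, ← Nat.modEq_and_modEq_iff_modEq_mul hcop]
    constructor
    · simpa using hm1.pow 2
    · have h0 : 3 ^ (t + 1) ∣ m + 1 := (Nat.modEq_zero_iff_dvd).1 hm2'
      refine ((Nat.modEq_iff_dvd).2 ?_)
      have h1 : ((3 ^ (t + 1) : ℕ) : ℤ) ∣ ((m + 1 : ℕ) : ℤ) := Int.natCast_dvd_natCast.2 h0
      have h2 : ((1 : ℕ) : ℤ) - ((m ^ 2 : ℕ) : ℤ) = ((m + 1 : ℕ) : ℤ) * (1 - m) := by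
        push_cast; ring
      rw [h2]
      exact h1.mul_right _

lemma exp_sq_modEq {a : ℤ} {b m n : ℕ} (hb : 0 < b) (h : m ≡ n [MOD 24 * b]) :
    Complex.exp (2 * π * Complex.I * (a * m / (24 * b))) =
      Complex.exp (2 * π * Complex.I * (a * n / (24 * b))) := by
  obtain ⟨k, hk⟩ := (Nat.modEq_iff_dvd).1 h
  rw [Complex.exp_eq_exp_iff_exists_int]
  refine ⟨-(a * k), ?_⟩
  have hbc : (b : ℂ) ≠ 0 := by exact_mod_cast hb.ne'
  have hk' : (n : ℂ) - m = 24 * b * k := by exact_mod_cast hk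
  push_cast
  have : (m : ℂ) = n - 24 * b * k := by linear_combination -hk'
  rw [this]
  field_simp
  ring

/-- The coefficients `χ(n) e^{πi n²α/12}`, `α = a/b`. -/
noncomputable def radialCoeff (a : ℤ) (b n : ℕ) : ℂ :=
  (chi n : ℂ) * Complex.exp (2 * π * Complex.I * (a * ((n ^ 2 : ℕ) : ℂ) / (24 * b)))

lemma periodic_radialCoeff (a : ℤ) {b : ℕ} (hb : 0 < b) :
    Function.Periodic (radialCoeff a b) (24 * b) := by
  intro n
  have h1 : chi (n + 24 * b) = chi n := by
    rw [← chi_mod, ← chi_mod n]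
    congr 1
    omega
  have h2 : (n + 24 * b) ^ 2 ≡ n ^ 2 [MOD 24 * b] := by
    have : n + 24 * b ≡ n [MOD 24 * b] := by simp [Nat.ModEq]
    exact this.pow 2
  rw [radialCoeff, radialCoeff, h1, exp_sq_modEq hb h2]

/-- Multiplication by m is an involution of the residues modulo 24b that preserves n² and changes
the sign of χ(n). -/
lemma sum_radialCoeff_eq_zero (a : ℤ) {b : ℕ} (hb : 0 < b) :
    ∑ n ∈ Finset.range (24 * b), radialCoeff a b n = 0 := by
  obtain ⟨m, hm, hm2⟩ := exists_sq_modEq_one hb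
  have hP : 0 < 24 * b := by positivity
  have hmul : ∀ n, radialCoeff a b (m * n % (24 * b)) = -radialCoeff a b n := by
    intro n
    rw [(periodic_radialCoeff a hb).map_mod_nat, radialCoeff, radialCoeff, chi_mul_five hm]
    have : (m * n) ^ 2 ≡ n ^ 2 [MOD 24 * b] := by
      rw [mul_pow]
      simpa using hm2.mul_right (n ^ 2)
    rw [exp_sq_modEq hb this]
    push_cast
    ring
  have hinv : ∀ n ∈ Finset.range (24 * b), m * (m * n % (24 * b)) % (24 * b) = n := by
    intro n hn
    rw [Nat.mul_mod, Nat.mod_mod, ← Nat.mul_mod, ← mul_assoc, ← pow_two]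
    have : m ^ 2 * n ≡ n [MOD 24 * b] := by simpa using hm2.mul_right n
    rw [this, Nat.mod_eq_of_lt (Finset.mem_range.1 hn)]
  have h := Finset.sum_nbij' (s := Finset.range (24 * b)) (t := Finset.range (24 * b))
    (f := fun n => radialCoeff a b n) (g := fun n => -radialCoeff a b n)
    (fun n => m * n % (24 * b)) (fun n => m * n % (24 * b))
    (fun n _ => Finset.mem_range.2 (Nat.mod_lt _ hP))
    (fun n _ => Finset.mem_range.2 (Nat.mod_lt _ hP)) hinv hinv
    (fun n _ => by rw [hmul, neg_neg])
  rw [Finset.sum_neg_distrib] at h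
  exact self_eq_neg.1 h

/-- At x = α/(2πi) + t the n-th term is the periodic coefficient `radialCoeff` times n e^{-τn²} with
τ = π²t/6. -/
lemma exists_tendsto_lacunary (α : ℚ) : ∃ l : ℂ, Tendsto (fun t : ℝ =>
    lacunary ((α : ℂ) / (2 * π * Complex.I) + (t : ℂ))) (𝓝[>] 0) (𝓝 l) := by
  have hb := α.den_pos
  have hτ : Tendsto (fun t : ℝ => π ^ 2 / 6 * t) (𝓝[>] 0) (𝓝[>] 0) := by
    refine tendsto_nhdsWithin_iff.2 ⟨?_, ?_⟩
    · have : Tendsto (fun t : ℝ => π ^ 2 / 6 * t) (𝓝 0) (𝓝 (π ^ 2 / 6 * 0)) :=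
        Continuous.tendsto (by fun_prop) _
      rw [mul_zero] at this
      exact this.mono_left nhdsWithin_le_nhds
    · filter_upwards [self_mem_nhdsWithin] with t ht
      have : 0 < t := ht
      exact mem_Ioi.2 (by positivity)
  have hsum : ∀ᶠ t : ℝ in 𝓝[>] 0, Summable fun n => ‖thetaSeq (π ^ 2 / 6 * t) n‖ := by
    filter_upwards [self_mem_nhdsWithin] with t ht
    have ht' : 0 < t := ht
    refine (summable_pow_mul_exp_neg_pt ht' 1).congr fun n => ?_
    rw [thetaSeq, Complex.norm_real, Real.norm_of_nonneg (by positivity), pow_one, pt]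
    congr 2
    ring
  have hpt : ∀ n, ∃ a, Tendsto (fun t : ℝ => thetaSeq (π ^ 2 / 6 * t) n) (𝓝[>] 0) (𝓝 a) := by
    refine fun n => ⟨thetaSeq (π ^ 2 / 6 * 0) n, ?_⟩
    have : Continuous fun t : ℝ => thetaSeq (π ^ 2 / 6 * t) n := by
      unfold thetaSeq; fun_prop
    exact (this.tendsto 0).mono_left nhdsWithin_le_nhds
  obtain ⟨l, hl⟩ := exists_tendsto_tsum_periodic (by positivity : 0 < 24 * α.den) 3
    (periodic_radialCoeff α.num hb) (sum_radialCoeff_eq_zero α.num hb) hsum hpt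
    (tendsto_tsum_norm_third_difference.comp hτ)
  refine ⟨l, hl.congr fun t => ?_⟩
  rw [lacunary]
  refine tsum_congr fun n => ?_
  have hα : (α : ℂ) = α.num / α.den := by
    exact_mod_cast (Rat.num_div_den α).symm
  have hd : (α.den : ℂ) ≠ 0 := by exact_mod_cast hb.ne'
  have hpi : (π : ℂ) ≠ 0 := by exact_mod_cast Real.pi_ne_zero
  have hI : (Complex.I) ^ 2 = -1 := Complex.I_sq
  have e : Complex.exp (-(pt n : ℂ) * ((α : ℂ) / (2 * π * Complex.I) + (t : ℂ))) =
      Complex.exp (2 * π * Complex.I * (α.num * ((n ^ 2 : ℕ) : ℂ) / (24 * α.den))) *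
      ((Real.exp (-((π ^ 2 / 6 * t) * (n : ℝ) ^ 2)) : ℝ) : ℂ) := by
    rw [Complex.ofReal_exp, ← Complex.exp_add, hα]
    congr 1
    rw [pt]
    push_cast
    have hI' : (Complex.I)⁻¹ = -Complex.I := Complex.inv_I
    rw [div_eq_mul_inv (α.num / α.den : ℂ), mul_inv, mul_inv, hI']
    field_simp
    ring
  rw [e, radialCoeff]
  rw [thetaSeq]
  push_cast
  ring

theorem exists_radial_limit (α : ℚ) : ∃ l : ℂ, Tendsto (fun t : ℝ =>
    lateralDiff ((α : ℂ) / (2 * π * Complex.I) + (t : ℂ))) (𝓝[>] 0) (𝓝 l) := by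
  obtain ⟨l, hl⟩ := exists_tendsto_lacunary α
  set x₀ : ℂ := (α : ℂ) / (2 * π * Complex.I) with hx₀
  have hre : x₀.re = 0 := by
    have : x₀ = ((-(α / (2 * π)) : ℝ) : ℂ) * Complex.I := by
      rw [hx₀, div_eq_mul_inv, mul_inv, Complex.inv_I]
      push_cast
      field_simp
    rw [this, Complex.re_ofReal_mul, Complex.I_re, mul_zero]
  have hc : ContinuousAt (fun x : ℂ => (π * x) ^ (3 / 2 : ℂ)) x₀ := by
    refine ContinuousAt.comp (f := fun x : ℂ => π * x) (g := fun z : ℂ => z ^ (3 / 2 : ℂ))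
      -- The positive exponent gives continuity also at the origin, so α = 0 needs no separate
      -- treatment.
      (Complex.continuousAt_cpow_const_of_re_pos (Or.inl ?_) ?_) (by fun_prop)
    · rw [Complex.re_ofReal_mul, hre, mul_zero]
    · norm_num
  have ht : Tendsto (fun t : ℝ => x₀ + (t : ℂ)) (𝓝[>] 0) (𝓝 x₀) := by
    have : Tendsto (fun t : ℝ => x₀ + (t : ℂ)) (𝓝 0) (𝓝 (x₀ + ((0 : ℝ) : ℂ))) :=
      Continuous.tendsto (by fun_prop) _
    rw [Complex.ofReal_zero, add_zero] at this
    exact this.mono_left nhdsWithin_le_nhds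
  refine ⟨_, (((hc.tendsto.comp ht).const_mul (Complex.I * √2)).mul hl).congr' ?_⟩
  filter_upwards [self_mem_nhdsWithin] with t htpos
  rw [lateralDiff_eq_lacunary (by simpa [hre] using htpos)]
  rfl

/-! ### Integrals along segments -/

/-- Integrability of `f` along the segment from `a` to `b`. -/
def SegIntegrable (f : ℂ → ℂ) (a b : ℂ) : Prop :=
  IntervalIntegrable (fun t : ℝ => f (a + (t : ℂ) * (b - a)) * (b - a)) volume 0 1

/-- The endpoints are left out of the equality because a segment may end on the real axis outside
the sheet of f, where another branch g supplies the continuity. -/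
lemma segIntegrable_of_eqOn {f g : ℂ → ℂ} {a b : ℂ}
    (h : ∀ t ∈ Ioo (0 : ℝ) 1, f (a + t * (b - a)) = g (a + t * (b - a)))
    (hc : ∀ t ∈ Icc (0 : ℝ) 1, ContinuousAt g (a + t * (b - a))) : SegIntegrable f a b := by
  have hg : IntervalIntegrable (fun t : ℝ => g (a + (t : ℂ) * (b - a)) * (b - a)) volume 0 1 := by
    refine ContinuousOn.intervalIntegrable fun t ht => ?_
    rw [uIcc_of_le zero_le_one] at ht
    refine ContinuousAt.continuousWithinAt (ContinuousAt.mul ?_ continuousAt_const)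
    exact ContinuousAt.comp (f := fun t : ℝ => a + (t : ℂ) * (b - a)) (hc t ht)
      (by fun_prop)
  unfold SegIntegrable
  rw [intervalIntegrable_iff_integrableOn_Ioo_of_le zero_le_one] at hg ⊢
  exact hg.congr_fun (fun t ht => by rw [h t ht]) measurableSet_Ioo

lemma segIntegrable_of_continuousAt {f : ℂ → ℂ} {a b : ℂ}
    (hc : ∀ t ∈ Icc (0 : ℝ) 1, ContinuousAt f (a + t * (b - a))) : SegIntegrable f a b :=
  segIntegrable_of_eqOn (fun _ _ => rfl) hc

lemma segInt_conj {f g : ℂ → ℂ} {a b : ℂ}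
    (h : ∀ t ∈ Ioo (0 : ℝ) 1,
      f (starRingEnd ℂ (a + t * (b - a))) = starRingEnd ℂ (g (a + t * (b - a)))) :
    segInt f (starRingEnd ℂ a) (starRingEnd ℂ b) = starRingEnd ℂ (segInt g a b) := by
  rw [segInt, segInt, intervalIntegral.integral_of_le zero_le_one,
    intervalIntegral.integral_of_le zero_le_one, integral_Ioc_eq_integral_Ioo,
    integral_Ioc_eq_integral_Ioo, ← integral_conj]
  refine setIntegral_congr_fun measurableSet_Ioo fun t ht => ?_
  have := h t ht
  simp only [map_add, map_mul, map_sub, Complex.conj_ofReal] at this ⊢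
  rw [this]

lemma segInt_add_sum {ι : Type*} (s : Finset ι) {f : ℂ → ℂ} {g : ι → ℂ → ℂ} (c : ι → ℂ) {a b : ℂ}
    (hf : SegIntegrable f a b) (hg : ∀ i ∈ s, SegIntegrable (g i) a b) :
    segInt (fun p => f p + ∑ i ∈ s, c i * g i p) a b =
      segInt f a b + ∑ i ∈ s, c i * segInt (g i) a b := by
  have hg' : ∀ i ∈ s, IntervalIntegrable
      (fun t : ℝ => c i * (g i (a + (t : ℂ) * (b - a)) * (b - a))) volume 0 1 :=
    fun i hi => (hg i hi).const_mul (c i)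
  simp only [segInt]
  rw [← Finset.sum_congr rfl fun i _ => intervalIntegral.integral_const_mul (c i) _,
    ← intervalIntegral.integral_finsetSum hg', ← intervalIntegral.integral_add hf ?_]
  · refine intervalIntegral.integral_congr fun t _ => ?_
    simp only [add_mul, Finset.sum_mul, mul_assoc]
  · exact (IntervalIntegrable.sum s hg').congr (by intro t _; exact Finset.sum_apply t s _)

/-- The fundamental theorem of calculus on a segment whose interior lies in `U`. -/
lemma segInt_eq_sub {f H : ℂ → ℂ} {a b A B : ℂ} {U : Set ℂ} (hf : SegIntegrable f a b)
    (hU : ∀ t ∈ Ioo (0 : ℝ) 1, a + t * (b - a) ∈ U) (hH : ∀ p ∈ U, HasDerivAt H (f p) p)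
    (hA : Tendsto H (𝓝[U] a) (𝓝 A)) (hB : Tendsto H (𝓝[U] b) (𝓝 B)) :
    segInt f a b = B - A := by
  have hc : Continuous fun t : ℝ => a + (t : ℂ) * (b - a) := by fun_prop
  refine intervalIntegral.integral_eq_sub_of_hasDerivAt_of_tendsto (a := (0 : ℝ)) (b := 1)
    (f := fun t : ℝ => H (a + (t : ℂ) * (b - a))) one_pos (fun t ht => ?_) hf ?_ ?_
  · have h1 : HasDerivAt (fun t : ℝ => a + (t : ℂ) * (b - a)) (b - a) t := by
      have := ((Complex.ofRealCLM.hasDerivAt (x := t)).mul_const (b - a)).const_add a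
      simpa using this
    exact (hH _ (hU t ht)).comp t h1
  · refine hA.comp (tendsto_nhdsWithin_iff.2 ⟨?_, ?_⟩)
    · have := (hc.tendsto 0).mono_left (nhdsWithin_le_nhds (s := Ioi 0))
      simpa using this
    · filter_upwards [Ioo_mem_nhdsGT one_pos] with t ht using hU t ht
  · refine hB.comp (tendsto_nhdsWithin_iff.2 ⟨?_, ?_⟩)
    · have := (hc.tendsto 1).mono_left (nhdsWithin_le_nhds (s := Iio 1))
      simpa using this
    · filter_upwards [Ioo_mem_nhdsLT one_pos] with t ht using hU t ht

/-! ### Positions of the break points -/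

lemma breakPt_lt_sing (k : ℕ) : breakPt sing k < sing k := by
  cases k with
  | zero => exact sing_pos 0
  | succ k =>
    have := sing_strictMono (Nat.lt_succ_self k)
    simp only [breakPt]; linarith

lemma sing_lt_breakPt (k : ℕ) : sing k < breakPt sing (k + 1) := by
  have := sing_strictMono (Nat.lt_succ_self k)
  simp only [breakPt]; linarith

lemma sing_lt_breakPt_of_lt {n k : ℕ} (h : n < k) : sing n < breakPt sing k := by
  obtain ⟨k, rfl⟩ := Nat.exists_eq_succ_of_ne_zero (by omega : k ≠ 0)
  exact (sing_strictMono.monotone (Nat.lt_succ_iff.1 h)).trans_lt (sing_lt_breakPt k)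

lemma breakPt_mem_sheet (k : ℕ) : (breakPt sing k : ℂ) ∈ sheet sing k :=
  Or.inr ⟨fun n hn => by simpa using sing_lt_breakPt_of_lt hn, by simpa using breakPt_lt_sing k⟩

lemma apex_re (η : ℕ → ℝ) (k : ℕ) (b : Bool) : (apex η k b).re = η k := by
  cases b <;> simp [apex]

lemma apex_im (η : ℕ → ℝ) (k : ℕ) (b : Bool) : (apex η k b).im = if b then 1 else -1 := by
  cases b <;> simp [apex]

lemma seg_re (a b : ℂ) (t : ℝ) : (a + t * (b - a)).re = (1 - t) * a.re + t * b.re := by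
  simp; ring

lemma seg_im (a b : ℂ) (t : ℝ) : (a + t * (b - a)).im = (1 - t) * a.im + t * b.im := by
  simp; ring

lemma convex_seg {s t : ℝ} {A B : ℝ} (hA : s < A) (hB : s < B) (ht : t ∈ Icc (0 : ℝ) 1) :
    s < (1 - t) * A + t * B := by
  rcases ht.1.eq_or_lt with h | h
  · rw [← h]; linarith
  · nlinarith [mul_lt_mul_of_pos_left hB h, mul_le_mul_of_nonneg_left hA.le (sub_nonneg.2 ht.2)]

/-! ### The dependence of the path integrals on the signs -/

/-- The integrand `e^{-xp} g(p)` of the Laplace transform. -/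
noncomputable def expMul (x : ℂ) (g : ℂ → ℂ) (p : ℂ) : ℂ := Complex.exp (-x * p) * g p

lemma DifferentiableAt.expMul {x : ℂ} {g : ℂ → ℂ} {p : ℂ} (h : DifferentiableAt ℂ g p) :
    DifferentiableAt ℂ (expMul x g) p := by
  unfold KZ.expMul
  exact DifferentiableAt.mul (by fun_prop) h

lemma exists_primitive_of_convex {U : Set ℂ} (hU : Convex ℝ U) (hUo : IsOpen U) {f : ℂ → ℂ}
    (hf : ∀ p ∈ U, DifferentiableAt ℂ f p) : ∃ H : ℂ → ℂ, ∀ p ∈ U, HasDerivAt H (f p) p := by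
  obtain ⟨H, hH⟩ := hU.exists_forall_hasDerivWithinAt (𝕜 := ℂ) (f := f)
    fun p hp => (hf p hp).differentiableWithinAt
  exact ⟨H, fun p hp => (hH p hp).hasDerivAt (hUo.mem_nhds hp)⟩

/-- A right term is holomorphic on the half-plane to the right of its singularity, so its integral
does not feel on which side later singularities are passed. -/
lemma exists_primitive_rightTerm (x : ℂ) (n : ℕ) : ∃ Φ : ℂ → ℂ, ∀ a b : ℂ, sing n < a.re →
    sing n < b.re → SegIntegrable (expMul x (rightTerm n)) a b ∧
      segInt (expMul x (rightTerm n)) a b = Φ b - Φ a := by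
  set U : Set ℂ := {p | sing n < p.re}
  have hUo : IsOpen U := isOpen_lt continuous_const Complex.continuous_re
  have hd : ∀ p ∈ U, DifferentiableAt ℂ (expMul x (rightTerm n)) p := fun p hp =>
    DifferentiableAt.expMul (differentiableAt_rightTerm (Or.inr hp))
  obtain ⟨Φ, hΦ⟩ := exists_primitive_of_convex (convex_halfSpace_re_gt _) hUo hd
  refine ⟨Φ, fun a b ha hb => ?_⟩
  have hmem : ∀ t ∈ Icc (0 : ℝ) 1, a + t * (b - a) ∈ U := fun t ht => by
    show sing n < (a + t * (b - a)).re
    rw [seg_re]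
    exact convex_seg ha hb ht
  have hi : SegIntegrable (expMul x (rightTerm n)) a b :=
    segIntegrable_of_continuousAt fun t ht => (hd _ (hmem t ht)).continuousAt
  exact ⟨hi, segInt_eq_sub hi (fun t ht => hmem t ⟨ht.1.le, ht.2.le⟩) hΦ
    ((hΦ a ha).continuousAt.tendsto.mono_left nhdsWithin_le_nhds)
    ((hΦ b hb).continuousAt.tendsto.mono_left nhdsWithin_le_nhds)⟩

/-- The part of the branch over `(sing k, sing (k + 1))` that is ramified over `sing k` or over
points to the right of it. -/
noncomputable def localG (k : ℕ) (b : Bool) (p : ℂ) : ℂ :=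
  tailG (k + 1) p + signVal b * rightTerm k p

lemma localG_eq_tailG {k : ℕ} {b : Bool} {p : ℂ} (h : if b then 0 < p.im else p.im < 0) :
    localG k b p = tailG k p := by
  cases b with
  | true =>
    have h' : 0 < p.im := h
    rw [localG, tailG_eq_add (r := k) (Or.inl h'.ne'), rightTerm_of_im_pos h']
    simp [signVal, add_comm]
  | false =>
    have h' : p.im < 0 := by simpa using h
    rw [localG, tailG_eq_add (r := k) (Or.inl h'.ne), rightTerm_of_im_neg h']
    simp [signVal, add_comm]

lemma segIntegrable_localG_left (x : ℂ) (k : ℕ) (b : Bool) :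
    SegIntegrable (expMul x (localG k b)) (breakPt sing k) (apex sing k b) := by
  refine segIntegrable_of_eqOn (g := expMul x (tailG k)) (fun t ht => ?_) fun t ht => ?_
  · rw [expMul, expMul, localG_eq_tailG]
    rw [seg_im, apex_im]
    cases b <;> simp [ht.1]
  · refine (DifferentiableAt.expMul (analyticAt_tailG ?_).differentiableAt).continuousAt
    rw [seg_im, seg_re, apex_im, apex_re, Complex.ofReal_im, Complex.ofReal_re]
    rcases ht.1.eq_or_lt with h | h
    · right; rw [← h]; linarith [breakPt_lt_sing k]
    · left; cases b <;> simp [h.ne']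

lemma segIntegrable_localG_right (x : ℂ) (k : ℕ) (b : Bool) :
    SegIntegrable (expMul x (localG k b)) (apex sing k b) (breakPt sing (k + 1)) := by
  refine segIntegrable_of_continuousAt fun t ht => ?_
  refine (DifferentiableAt.expMul (DifferentiableAt.add (analyticAt_tailG ?_).differentiableAt
    ((differentiableAt_rightTerm ?_).const_mul _))).continuousAt
  · right
    rw [seg_re, apex_re, Complex.ofReal_re]
    have h1 := breakPt_lt_sing (k + 1)
    have h2 := sing_strictMono (Nat.lt_succ_self k)
    have := convex_seg (neg_lt_neg h2) (neg_lt_neg h1) ht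
    linarith
  · rw [seg_im, seg_re, apex_im, apex_re, Complex.ofReal_im, Complex.ofReal_re]
    rcases ht.1.eq_or_lt with h | h
    · left; rw [← h]; cases b <;> simp
    · right; nlinarith [sing_lt_breakPt k]

/-- Each sign of an address contributes to the path integrals separately. -/
lemma exists_pathLaplace_eq (x : ℂ) : ∃ (φ : ℕ → Bool → ℂ) (J : ℕ → ℕ → ℂ),
    ∀ (R : ℕ) (ε : Fin R → Bool), pathLaplace sing branchG x R ε =
      ∑ k : Fin R, (φ k (ε k) + ∑ n : Fin k, signVal (ε (n.castLE k.isLt.le)) * J n k) := by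
  choose Φ hΦ using exists_primitive_rightTerm x
  -- On the k-th piece of the path, `localG` involves the sign k only; each earlier sign enters as
  -- the coefficient of a path-independent increment of a primitive.
  refine ⟨fun k b => segInt (expMul x (localG k b)) (breakPt sing k) (apex sing k b) +
    segInt (expMul x (localG k b)) (apex sing k b) (breakPt sing (k + 1)),
    fun n k => Φ n (breakPt sing (k + 1)) - Φ n (breakPt sing k), fun R ε => ?_⟩
  refine Finset.sum_congr rfl fun k _ => ?_
  have e : (fun p => Complex.exp (-x * p) * branchG (k + 1)
      (fun i : Fin (k + 1) => ε (Fin.castLE k.isLt i)) p) = fun p => expMul x (localG k (ε k)) p +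
        ∑ n : Fin k, signVal (ε (n.castLE k.isLt.le)) * expMul x (rightTerm n) p := by
    funext p
    simp only [branchG, expMul, localG, Fin.sum_univ_castSucc, Fin.val_castSucc, Fin.val_last]
    have h1 : Fin.castLE k.isLt (Fin.last k) = k := Fin.ext rfl
    have h2 : ∀ n : Fin k, Fin.castLE k.isLt n.castSucc = n.castLE k.isLt.le := fun n => rfl
    simp only [h1, h2]
    rw [mul_add, mul_add, mul_add, Finset.mul_sum]
    have h3 : ∀ n : Fin k, Complex.exp (-x * p) *
        (signVal (ε (n.castLE k.isLt.le)) * rightTerm n p) =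
        signVal (ε (n.castLE k.isLt.le)) * (Complex.exp (-x * p) * rightTerm n p) :=
      fun n => mul_left_comm _ _ _
    simp only [h3]
    ring
  have hre : ∀ n : Fin k, sing n < sing k := fun n => sing_strictMono n.isLt
  have hl : ∀ n : Fin k, _ := fun n => hΦ n (breakPt sing k) (apex sing k (ε k))
    (by simpa using sing_lt_breakPt_of_lt n.isLt) (by rw [apex_re]; exact hre n)
  have hr : ∀ n : Fin k, _ := fun n => hΦ n (apex sing k (ε k)) (breakPt sing (k + 1))
    (by rw [apex_re]; exact hre n)
    (by simpa using sing_lt_breakPt_of_lt (n.isLt.trans (Nat.lt_succ_self k)))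
  simp only [e]
  rw [segInt_add_sum _ _ (segIntegrable_localG_left x k (ε k)) fun n _ => (hl n).1,
    segInt_add_sum _ _ (segIntegrable_localG_right x k (ε k)) fun n _ => (hr n).1,
    add_add_add_comm, ← Finset.sum_add_distrib]
  congr 1
  refine Finset.sum_congr rfl fun n _ => ?_
  rw [(hl n).2, (hr n).2]
  ring

/-! ### Averages -/

lemma sum_eq_sum_extend {r : ℕ} (f : (Fin (r + 1) → Bool) → ℂ) :
    ∑ ε, f ε = ∑ ε : Fin r → Bool, (f (extend ε true) + f (extend ε false)) := by
  rw [← (Fin.snocEquiv fun _ : Fin (r + 1) => Bool).sum_comp, Fintype.sum_prod_type_right]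
  exact Finset.sum_congr rfl fun ε _ => Fintype.sum_bool _

lemma extend_castSucc {r : ℕ} (ε : Fin r → Bool) (b : Bool) (k : Fin r) :
    extend ε b k.castSucc = ε k := by simp [extend]

lemma IsAverage.sum_eq_one {m : Weights} (hm : IsAverage m) (r : ℕ) : ∑ ε, m r ε = 1 := by
  induction r with
  | zero =>
    rw [Fintype.sum_unique, ← hm.total]
    exact congrArg (m 0) (Subsingleton.elim _ _)
  | succ r ih =>
    rw [sum_eq_sum_extend, ← ih]
    exact Finset.sum_congr rfl fun ε _ => (hm.consistent r ε).symm

/-- The mean of the sign at the `k`-th ramification point. -/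
noncomputable def signMean (m : Weights) (r : ℕ) (k : Fin r) : ℂ := ∑ ε, m r ε * signVal (ε k)

lemma IsAverage.signMean_castSucc {m : Weights} (hm : IsAverage m) {r : ℕ} (k : Fin r) :
    signMean m (r + 1) k.castSucc = signMean m r k := by
  rw [signMean, signMean, sum_eq_sum_extend]
  refine Finset.sum_congr rfl fun ε _ => ?_
  rw [extend_castSucc, extend_castSucc, hm.consistent r ε]
  ring

lemma conj_tailG {r : ℕ} {p : ℂ} (h : p.im ≠ 0 ∨ p.re < sing r) :
    starRingEnd ℂ (tailG r p) = tailG r (starRingEnd ℂ p) := by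
  rw [tailG, tailG, Complex.conj_tsum]
  refine tsum_congr fun n => ?_
  by_cases hn : n ∈ {n | n ∈ chiSupport ∧ r ≤ n / 3}
  · rw [indicator_of_mem hn, indicator_of_mem hn]
    refine conj_termG (h.imp_right fun h => h.trans_le ?_)
    rw [← sing_div_three hn.1]
    exact sing_strictMono.monotone hn.2
  · rw [indicator_of_notMem hn, indicator_of_notMem hn, map_zero]

lemma tailG_ofReal_im {r : ℕ} {t : ℝ} (h : t < sing r) : (tailG r t).im = 0 := by
  have := conj_tailG (r := r) (p := t) (Or.inr (by simpa using h))
  rw [Complex.conj_ofReal] at this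
  exact Complex.conj_eq_iff_im.1 this

/-- Being purely imaginary and nonzero on the axis, the right term detects a nonzero mean sign
through the imaginary part of the average. -/
lemma exists_rightTerm_ofReal {k : ℕ} {t : ℝ} (h : sing k < t) :
    ∃ c : ℝ, c ≠ 0 ∧ rightTerm k t = c * Complex.I := by
  have h1 : starRingEnd ℂ (coeffG (coprimeSix k)) = coeffG (coprimeSix k) := conj_coeffG _
  obtain ⟨a, ha⟩ := Complex.conj_eq_iff_real.1 h1
  have ha0 : a ≠ 0 := by
    have := coeffG_ne_zero (coprimeSix_mem k)
    rw [ha] at this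
    exact_mod_cast this
  have hpos : 0 < t - sing k := by linarith
  refine ⟨a * (t - sing k) ^ (-(5 / 2) : ℝ), mul_ne_zero ha0 (Real.rpow_pos_of_pos hpos _).ne', ?_⟩
  rw [rightTerm, ha, Complex.ofReal_mul, Complex.ofReal_cpow hpos.le]
  push_cast
  ring

lemma isReal_G {t : ℝ} (h : t < sing 0) : (branchG 0 emptyAddr t).im = 0 := by
  rw [branchG_zero, ← tailG_zero]
  exact tailG_ofReal_im h

lemma average_branchG {m : Weights} (hm : IsAverage m) (r : ℕ) (p : ℂ) :
    average m branchG r p = tailG r p + ∑ k : Fin r, signMean m r k * rightTerm k p := by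
  simp only [average, branchG, mul_add, Finset.sum_add_distrib, ← Finset.sum_mul,
    hm.sum_eq_one, one_mul, Finset.mul_sum, signMean]
  congr 1
  rw [Finset.sum_comm]
  refine Finset.sum_congr rfl fun k _ => ?_
  rw [Finset.sum_mul]
  exact Finset.sum_congr rfl fun ε _ => (mul_assoc _ _ _).symm

/-- The signs have mean zero for reality-preserving averages. -/
lemma signMean_eq_zero {m : Weights} (hm : IsAverage m) (hr : IsRealityPreserving sing m) (r : ℕ) :
    ∀ k : Fin r, signMean m r k = 0 := by
  induction r with
  | zero => exact fun k => k.elim0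
  | succ r ih =>
    refine Fin.lastCases ?_ fun k => by rw [hm.signMean_castSucc, ih]
    have h1 := sing_lt_breakPt r
    have h2 := breakPt_lt_sing (r + 1)
    -- Reality is tested on G itself just to the right of `sing r`. Earlier signs have mean zero by
    -- induction, so the imaginary part is the mean of the new sign times a nonzero constant.
    have h := hr.2 branchG isRamified_branchG (fun t ht => isReal_G ht) (r + 1)
      (breakPt sing (r + 1)) (fun k hk => sing_lt_breakPt_of_lt hk) h2
    obtain ⟨c, hc, hct⟩ := exists_rightTerm_ofReal h1
    have him : (signMean m (r + 1) (Fin.last r)).im = 0 := by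
      rw [signMean, Complex.im_sum]
      refine Finset.sum_eq_zero fun ε _ => ?_
      rw [Complex.mul_im, hr.1]
      cases ε (Fin.last r) <;> simp [signVal]
    rw [average_branchG hm, Fin.sum_univ_castSucc, Finset.sum_eq_zero fun k _ => by
      rw [hm.signMean_castSucc, ih, zero_mul], zero_add, Complex.add_im, tailG_ofReal_im h2,
      zero_add, Fin.val_last, hct, Complex.mul_im, him, zero_mul, add_zero] at h
    simp only [Complex.im_ofReal_mul, Complex.I_im, mul_one, mul_eq_zero, hc, or_false] at h
    exact Complex.ext h him

/-- If the signs have mean zero, then the average of a sum of functions of one sign each is its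
median. -/
lemma sum_mul_eq_of_signMean {m : Weights} (hm : IsAverage m) {r : ℕ}
    (h0 : ∀ k : Fin r, signMean m r k = 0) (φ : Fin r → Bool → ℂ) {ι : Fin r → Type*}
    [∀ k, Fintype (ι k)] (J : ∀ k, ι k → ℂ) (i : ∀ k, ι k → Fin r) :
    ∑ ε, m r ε * ∑ k, (φ k (ε k) + ∑ n, signVal (ε (i k n)) * J k n) =
      ∑ k, (φ k true + φ k false) / 2 := by
  have h1 : ∀ k : Fin r, ∑ ε, m r ε * φ k (ε k) = (φ k true + φ k false) / 2 := fun k => by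
    have e : ∀ ε : Fin r → Bool, m r ε * φ k (ε k) = m r ε * ((φ k true + φ k false) / 2) +
        m r ε * signVal (ε k) * ((φ k true - φ k false) / 2) := fun ε => by
      cases ε k <;> simp only [signVal, if_true, Bool.false_eq_true, if_false] <;> ring
    simp only [e]
    rw [Finset.sum_add_distrib, ← Finset.sum_mul, ← Finset.sum_mul, hm.sum_eq_one,
      show ∑ ε, m r ε * signVal (ε k) = 0 from h0 k]
    ring
  have h2 : ∀ (k : Fin r) (n : ι k), ∑ ε, m r ε * (signVal (ε (i k n)) * J k n) = 0 := fun k n => by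
    simp only [← mul_assoc]
    rw [← Finset.sum_mul, show ∑ ε, m r ε * signVal (ε (i k n)) = 0 from h0 _, zero_mul]
  simp only [Finset.mul_sum, mul_add]
  rw [Finset.sum_comm]
  refine Finset.sum_congr rfl fun k _ => ?_
  rw [Finset.sum_add_distrib, h1, Finset.sum_comm, Finset.sum_eq_zero fun n _ => h2 k n, add_zero]

/-- A reality-preserving average of the path integrals is their median average. -/
theorem sum_mul_pathLaplace {m : Weights} (hm : IsAverage m) (hr : IsRealityPreserving sing m)
    (x : ℂ) (R : ℕ) : ∑ ε, m R ε * pathLaplace sing branchG x R ε =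
      (pathLaplace sing branchG x R (fun _ => true) +
        pathLaplace sing branchG x R fun _ => false) / 2 := by
  rw [← sum_med]
  obtain ⟨φ, J, h⟩ := exists_pathLaplace_eq x
  simp only [h]
  have key := fun {m : Weights} (hm : IsAverage m) (h0 : ∀ k : Fin R, signMean m R k = 0) =>
    sum_mul_eq_of_signMean hm h0 (fun k => φ k) (ι := fun k : Fin R => Fin k)
      (fun k n => J n k) fun k n => n.castLE k.isLt.le
  exact (key hm (signMean_eq_zero hm hr R)).trans
    (key isAverage_med (signMean_eq_zero isAverage_med isRealityPreserving_med R)).symm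

/-! ### The limit of the integrals along the paths above the singularities -/

/-- The upper half-plane. -/
def upper : Set ℂ := {p | 0 < p.im}

lemma isOpen_upper : IsOpen upper := isOpen_lt continuous_const Complex.continuous_im

lemma convex_upper : Convex ℝ upper := convex_halfSpace_im_gt 0

lemma branchG_true_of_im_pos (r : ℕ) {p : ℂ} (hp : 0 < p.im) :
    branchG r (fun _ => true) p = G p := by
  rw [isRamified_branchG.const_true r hp, branchG_zero]

lemma branchG_false_of_im_neg (r : ℕ) {p : ℂ} (hp : p.im < 0) :
    branchG r (fun _ => false) p = G p := by
  rw [isRamified_branchG.const_false r hp, branchG_zero]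

lemma differentiableAt_branchG {r : ℕ} {ε : Fin r → Bool} {p : ℂ} (hp : p ∈ sheet sing r) :
    DifferentiableAt ℂ (branchG r ε) p :=
  (isRamified_branchG.analytic r ε).differentiableAt ((isOpen_sheet sing r).mem_nhds hp)

lemma exists_primitive_upper (x : ℂ) : ∃ H : ℂ → ℂ, ∀ p ∈ upper, HasDerivAt H (expMul x G p) p :=
  exists_primitive_of_convex convex_upper isOpen_upper fun p hp => by
    have hp' : 0 < p.im := hp
    refine DifferentiableAt.expMul ?_
    rw [← funext (tailG_zero)]
    exact (analyticAt_tailG (Or.inl hp'.ne')).differentiableAt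

/-- The branch continued from above is analytic across the interval containing the break point, so
it has a primitive on a disc there; the two primitives differ by a constant on the upper half of the
disc. -/
lemma exists_tendsto_primitive {x : ℂ} {H : ℂ → ℂ}
    (hH : ∀ p ∈ upper, HasDerivAt H (expMul x G p) p) (k : ℕ) :
    ∃ L, Tendsto H (𝓝[upper] (breakPt sing k : ℂ)) (𝓝 L) := by
  obtain ⟨ρ, hρ, hball⟩ := Metric.isOpen_iff.1 (isOpen_sheet sing k) _ (breakPt_mem_sheet k)
  obtain ⟨Φ, hΦ⟩ := exists_primitive_of_convex (convex_ball (breakPt sing k : ℂ) ρ)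
    Metric.isOpen_ball (f := expMul x (branchG k fun _ => true)) fun p hp =>
      DifferentiableAt.expMul (differentiableAt_branchG (hball hp))
  set U := Metric.ball (breakPt sing k : ℂ) ρ ∩ upper with hU
  have hUo : IsOpen U := Metric.isOpen_ball.inter isOpen_upper
  have hUc : Convex ℝ U := (convex_ball _ _).inter convex_upper
  have hd : ∀ p ∈ U, HasDerivAt (fun p => H p - Φ p) 0 p := fun p hp => by
    have h := (hH p hp.2).fun_sub (hΦ p hp.1)
    rwa [expMul, expMul, branchG_true_of_im_pos k hp.2, sub_self] at h
  have hne : (breakPt sing k : ℂ) + (ρ / 2 : ℝ) * Complex.I ∈ U := by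
    refine ⟨?_, ?_⟩
    · rw [Metric.mem_ball, dist_eq_norm, add_sub_cancel_left, norm_mul, Complex.norm_I, mul_one,
        Complex.norm_real, Real.norm_of_nonneg (by positivity)]
      linarith
    · show 0 < ((breakPt sing k : ℂ) + (ρ / 2 : ℝ) * Complex.I).im
      rw [Complex.add_im, Complex.ofReal_im, zero_add, Complex.im_ofReal_mul, Complex.I_im, mul_one]
      positivity
  obtain ⟨c, hc⟩ : ∃ c, ∀ p ∈ U, H p = Φ p + c := by
    refine ⟨H (breakPt sing k + (ρ / 2 : ℝ) * Complex.I) - Φ (breakPt sing k + (ρ / 2 : ℝ) * Complex.I),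
      fun p hp => ?_⟩
    have := hUc.is_const_of_fderivWithin_eq_zero (𝕜 := ℂ)
      (fun q hq => (hd q hq).differentiableAt.differentiableWithinAt)
      (fun q hq => by
        rw [fderivWithin_of_isOpen hUo hq]
        ext
        simp [(hd q hq).hasFDerivAt.fderiv]) hp hne
    linear_combination this
  refine ⟨Φ (breakPt sing k) + c, ?_⟩
  have h1 : Tendsto (fun p => Φ p + c) (𝓝[upper] (breakPt sing k : ℂ))
      (𝓝 (Φ (breakPt sing k) + c)) :=
    ((hΦ _ (Metric.mem_ball_self hρ)).continuousAt.tendsto.mono_left nhdsWithin_le_nhds).add_const c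
  refine h1.congr' ?_
  filter_upwards [self_mem_nhdsWithin, mem_nhdsWithin_of_mem_nhds (Metric.ball_mem_nhds _ hρ)]
    with p hp1 hp2
  exact (hc p ⟨hp2, hp1⟩).symm

/-- All branches with only + signs coincide in the upper half-plane; the index r may differ from k
because an endpoint on the axis can belong to a neighbouring interval. -/
lemma segInt_branchG_true {x : ℂ} {H : ℂ → ℂ} {k : ℕ} {a b A B : ℂ}
    (hH : ∀ p ∈ upper, HasDerivAt H (expMul x G p) p)
    (hk : ∃ r, ∀ t ∈ Icc (0 : ℝ) 1, a + t * (b - a) ∈ sheet sing r)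
    (hU : ∀ t ∈ Ioo (0 : ℝ) 1, a + t * (b - a) ∈ upper)
    (hA : Tendsto H (𝓝[upper] a) (𝓝 A)) (hB : Tendsto H (𝓝[upper] b) (𝓝 B)) :
    segInt (expMul x (branchG k fun _ => true)) a b = B - A := by
  obtain ⟨r, hr⟩ := hk
  refine segInt_eq_sub (segIntegrable_of_eqOn (g := expMul x (branchG r fun _ => true))
    (fun t ht => ?_) fun t ht =>
      (DifferentiableAt.expMul (differentiableAt_branchG (hr t ht))).continuousAt) hU
    (fun p hp => ?_) hA hB
  · rw [expMul, expMul, branchG_true_of_im_pos k (hU t ht), branchG_true_of_im_pos r (hU t ht)]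
  · rw [expMul, branchG_true_of_im_pos k hp]
    exact hH p hp

/-- The pieces of the path join boundary values of one primitive, so the sum telescopes. -/
lemma pathLaplace_true {x : ℂ} {H : ℂ → ℂ} (hH : ∀ p ∈ upper, HasDerivAt H (expMul x G p) p)
    {L : ℕ → ℂ} (hL : ∀ k, Tendsto H (𝓝[upper] (breakPt sing k : ℂ)) (𝓝 (L k))) (R : ℕ) :
    pathLaplace sing branchG x R (fun _ => true) = L R - L 0 := by
  have hapex : ∀ k, Tendsto H (𝓝[upper] (apex sing k true)) (𝓝 (H (apex sing k true))) := fun k =>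
    (hH _ (by show 0 < (apex sing k true).im; rw [apex_im]; simp)).continuousAt.tendsto.mono_left
      nhdsWithin_le_nhds
  rw [pathLaplace, ← Finset.sum_range_sub L R, ← Fin.sum_univ_eq_sum_range fun k => L (k + 1) - L k]
  refine Finset.sum_congr rfl fun k _ => ?_
  have e : (fun p => Complex.exp (-x * p) *
      branchG (k + 1) (fun i : Fin (k + 1) => (fun _ : Fin R => true) (Fin.castLE k.isLt i)) p) =
      expMul x (branchG (k + 1) fun _ => true) := rfl
  simp only [e]
  rw [segInt_branchG_true hH ⟨k, fun t ht => ?_⟩ (fun t ht => ?_) (hL k) (hapex k),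
    segInt_branchG_true hH ⟨k + 1, fun t ht => ?_⟩ (fun t ht => ?_) (hapex k) (hL (k + 1))]
  · ring
  · rcases ht.2.eq_or_lt with h | h
    · rw [h, Complex.ofReal_one, one_mul, add_sub_cancel]
      exact breakPt_mem_sheet (k + 1)
    · left
      rw [seg_im, apex_im, Complex.ofReal_im]
      simpa using (sub_pos.2 h).ne'
  · show 0 < (_ : ℂ).im
    rw [seg_im, apex_im, Complex.ofReal_im]
    simpa using ht.2
  · rcases ht.1.eq_or_lt with h | h
    · rw [← h, Complex.ofReal_zero, zero_mul, add_zero]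
      exact breakPt_mem_sheet k
    · left
      rw [seg_im, apex_im, Complex.ofReal_im]
      simpa using h.ne'
  · show 0 < (_ : ℂ).im
    rw [seg_im, apex_im, Complex.ofReal_im]
    simpa using ht.1

lemma coprimeSix_add_two_le (k : ℕ) : coprimeSix k + 2 ≤ coprimeSix (k + 1) := by
  unfold coprimeSix; omega

lemma pt_sub_pt_ge {m n : ℕ} (h : m + 2 ≤ n) : 2 * (n : ℝ) ≤ pt n - pt m := by
  have h' : (m : ℝ) + 2 ≤ n := by exact_mod_cast h
  have hpi : 1 ≤ π ^ 2 / 6 := by nlinarith [Real.pi_gt_three]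
  have hm : (0 : ℝ) ≤ m := Nat.cast_nonneg m
  have e : pt n - pt m = π ^ 2 / 6 * ((n - m) * (n + m)) := by unfold pt; ring
  have h2 : 2 * (n : ℝ) ≤ ((n : ℝ) - m) * (n + m) := by nlinarith
  rw [e]
  nlinarith

/-- The distance between a break point and the singularities. -/
lemma le_abs_pt_sub_breakPt {n : ℕ} (hn : n ∈ chiSupport) (r : ℕ) :
    (n : ℝ) ≤ |pt n - breakPt sing (r + 1)| := by
  have hmono := coprimeSix_strictMono.monotone
  rw [← coprimeSix_of_mem hn]
  set j := n / 3
  simp only [breakPt]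
  rcases Nat.lt_or_ge r j with h | h
  · have h1 : sing (r + 1) ≤ sing j := sing_strictMono.monotone h
    have h2 := pt_sub_pt_ge ((coprimeSix_add_two_le r).trans (hmono h))
    rw [le_abs]; left
    unfold sing at *
    linarith
  · have h1 : sing j ≤ sing r := sing_strictMono.monotone h
    have h3 : coprimeSix (j + 1) ≤ coprimeSix (r + 1) := hmono (by omega)
    have h2 := pt_sub_pt_ge ((coprimeSix_add_two_le j).trans h3)
    have h4 : (coprimeSix j : ℝ) ≤ coprimeSix (r + 1) := by
      exact_mod_cast hmono (by omega : j ≤ r + 1)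
    rw [le_abs]; right
    unfold sing at *
    linarith

/-- On the vertical line through a break point the distance to pt n is at least n, which bounds G by
the same constant on all these lines. -/
lemma norm_G_le_of_re {r : ℕ} {p : ℂ} (hp : p.re = breakPt sing (r + 1)) : ‖G p‖ ≤ boundG := by
  have := norm_G_le one_pos (p := p) fun n hn => by
    rw [one_mul]
    refine (le_abs_pt_sub_breakPt hn r).trans ?_
    have := Complex.abs_re_le_norm ((pt n : ℂ) - p)
    rwa [Complex.sub_re, Complex.ofReal_re, hp] at this
  rwa [Real.one_rpow, one_mul] at this

lemma tendsto_breakPt : Tendsto (fun r => breakPt sing (r + 1)) atTop atTop := by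
  refine tendsto_atTop_mono (fun r => ?_) tendsto_natCast_atTop_atTop
  have h1 : (r : ℝ) ≤ coprimeSix r := by
    have : r ≤ coprimeSix r := by unfold coprimeSix; omega
    exact_mod_cast this
  have h2 := le_abs_pt_sub_breakPt (coprimeSix_mem r) r
  have h3 := sing_lt_breakPt r
  have h4 := sing_pos r
  rw [show pt (coprimeSix r) = sing r from rfl, abs_sub_comm, abs_of_pos (by linarith)] at h2
  linarith

/-- The primitive on a vertical segment above a break point. -/
lemma norm_primitive_sub_le {x : ℂ} {H : ℂ → ℂ} (hH : ∀ p ∈ upper, HasDerivAt H (expMul x G p) p)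
    {r : ℕ} {L : ℂ} (hL : Tendsto H (𝓝[upper] (breakPt sing (r + 1) : ℂ)) (𝓝 L)) {y : ℝ}
    (hy : 0 < y) (hxy : |x.im| * y ≤ x.re * breakPt sing (r + 1) / 2) :
    ‖H (breakPt sing (r + 1) + y * Complex.I) - L‖ ≤
      Real.exp (-(x.re * breakPt sing (r + 1) / 2)) * boundG * y := by
  set b := breakPt sing (r + 1)
  have hre : ∀ t : ℝ, ((b : ℂ) + t * Complex.I).re = b := fun t => by simp
  have him : ∀ t : ℝ, ((b : ℂ) + t * Complex.I).im = t := fun t => by simp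
  have hmem : ∀ t : ℝ, 0 < t → (b : ℂ) + t * Complex.I ∈ upper := fun t ht => by
    show 0 < (_ : ℂ).im
    rwa [him]
  have hline : ∀ t : ℝ, HasDerivAt (fun t : ℝ => (b : ℂ) + t * Complex.I) Complex.I t := fun t => by
    have := ((Complex.ofRealCLM.hasDerivAt (x := t)).mul_const Complex.I).const_add (b : ℂ)
    simpa using this
  have hd : ∀ t ∈ Ioc 0 y, HasDerivWithinAt (fun t : ℝ => H ((b : ℂ) + t * Complex.I))
      (expMul x G ((b : ℂ) + t * Complex.I) * Complex.I) (Ioc 0 y) t := fun t ht =>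
    ((hH _ (hmem t ht.1)).comp t (hline t)).hasDerivWithinAt
  have hbd : ∀ t ∈ Ioc 0 y, ‖expMul x G ((b : ℂ) + t * Complex.I) * Complex.I‖ ≤
      Real.exp (-(x.re * b / 2)) * boundG := fun t ht => by
    rw [norm_mul, Complex.norm_I, mul_one, expMul, norm_mul, Complex.norm_exp]
    refine mul_le_mul (Real.exp_le_exp.2 ?_) (norm_G_le_of_re (hre t)) (norm_nonneg _)
      (Real.exp_pos _).le
    rw [Complex.mul_re, hre, him, Complex.neg_re, Complex.neg_im]
    have h1 : x.im * t ≤ |x.im| * y :=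
      (mul_le_mul_of_nonneg_right (le_abs_self _) ht.1.le).trans
        (mul_le_mul_of_nonneg_left ht.2 (abs_nonneg _))
    linarith
  have hlim : Tendsto (fun t : ℝ => H ((b : ℂ) + t * Complex.I)) (𝓝[>] 0) (𝓝 L) := by
    refine hL.comp (tendsto_nhdsWithin_iff.2 ⟨?_, ?_⟩)
    · have : Continuous fun t : ℝ => (b : ℂ) + t * Complex.I := by fun_prop
      have := (this.tendsto 0).mono_left (nhdsWithin_le_nhds (s := Ioi 0))
      simpa using this
    · filter_upwards [self_mem_nhdsWithin] with t ht using hmem t ht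
  refine le_of_tendsto (tendsto_const_nhds.sub hlim).norm ?_
  filter_upwards [Ioo_mem_nhdsGT hy] with t ht
  refine ((convex_Ioc 0 y).norm_image_sub_le_of_norm_hasDerivWithin_le hd hbd
    ⟨ht.1, ht.2.le⟩ (right_mem_Ioc.2 hy)).trans ?_
  refine mul_le_mul_of_nonneg_left ?_ (mul_nonneg (Real.exp_pos _).le boundG_nonneg)
  rw [Real.norm_eq_abs, abs_of_pos (by linarith [ht.2])]
  linarith [ht.1]

/-- Both conditions hold for all small angles. The second one ensures |Im x| y ≤ (Re x) b / 2 up to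
the height y = b tan ε, at which the ray meets the vertical line through b. -/
lemma exists_angle {x : ℂ} (hx : 0 < x.re) : ∃ ε ∈ Ioo 0 (π / 2), |(Complex.log x).im + ε| < π / 2 ∧
    |x.im| * Real.sin ε ≤ x.re * Real.cos ε / 2 := by
  have h1 : ∀ᶠ ε : ℝ in 𝓝 0, |(Complex.log x).im + ε| < π / 2 :=
    ContinuousAt.eventually_lt (by fun_prop) continuousAt_const (by simpa using abs_log_im_lt hx)
  have h2 : ∀ᶠ ε : ℝ in 𝓝 0, |x.im| * Real.sin ε < x.re * Real.cos ε / 2 :=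
    ContinuousAt.eventually_lt (by fun_prop) (by fun_prop) (by simpa using hx)
  have h3 : ∀ᶠ ε : ℝ in 𝓝[>] 0, ε ∈ Ioo 0 (π / 2) := Ioo_mem_nhdsGT (by positivity)
  obtain ⟨ε, hε, h3, h4⟩ := (h3.and ((h1.and h2).filter_mono nhdsWithin_le_nhds)).exists
  exact ⟨ε, hε, h3, h4.le⟩

/-- The integrals along the paths above the singularities converge to the integral along a ray. -/
theorem tendsto_pathLaplace_true {x : ℂ} (hx : 0 < x.re) :
    Tendsto (fun R => pathLaplace sing branchG x R fun _ => true) atTop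
      (𝓝 (sumRight (Complex.log x) - 1)) := by
  obtain ⟨H, hH⟩ := exists_primitive_upper x
  choose L hL using exists_tendsto_primitive hH
  obtain ⟨ε, hε, habs, hsc⟩ := exists_angle hx
  have hε' : ε ∈ Ioo 0 (2 * π) := ⟨hε.1, by linarith [hε.2, Real.pi_pos]⟩
  have hx0 : x ≠ 0 := by rintro rfl; simp at hx
  have hcos : 0 < Real.cos ε := Real.cos_pos_of_mem_Ioo ⟨by linarith [hε.1, Real.pi_pos], hε.2⟩
  have hsin : 0 < Real.sin ε := Real.sin_pos_of_pos_of_lt_pi hε.1 (by linarith [hε.2, Real.pi_pos])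
  simp only [pathLaplace_true hH hL]
  rw [sumRight_eq hε' habs, add_sub_cancel_left, Complex.exp_log hx0]
  -- the integral along the ray
  have hint : RayIntegrable (expMul x G) ε := by
    refine rayIntegrable_laplace hε' ?_
    rw [← Complex.exp_log hx0, exp_mul_exp_I_re]
    exact mul_pos (Real.exp_pos _) (cos_pos_of_abs_lt habs)
  set w := Complex.exp (Complex.I * ε) with hw
  have hw' : w = Real.cos ε + Real.sin ε * Complex.I := by
    rw [hw, mul_comm, Complex.exp_mul_I]; push_cast; rfl
  have hwim : ∀ r : ℝ, 0 < r → (r : ℂ) * w ∈ upper := fun r hr => by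
    show 0 < ((r : ℂ) * w).im
    rw [Complex.im_ofReal_mul, hw']
    simp only [Complex.add_im, Complex.ofReal_im, Complex.mul_im, Complex.ofReal_re, Complex.I_im,
      Complex.I_re, mul_one, mul_zero, add_zero, zero_add]
    positivity
  have hray : ∀ r : ℝ, 0 < r →
      ∫ t in (0 : ℝ)..r, expMul x G (t * w) * w = H (r * w) - L 0 := fun r hr => by
    have hc : Continuous fun t : ℝ => (t : ℂ) * w := by fun_prop
    refine intervalIntegral.integral_eq_sub_of_hasDerivAt_of_tendsto
      (f := fun t : ℝ => H (t * w)) hr (fun t ht => ?_) ?_ ?_ ?_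
    · have h1 : HasDerivAt (fun t : ℝ => (t : ℂ) * w) w t := by
        simpa using (Complex.ofRealCLM.hasDerivAt (x := t)).mul_const w
      exact (hH _ (hwim t ht.1)).comp t h1
    · rw [intervalIntegrable_iff_integrableOn_Ioc_of_le hr.le]
      exact (IntegrableOn.mono_set hint Ioc_subset_Ioi_self).mul_const w
    · refine (hL 0).comp (tendsto_nhdsWithin_iff.2 ⟨?_, ?_⟩)
      · have := (hc.tendsto 0).mono_left (nhdsWithin_le_nhds (s := Ioi 0))
        simpa [breakPt] using this
      · filter_upwards [self_mem_nhdsWithin] with t ht using hwim t ht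
    · refine ((hH _ (hwim r hr)).continuousAt.tendsto.comp ?_)
      exact (hc.tendsto r).mono_left nhdsWithin_le_nhds
  -- The radius b / cos ε gives the point of the ray with real part b, vertically above the break
  -- point.
  have hrad : Tendsto (fun R => breakPt sing (R + 1) / Real.cos ε) atTop atTop :=
    tendsto_breakPt.atTop_div_const hcos
  have h1 : Tendsto (fun R => H (((breakPt sing (R + 1) / Real.cos ε : ℝ) : ℂ) * w) - L 0) atTop
      (𝓝 (rayInt (expMul x G) ε)) := by
    refine (intervalIntegral_tendsto_integral_Ioi 0 (hint.mul_const w) hrad).congr' ?_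
    filter_upwards [hrad.eventually_gt_atTop 0] with R hR using hray _ hR
  -- the difference from the values at the break points
  have h2 : Tendsto (fun R => H (((breakPt sing (R + 1) / Real.cos ε : ℝ) : ℂ) * w) - L (R + 1))
      atTop (𝓝 0) := by
    have h3 : Tendsto (fun R => boundG * (Real.sin ε / Real.cos ε) * (2 / x.re) *
        ((x.re / 2 * breakPt sing (R + 1)) ^ 1 * Real.exp (-(x.re / 2 * breakPt sing (R + 1)))))
        atTop (𝓝 0) := by
      have := ((Real.tendsto_pow_mul_exp_neg_atTop_nhds_zero 1).comp
        (tendsto_breakPt.const_mul_atTop (half_pos hx))).const_mul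
          (boundG * (Real.sin ε / Real.cos ε) * (2 / x.re))
      rw [mul_zero] at this
      exact this
    refine squeeze_zero_norm (fun R => ?_) h3
    set b := breakPt sing (R + 1) with hb
    have hb0 : 0 < b := (sing_pos R).trans (sing_lt_breakPt R)
    have e : ((b / Real.cos ε : ℝ) : ℂ) * w =
        (b : ℂ) + ((b * Real.sin ε / Real.cos ε : ℝ) : ℂ) * Complex.I := by
      have hc : (Real.cos ε : ℂ) ≠ 0 := by exact_mod_cast hcos.ne'
      rw [hw']
      push_cast [-Complex.ofReal_cos, -Complex.ofReal_sin]
      field_simp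
    rw [e]
    refine (norm_primitive_sub_le hH (hL (R + 1)) (by positivity) ?_).trans (le_of_eq ?_)
    · rw [← mul_div_assoc, div_le_iff₀ hcos]
      calc |x.im| * (b * Real.sin ε) = b * (|x.im| * Real.sin ε) := by ring
        _ ≤ b * (x.re * Real.cos ε / 2) := by gcongr
        _ = _ := by ring
    · rw [← hb, show -(x.re / 2 * b) = -(x.re * b / 2) by ring]
      field_simp
  refine (tendsto_add_atTop_iff_nat 1).1 ?_
  have h3 := h1.sub h2
  rw [sub_zero] at h3
  refine h3.congr fun R => by ring

/-- The integrals along the paths below the singularities are complex conjugates of those along the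
paths above them. -/
lemma pathLaplace_false (x : ℂ) (R : ℕ) :
    pathLaplace sing branchG x R (fun _ => false) =
      starRingEnd ℂ (pathLaplace sing branchG (starRingEnd ℂ x) R fun _ => true) := by
  have hconj : ∀ (k : ℕ) {p : ℂ}, 0 < p.im →
      expMul x (branchG k fun _ => false) (starRingEnd ℂ p) =
        starRingEnd ℂ (expMul (starRingEnd ℂ x) (branchG k fun _ => true) p) := fun k p hp => by
    rw [expMul, expMul, branchG_true_of_im_pos k hp, branchG_false_of_im_neg k (by simpa using hp),
      map_mul, conj_G (Or.inl hp.ne'), ← Complex.exp_conj, map_mul, map_neg, Complex.conj_conj]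
  have hapex : ∀ k, apex sing k false = starRingEnd ℂ (apex sing k true) := fun k => by
    simp [apex]
  rw [pathLaplace, pathLaplace, map_sum]
  refine Finset.sum_congr rfl fun k _ => ?_
  have e : ∀ b y, (fun p => Complex.exp (-y * p) *
      branchG (k + 1) (fun i : Fin (k + 1) => (fun _ : Fin R => b) (Fin.castLE k.isLt i)) p) =
      expMul y (branchG (k + 1) fun _ => b) := fun b y => rfl
  simp only [e, hapex]
  rw [map_add, ← segInt_conj fun t ht => hconj (k + 1) ?_,
    ← segInt_conj fun t ht => hconj (k + 1) ?_, Complex.conj_ofReal, Complex.conj_ofReal]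
  · rw [seg_im, apex_im, Complex.ofReal_im]
    simpa using ht.2
  · rw [seg_im, apex_im, Complex.ofReal_im]
    simpa using ht.1

lemma log_conj_of_re_pos {x : ℂ} (hx : 0 < x.re) :
    Complex.log (starRingEnd ℂ x) = starRingEnd ℂ (Complex.log x) := by
  refine Complex.log_conj x fun h => ?_
  have := abs_log_im_lt hx
  rw [Complex.log_im, h, abs_of_pos Real.pi_pos] at this
  linarith [Real.pi_pos]

theorem tendsto_pathLaplace_false {x : ℂ} (hx : 0 < x.re) :
    Tendsto (fun R => pathLaplace sing branchG x R fun _ => false) atTop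
      (𝓝 (sumLeft (Complex.log x) - 1)) := by
  have h := (Complex.continuous_conj.tendsto _).comp
    (tendsto_pathLaplace_true (x := starRingEnd ℂ x) (by simpa using hx))
  rw [map_sub, map_one, log_conj_of_re_pos hx] at h
  exact h.congr fun R => (pathLaplace_false x R).symm

/-- The value at `x` of the sum for the median average. -/
noncomputable def sumMedian (x : ℂ) : ℂ :=
  (sumRight (Complex.log x) + sumLeft (Complex.log x)) / 2

lemma conj_sumMedian {x : ℂ} (hx : 0 < x.re) :
    starRingEnd ℂ (sumMedian x) = sumMedian (starRingEnd ℂ x) := by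
  simp only [sumMedian, sumLeft, log_conj_of_re_pos hx, map_div₀, map_add, Complex.conj_conj,
    map_ofNat]
  rw [add_comm]

lemma hasSummation_iff {m : Weights} {x S : ℂ} : HasSummation F sing m branchG x S ↔
    Tendsto (fun R => ∑ ε, m R ε * pathLaplace sing branchG x R ε) atTop (𝓝 (S - 1)) := by
  rw [HasSummation, HasLaplace, constantCoeff_F, Rat.cast_one]

lemma hasSummation_mur {x : ℂ} (hx : 0 < x.re) :
    HasSummation F sing mur branchG x (sumRight (Complex.log x)) := by
  rw [hasSummation_iff]
  simp only [sum_mur]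
  exact tendsto_pathLaplace_true hx

lemma hasSummation_mul {x : ℂ} (hx : 0 < x.re) :
    HasSummation F sing mul branchG x (sumLeft (Complex.log x)) := by
  rw [hasSummation_iff]
  simp only [sum_mul]
  exact tendsto_pathLaplace_false hx

theorem hasSummation_sumMedian {m : Weights} (hm : IsAverage m) (hr : IsRealityPreserving sing m)
    {x : ℂ} (hx : 0 < x.re) : HasSummation F sing m branchG x (sumMedian x) := by
  rw [hasSummation_iff]
  simp only [sum_mul_pathLaplace hm hr]
  have := ((tendsto_pathLaplace_true hx).add (tendsto_pathLaplace_false hx)).div_const 2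
  convert! this using 2
  rw [sumMedian]
  ring

end KZ

theorem theorem2 :
    -- (a) the Borel transform
    (∀ p : ℂ, ‖p‖ < π ^ 2 / 6 →
      HasSum (fun n => ((PowerSeries.coeff n (KZ.borel KZ.F) : ℚ) : ℂ) * p ^ n) (KZ.G p)) ∧
    (∀ p ∈ KZ.sheet KZ.sing 0, Summable fun n => ‖KZ.termG n p‖) ∧
    -- continuation along all paths that avoid the singular set
    (∀ (q : ℂ) (γ : Path (0 : ℂ) q), (∀ t, γ t ∉ KZ.singSet) →
      ∃ f, KZ.IsContinuationAlong KZ.G γ f) ∧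
    -- every branch is given by the same series, with some determination of each square root
    (∀ (q : ℂ) (γ : Path (0 : ℂ) q), (∀ t, γ t ∉ KZ.singSet) →
      ∀ f, KZ.IsContinuationAlong KZ.G γ f →
        ∃ w : ℕ → ℂ → ℂ, (∀ n, KZ.chi n ≠ 0 → AnalyticAt ℂ (w n) q) ∧
          ∀ᶠ p in 𝓝 q, (∀ n, KZ.chi n ≠ 0 → w n p ^ 2 = (KZ.pt n : ℂ) - p) ∧
            HasSum (fun n => KZ.coeffG n * (w n p ^ 5)⁻¹) (f 1 p)) ∧
    -- near each point of the singular set every branch is `A(p) ± cₙ (n²π²/6 - p)^{-5/2}`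
    (∀ n : ℕ, (KZ.pt n : ℂ) ∈ KZ.singSet → KZ.coeffG n ≠ 0 ∧
      ∀ ρ : ℝ, 0 < ρ → (∀ p ∈ KZ.singSet, p ≠ (KZ.pt n : ℂ) → ρ ≤ ‖p - (KZ.pt n : ℂ)‖) →
        ∀ q ∈ Metric.ball (KZ.pt n : ℂ) ρ, ∀ (γ : Path (0 : ℂ) q), (∀ t, γ t ∉ KZ.singSet) →
          ∀ f, KZ.IsContinuationAlong KZ.G γ f →
            ∃ A w : ℂ → ℂ, AnalyticOnNhd ℂ A (Metric.ball (KZ.pt n : ℂ) ρ) ∧ AnalyticAt ℂ w q ∧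
              ∀ᶠ p in 𝓝 q, w p ^ 2 = (KZ.pt n : ℂ) - p ∧
                f 1 p = A p + KZ.coeffG n * (w p ^ 5)⁻¹) ∧
    -- the branches of `G` along the positive real axis
    (∃ g : KZ.Branches, KZ.IsRamified KZ.sing g ∧
      (∀ p ∈ KZ.sheet KZ.sing 0, g 0 KZ.emptyAddr p = KZ.G p) ∧
      PowerSeries.constantCoeff KZ.F = 1 ∧
      -- (b) `Sl s`, `Sr s` are the values at `x = e^s` of the sums for `mul` (all signs `-`)
      -- and `mur` (all signs `+`), extended to sectors on the Riemann surface of `log x`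
      ∃ Sl Sr Sm δ : ℂ → ℂ,
        DifferentiableOn ℂ Sr {s | s.im ∈ Ioo (-(5 * π / 2)) (π / 2)} ∧
        DifferentiableOn ℂ Sl {s | s.im ∈ Ioo (-(π / 2)) (5 * π / 2)} ∧
        (∀ x : ℂ, 0 < x.re →
          KZ.HasSummation KZ.F KZ.sing KZ.mur g x (Sr (Complex.log x)) ∧
          KZ.HasSummation KZ.F KZ.sing KZ.mul g x (Sl (Complex.log x))) ∧
        (∀ s : ℂ, ∀ ε ∈ Ioo 0 (2 * π), |s.im + ε| < π / 2 →
          KZ.RayIntegrable (fun p => Complex.exp (-Complex.exp s * p) * KZ.G p) ε ∧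
          Sr s = 1 + KZ.rayInt (fun p => Complex.exp (-Complex.exp s * p) * KZ.G p) ε ∧
          KZ.RayIntegrable (KZ.etaKernel (Complex.exp s)) (s.im + ε) ∧
          Sr s = √3 * KZ.rayInt (KZ.etaKernel (Complex.exp s)) (s.im + ε)) ∧
        (∀ s : ℂ, ∀ ε ∈ Ioo 0 (2 * π), |s.im - ε| < π / 2 →
          KZ.RayIntegrable (fun p => Complex.exp (-Complex.exp s * p) * KZ.G p) (-ε) ∧
          Sl s = 1 + KZ.rayInt (fun p => Complex.exp (-Complex.exp s * p) * KZ.G p) (-ε) ∧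
          KZ.RayIntegrable (KZ.etaKernel (Complex.exp s)) (s.im - ε) ∧
          Sl s = √3 * KZ.rayInt (KZ.etaKernel (Complex.exp s)) (s.im - ε)) ∧
        -- (c) reality-preserving averages
        KZ.IsAverage KZ.med ∧ KZ.IsRealityPreserving KZ.sing KZ.med ∧
        (∀ m : KZ.Weights, KZ.IsAverage m → KZ.IsRealityPreserving KZ.sing m →
          ∀ x : ℂ, 0 < x.re → KZ.HasSummation KZ.F KZ.sing m g x (Sm x)) ∧
        (∀ x : ℂ, 0 < x.re →
          Sm x = (Sr (Complex.log x) + Sl (Complex.log x)) / 2 ∧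
          (∀ ε : ℝ, 0 < ε → |x.arg| + ε < π / 2 →
            Sm x = √3 / 2 * (KZ.rayInt (KZ.etaKernel x) (x.arg + ε) +
              KZ.rayInt (KZ.etaKernel x) (x.arg - ε))) ∧
          starRingEnd ℂ (Sm x) = Sm (starRingEnd ℂ x)) ∧
        -- (d) the associated Dirichlet series
        (∀ x : ℂ, 0 < x.re →
          δ x = (Sr (Complex.log x) - Sl (Complex.log x)) / 2 ∧
          δ x = Complex.I * √2 * (π * x) ^ (3 / 2 : ℂ) * KZ.etaTilde (2 * π * Complex.I * x) ∧
          HasSum (fun n : ℕ => Complex.I * √2 * (π * x) ^ (3 / 2 : ℂ) *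
            ((KZ.chi n : ℂ) * (n : ℂ) * Complex.exp (-(KZ.pt n : ℂ) * x))) (δ x)) ∧
        Tendsto (fun k => KZ.sing (k + 1) - KZ.sing k) atTop atTop ∧
        KZ.HasNaturalBoundary δ ∧
        (∀ α : ℚ, ∃ l : ℂ,
          Tendsto (fun t : ℝ => δ ((α : ℂ) / (2 * π * Complex.I) + (t : ℂ))) (𝓝[>] 0) (𝓝 l))) := by
  refine ⟨fun p hp => KZ.hasSum_borel hp, fun p hp => KZ.summable_norm_termG hp,
    fun q γ hγ => KZ.exists_isContinuationAlong γ hγ,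
    fun q γ hγ f hf => KZ.IsContinuationAlong.exists_roots hγ hf, fun n hn => ?_,
    KZ.branchG, KZ.isRamified_branchG, fun p _ => KZ.branchG_zero _ p, KZ.constantCoeff_F,
    KZ.sumLeft, KZ.sumRight, KZ.sumMedian, KZ.lateralDiff,
    fun s hs => (KZ.differentiableAt_sumRight hs).differentiableWithinAt,
    fun s hs => (KZ.differentiableAt_sumLeft hs).differentiableWithinAt,
    fun x hx => ⟨KZ.hasSummation_mur hx, KZ.hasSummation_mul hx⟩, fun s ε hε hs => ?_,
    fun s ε hε hs => ?_, KZ.isAverage_med, KZ.isRealityPreserving_med,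
    fun m hm hr x hx => KZ.hasSummation_sumMedian hm hr hx, fun x hx => ⟨rfl, ?_,
      KZ.conj_sumMedian hx⟩,
    fun x hx => ⟨rfl, KZ.lateralDiff_eq hx, KZ.hasSum_lateralDiff hx⟩, KZ.tendsto_sing_gap,
    KZ.hasNaturalBoundary_lateralDiff, KZ.exists_radial_limit⟩
  · have hn' := KZ.mem_of_pt_mem_singSet hn
    exact ⟨KZ.coeffG_ne_zero hn', fun _ _ hsep q hq γ hγ f hf =>
      KZ.IsContinuationAlong.exists_singular_form hn' hsep hq hγ hf⟩
  · refine ⟨KZ.rayIntegrable_laplace hε ?_, KZ.sumRight_eq hε hs,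
      (KZ.rayIntegrable_etaKernel_and_hasSum hε hs).1, KZ.sumRight_eq_eta hε hs⟩
    rw [KZ.exp_mul_exp_I_re]
    exact mul_pos (Real.exp_pos _) (KZ.cos_pos_of_abs_lt hs)
  · refine ⟨KZ.rayIntegrable_laplace_neg hε ?_, KZ.sumLeft_eq hε hs,
      (KZ.sumLeft_eq_eta hε hs).1, (KZ.sumLeft_eq_eta hε hs).2⟩
    rw [KZ.exp_mul_exp_I_re]
    exact mul_pos (Real.exp_pos _) (KZ.cos_pos_of_abs_lt hs)
  · intro ε hε hs
    have h1 : |(Complex.log x).im + ε| < π / 2 := by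
      rw [Complex.log_im]
      exact (abs_add_le _ _).trans_lt (by rwa [abs_of_pos hε])
    have h2 : |(Complex.log x).im - ε| < π / 2 := by
      rw [Complex.log_im]
      exact (abs_sub _ _).trans_lt (by rwa [abs_of_pos hε])
    have hmem : ε ∈ Ioo 0 (2 * π) := ⟨hε, by linarith [abs_nonneg x.arg, Real.pi_pos]⟩
    have hx0 : x ≠ 0 := by rintro rfl; simp at hx
    have h3 := KZ.sumRight_eq_eta hmem h1
    have h4 := (KZ.sumLeft_eq_eta hmem h2).2
    rw [Complex.exp_log hx0, Complex.log_im] at h3 h4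
    rw [KZ.sumMedian, h3, h4]
    ring
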